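/- **Setting.** Let $n,k\ge 1$, let $\mathcal N$ be a smooth manifold of dimension $n+k$ and $\omega$ a smooth closed nowhere vanishing $n$-form on $\mathcal N$. For $q\in\mathcal N$ let $D^\omega_q\mathcal N\subset\Lambda^nT_q\mathcal N$ be the set of decomposable $n$-vectors $z$ with $\langle z,\omega_q\rangle=1$ (identified with the set $Gr^\omega_q\mathcal N$ of oriented $n$-planes of $T_q\mathcal N$ on which $\omega$ is positive), let $L$ be a smooth real function on $Gr^\omega\mathcal N\simeq D^\omega\mathcal N$, and put $W(q,z,p)=\langle z,p\rangle-L(q,z)$ for $p\in\Lambda^nT^*_q\mathcal N$. Let $P_q(z)=\{p:\partial W/\partial z(q,z,p)=0\}$, where $\partial/\partial z$ is the differential along $D^\omega_q\mathcal N$, and $Z_q(p)=\{z\in D^\omega_q\mathcal N: p\in P_q(z)\}$; let $(T_zD^\omega_q\mathcal N)^\perp\subset\Lambda^nT_q^*\mathcal N$ be the annihilator of $T_zD^\omega_q\mathcal N$. Let $\mathcal M\subset\Lambda^nT^*\mathcal N$ be a smooth submanifold fibred over $\mathcal N$, whose fibres $\mathcal M_q$ are smooth submanifolds, possibly with boundary,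 of $\Lambda^nT^*_q\mathcal N$ of a fixed dimension between $1$ and $\binom{n+k}{n}$, such that for every $(q,p)\in\mathcal M$: (a) $Z_q(p)$ is a nonempty connected smooth submanifold; (b) for each $z_0\in Z_q(p)$, $Z_q(p)=\{z\in D^\omega_q\mathcal N:\langle z-z_0,\dot p\rangle=0\ \ \forall \dot p\in T_p\mathcal M_q\}$; (c) the correspondence is smooth, i.e. through each $z_0\in Z_q(p)$ passes a smooth local section $(q',p')\mapsto z(q',p')\in Z_{q'}(p')$ over a neighbourhood of $(q,p)$ in $\mathcal M$. Define $\mathcal H:\mathcal M\to\mathbb R$ by $\mathcal H(q,p)=W(q,z,p)$ with $z\in Z_q(p)$. Let $\widehat{\mathcal G}^\omega$ be the set of $n$-dimensional submanifolds $\Gamma$ of $\mathcal M$ which project to an embedded submanifold $\Pi(\Gamma)$ of $\mathcal N$ (so that $\Gamma$ is the graph of a smooth section $q\mapsto p(q)$ over it) and on which $\omega$ does not vanish, oriented by $\omega|_\Gamma>0$. For such $\Gamma$ and $q\in\Pi(\Gamma)$ let $z_\Gamma(q)\in D^\omega_q\mathcal N$ be the $n$-vector that spans $T_q\Pi(\Gamma)$.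 Let $\theta_{(q,p)}(X_1,\dots,X_n)=p(\Pi_*X_1,\dots,\Pi_*X_n)$ and $\mathcal I[\Gamma]=\int_\Gamma\theta-\mathcal H\omega$. Call $\Gamma$ a critical point of $\mathcal I$ if for every compact $K\subset\Gamma$ and every smooth deformation $\Gamma_s$ of $\Gamma_0=\Gamma$ with support in $K$ and with $\Gamma_s\subset\mathcal M$ for small $s\ge 0$, the derivative from the right at $s=0$ of the action on (the deformed) $K$ is zero. **Statement.** Let $\Gamma\in\widehat{\mathcal G}^\omega$ be a critical point of $\mathcal I$. Then $z_\Gamma(q)\in Z_q(p)$ for all $(q,p)\in\Gamma$, and: 1. If $\pi$ is a smooth section of $\Lambda^nT^*\mathcal N$ over $\Pi(\Gamma)$ with $\pi(q)\in(T_zD^\omega_q\mathcal N)^\perp$ for $z=z_\Gamma(q)\in Z_q(p)$ and all $(q,p)\in\Gamma$, and if $\widetilde\Gamma=\{(q,p+\pi(q)):(q,p)\in\Gamma\}$ lies in $\mathcal M$, then $\widetilde\Gamma\in\widehat{\mathcal G}^\omega$ is again a critical point of $\mathcal I$. 2. In particular, for $h,t\in\mathbb R$ let $\Gamma_t=\{(q,p+t(h-\mathcal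 H(q,p))\omega_q):(q,p)\in\Gamma\}$. If $\Gamma_t\subset\mathcal M$, then $\Gamma_t\in\widehat{\mathcal G}^\omega$ is a critical point of $\mathcal I$, and $\mathcal H=(1-t)\mathcal H(q,p)+t h$ at its point over $q$. So $\Gamma_0=\Gamma$ is deformed into the critical point $\Gamma_1$, which lies in the level set $\mathcal M^h=\{\mathcal H=h\}$. -/

import Mathlib

open Set Filter Topology
open scoped Manifold ContDiff

noncomputable section

namespace LepageDedecker

/-- The model space `ℝ^d`. For a manifold `N` modelled on `E d`, Mathlib's tangent space
`TangentSpace 𝓘(ℝ, E d) q` is by definition the type `E d` (a tangent vector being read in the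
preferred chart at `q`), so that forms and multivectors at `q` are forms and multivectors on
`E d`. -/
abbrev E (d : ℕ) : Type := EuclideanSpace ℝ (Fin d)

/-- Alternating `n`-forms on a `d`-dimensional space: the fibre `Λⁿ T*_q N`. -/
abbrev Form (n d : ℕ) : Type := (E d) [⋀^Fin n]→L[ℝ] ℝ

/-- `n`-vectors on a `d`-dimensional space: the fibre `Λⁿ T_q N`, realised as the dual of the
finite-dimensional space of `n`-forms through the duality pairing `⟨z, p⟩ = z p`. -/
abbrev NVec (n d : ℕ) : Type := Form n d →L[ℝ] ℝ

/-- The decomposable `n`-vector `v₁ ∧ ⋯ ∧ vₙ`, i.e. `p ↦ p (v₁, …, vₙ)`. -/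
def wedge {n d : ℕ} (v : Fin n → E d) : NVec n d :=
  ContinuousAlternatingMap.apply ℝ (E d) ℝ v

/-- Push-forward `A_* z` of an `n`-vector by a linear map: `⟨A_* z, p⟩ = ⟨z, A^* p⟩`. -/
def pushNVec {n d : ℕ} (A : E d →L[ℝ] E d) (z : NVec n d) : NVec n d :=
  z.comp (ContinuousAlternatingMap.compContinuousLinearMapCLM A)

/-- The tangent space at `a` of a subset `A` of a normed space, used for submanifolds (possibly
with boundary): the span of all limits of rescaled secants at `a`. -/
def tangent {V : Type*} [NormedAddCommGroup V] [NormedSpace ℝ V] (A : Set V) (a : V) :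
    Submodule ℝ V :=
  Submodule.span ℝ (tangentConeAt ℝ A a)

/-- `A` is a smooth embedded submanifold (without boundary) of `V`. -/
def IsSubmanifold {V : Type*} [NormedAddCommGroup V] [NormedSpace ℝ V] (A : Set V) : Prop :=
  ∀ a ∈ A, ∃ (Φ : OpenPartialHomeomorph V V) (S : Submodule ℝ V), a ∈ Φ.source ∧
    ContDiffOn ℝ ∞ Φ Φ.source ∧ ContDiffOn ℝ ∞ Φ.symm Φ.target ∧
    ∀ v ∈ Φ.source, v ∈ A ↔ Φ v ∈ S

section Bundle

variable {n d : ℕ} {N : Type*} [TopologicalSpace N] [ChartedSpace (E d) N]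

/-- The points of the bundle `Λⁿ T* N`: a point `q` of `N` and an `n`-form `p` on `T_q N`. -/
structure FormBundle (n d : ℕ) (N : Type*) where
  /-- The base point `q`. -/
  pt : N
  /-- The `n`-form `p ∈ Λⁿ T*_q N`. -/
  form : Form n d

variable [IsManifold 𝓘(ℝ, E d) ∞ N]

/-- The change of coordinates `T_q N → T_q N` from the chart centred at `c` to the preferred chart
at `q` (the one in which `TangentSpace` at `q` is read). -/
def fromChart (c q : N) : E d →L[ℝ] E d := tangentCoordChange 𝓘(ℝ, E d) c q q

/-- The inverse change of coordinates, from the preferred chart at `q` to the chart at `c`. -/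
def toChart (c q : N) : E d →L[ℝ] E d := tangentCoordChange 𝓘(ℝ, E d) q c q

/-- Coordinates `(q^α, p_{α₁⋯αₙ})` of a point of `Λⁿ T* N` in the chart of `N` centred at `c`. -/
def coord (c : N) (m : FormBundle n d N) : E d × Form n d :=
  (extChartAt 𝓘(ℝ, E d) c m.pt, m.form.compContinuousLinearMap (fromChart c m.pt))

/-- The point of `Λⁿ T* N` with given coordinates in the chart of `N` centred at `c`. -/
def ofCoord (c : N) (a : E d × Form n d) : FormBundle n d N :=
  ⟨(extChartAt 𝓘(ℝ, E d) c).symm a.1,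
    a.2.compContinuousLinearMap (toChart c ((extChartAt 𝓘(ℝ, E d) c).symm a.1))⟩

/-- Smoothness of a map from a manifold `A` to the manifold `Λⁿ T* N`: the base point is a smooth
function, and near each `a` the components of the form in a chart are smooth functions. -/
def SmoothForm {F H : Type*} [NormedAddCommGroup F] [NormedSpace ℝ F] [TopologicalSpace H]
    (I : ModelWithCorners ℝ F H) {A : Type*} [TopologicalSpace A] [ChartedSpace H A]
    (f : A → FormBundle n d N) : Prop :=
  ContMDiff I 𝓘(ℝ, E d) ∞ (fun a => (f a).pt) ∧
    ∀ a, ContMDiffAt I 𝓘(ℝ, Form n d) ∞ (fun b => (coord (f a).pt (f b)).2) a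

/-- `om` (written `ω` in the comments) is a smooth closed nowhere vanishing `n`-form on `N`. -/
structure IsSpaceTimeVolume (om : N → Form n d) : Prop where
  smooth : SmoothForm 𝓘(ℝ, E d) (fun q : N => (⟨q, om q⟩ : FormBundle n d N))
  ne_zero : ∀ q, om q ≠ 0
  closed : ∀ c : N, ∀ x ∈ (extChartAt 𝓘(ℝ, E d) c).target,
    extDeriv (fun y => (coord c (⟨(extChartAt 𝓘(ℝ, E d) c).symm y,
      om ((extChartAt 𝓘(ℝ, E d) c).symm y)⟩ : FormBundle n d N)).2) x = 0

/-- `D^ω_q N`: decomposable `n`-vectors `z` with `⟨z, ω_q⟩ = 1`. It is identified with the set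
`Gr^ω_q N` of oriented `n`-planes in `T_q N` on which `ω` is positive. -/
def planes (om : N → Form n d) (q : N) : Set (NVec n d) :=
  {z | z ∈ range wedge ∧ z (om q) = 1}

/-- The Lagrangian density `L` is smooth on `Gr^ω N ≃ D^ω N`. Only the values `L q z` with
`z ∈ D^ω_q N` matter. Smoothness is tested on the bundle of `n`-frames `v` with `ω (v) > 0`, which
is mapped to `D^ω N` by the surjective submersion `v ↦ v₁ ∧ ⋯ ∧ vₙ / ω (v)`. -/
def SmoothLagrangian (om : N → Form n d) (L : N → NVec n d → ℝ) : Prop :=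
  ∀ c : N, ContDiffOn ℝ ∞
    (fun a : E d × (Fin n → E d) =>
      let q := (extChartAt 𝓘(ℝ, E d) c).symm a.1
      let v : Fin n → E d := fun i => fromChart c q (a.2 i)
      L q ((om q v)⁻¹ • wedge v))
    {a | a.1 ∈ (extChartAt 𝓘(ℝ, E d) c).target ∧
      0 < om ((extChartAt 𝓘(ℝ, E d) c).symm a.1)
        (fun i => fromChart c ((extChartAt 𝓘(ℝ, E d) c).symm a.1) (a.2 i))}

/-- `W (q, z, p) = ⟨z, p⟩ - L (q, z)`. -/
def W (L : N → NVec n d → ℝ) (q : N) (z : NVec n d) (p : Form n d) : ℝ := z p - L q z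

/-- `p ∈ P_q (z)` (equivalently `z ∈ Z_q (p)`): the plane `z` lies in `D^ω_q N` and
`∂W/∂z (q, z, p) = 0`, i.e. the differential at `z` of `W (q, ·, p)` along `D^ω_q N` is zero. -/
def Corresponds (om : N → Form n d) (L : N → NVec n d → ℝ) (q : N) (z : NVec n d)
    (p : Form n d) : Prop :=
  z ∈ planes om q ∧ HasFDerivWithinAt (fun z' => W L q z' p) (0 : NVec n d →L[ℝ] ℝ) (planes om q) z

/-- `Z_q (p)`. -/
def Z (om : N → Form n d) (L : N → NVec n d → ℝ) (m : FormBundle n d N) : Set (NVec n d) :=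
  {z | Corresponds om L m.pt z m.form}

/-- The annihilator `(T_z D^ω_q N)^⊥ ⊆ Λⁿ T*_q N`. -/
def tangentAnnihilator (om : N → Form n d) (q : N) (z : NVec n d) : Set (Form n d) :=
  {p | ∀ ζ ∈ tangent (planes om q) z, ζ p = 0}

/-- The fibre `ℳ_q` of a subset `ℳ` of `Λⁿ T* N`. -/
def fibre (M : Set (FormBundle n d N)) (q : N) : Set (Form n d) := {p | ⟨q, p⟩ ∈ M}

open Classical in
/-- The Hamiltonian `ℋ (q, p) = W (q, z, p)` where `z ∈ Z_q (p)`. -/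
def hamiltonian (om : N → Form n d) (L : N → NVec n d → ℝ) (m : FormBundle n d N) : ℝ :=
  if h : (Z om L m).Nonempty then W L m.pt h.some m.form else 0

/-- `ℳ` is a smooth submanifold of `Λⁿ T* N` fibred over `N`, whose fibres `ℳ_q` are
`r`-dimensional submanifolds, possibly with boundary, of `Λⁿ T*_q N`: near each of its points there
is a fibre-preserving diffeomorphism that straightens every fibre to an open piece of a
fixed `r`-dimensional space `S`, or of a half-space `{y ∈ S, 0 ≤ lam y}` of it. -/
def IsSubbundle (M : Set (FormBundle n d N)) (r : ℕ) : Prop :=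
  ∀ m ∈ M, ∃ (Ψ : OpenPartialHomeomorph (E d × Form n d) (E d × Form n d))
    (S : Submodule ℝ (Form n d)) (lam : Form n d →L[ℝ] ℝ),
    Module.finrank ℝ S = r ∧
    coord m.pt m ∈ Ψ.source ∧
    (∀ a ∈ Ψ.source, a.1 ∈ (extChartAt 𝓘(ℝ, E d) m.pt).target ∧ (Ψ a).1 = a.1) ∧
    ContDiffOn ℝ ∞ Ψ Ψ.source ∧ ContDiffOn ℝ ∞ Ψ.symm Ψ.target ∧
    ∀ a ∈ Ψ.source, ofCoord m.pt a ∈ M ↔ (Ψ a).2 ∈ S ∧ 0 ≤ lam (Ψ a).2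

/-- The Legendre Correspondence Hypothesis for `ℳ`, with fibres of dimension `r`. -/
structure LegendreCorrespondenceHypothesis (om : N → Form n d) (L : N → NVec n d → ℝ)
    (M : Set (FormBundle n d N)) (r : ℕ) : Prop where
  subbundle : IsSubbundle M r
  one_le : 1 ≤ r
  le_choose : r ≤ d.choose n
  /-- `Z_q (p)` is connected (in particular nonempty, so that `ℳ ⊆ 𝒫`). -/
  connected : ∀ m ∈ M, IsConnected (Z om L m)
  submanifold : ∀ m ∈ M, IsSubmanifold (Z om L m)
  eq_of_mem : ∀ m ∈ M, ∀ z₀ ∈ Z om L m,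
    Z om L m = {z | z ∈ planes om m.pt ∧ ∀ p ∈ tangent (fibre M m.pt) m.form, (z - z₀) p = 0}
  /-- The correspondence is smooth: through each `z₀ ∈ Z_q (p)` passes a smooth local
  section `(q', p') ↦ z' ∈ Z_{q'} (p')` over `ℳ` (written in the chart at `q`). -/
  smooth_section : ∀ m ∈ M, ∀ z₀ ∈ Z om L m,
    ∃ (U : Set (E d × Form n d)) (f : E d × Form n d → NVec n d),
      IsOpen U ∧ coord m.pt m ∈ U ∧ ContDiffOn ℝ ∞ f U ∧
      pushNVec (fromChart m.pt m.pt) (f (coord m.pt m)) = z₀ ∧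
      ∀ a ∈ U, a.1 ∈ (extChartAt 𝓘(ℝ, E d) m.pt).target → ofCoord m.pt a ∈ M →
        pushNVec (fromChart m.pt (ofCoord m.pt a).pt) (f a) ∈ Z om L (ofCoord m.pt a)

end Bundle

section Integral

variable {n : ℕ} {X : Type*} [TopologicalSpace X] [ChartedSpace (E n) X]

/-- The coefficient at `x` of an `n`-form `α` on the `n`-manifold `X` in the chart centred at `c`:
`α = (coeff c α x) dx¹ ∧ ⋯ ∧ dxⁿ`. -/
def coeff [IsManifold 𝓘(ℝ, E n) ∞ X] (c : X) (α : X → Form n n) (x : X) : ℝ :=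
  α x (fun i => fromChart c x (EuclideanSpace.single i 1))

variable [T2Space X] [SigmaCompactSpace X] [IsManifold 𝓘(ℝ, E n) ∞ X]

/-- A smooth partition of unity subordinate to the charts of `X`. -/
def chartPartition (X : Type*) [TopologicalSpace X] [ChartedSpace (E n) X] [T2Space X]
    [SigmaCompactSpace X] [IsManifold 𝓘(ℝ, E n) ∞ X] :
    SmoothPartitionOfUnity X 𝓘(ℝ, E n) X univ :=
  (SmoothPartitionOfUnity.exists_isSubordinate_chartAt_source 𝓘(ℝ, E n) X).choose

/-- The integral over `K ⊆ X` of an `n`-form `α`, where `X` is oriented by the nowhere vanishing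
`n`-form `ν`, computed in charts by means of a partition of unity. -/
def integralForm (ν : X → Form n n) (K : Set X) (α : X → Form n n) : ℝ :=
  ∑ᶠ c : X, ∫ y in (extChartAt 𝓘(ℝ, E n) c).target,
    let x := (extChartAt 𝓘(ℝ, E n) c).symm y
    chartPartition (n := n) X c x * K.indicator (fun x => SignType.sign (coeff c ν x) * coeff c α x) x

end Integral

section Curves

variable {n d : ℕ} {N : Type*} [TopologicalSpace N] [ChartedSpace (E d) N]
  {X : Type*} [TopologicalSpace X] [ChartedSpace (E n) X]

/-- The differential at `x` of the map `Π ∘ γ : X → N` under `γ : X → Λⁿ T* N`. -/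
def dbase (γ : X → FormBundle n d N) (x : X) : E n →L[ℝ] E d :=
  mfderiv 𝓘(ℝ, E n) 𝓘(ℝ, E d) (fun x => (γ x).pt) x

/-- The pull-back `γ^* ω` to `X` of (the lift to `Λⁿ T* N` of) `ω`. -/
def pullVolume (om : N → Form n d) (γ : X → FormBundle n d N) (x : X) : Form n n :=
  (om (γ x).pt).compContinuousLinearMap (dbase γ x)

/-- The pull-back `γ^* θ` to `X` of the Poincaré–Cartan form
`θ_{(q,p)} (X₁, …, Xₙ) = p (Π_* X₁, …, Π_* Xₙ)`. -/
def pullTheta (γ : X → FormBundle n d N) (x : X) : Form n n :=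
  (γ x).form.compContinuousLinearMap (dbase γ x)

/-- The unique `n`-vector in `D^ω_q N`, `q = Π (γ (x))`, that spans the tangent plane
of `Π (Γ)` at `q`. -/
def planeAt (om : N → Form n d) (γ : X → FormBundle n d N) (x : X) : NVec n d :=
  (pullVolume om γ x (fun i => EuclideanSpace.single i 1))⁻¹ •
    wedge (fun i => dbase γ x (EuclideanSpace.single i 1))

variable [IsManifold 𝓘(ℝ, E d) ∞ N]

/-- `Γ = γ (X)` is an element of `𝒢̂^ω`: an `n`-dimensional submanifold of `ℳ`, on which `ω` does
not vanish, and which projects to an embedded submanifold `Π (Γ)` of `N`. It is oriented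
by `ω|_Γ > 0`. -/
structure IsCurve (om : N → Form n d) (M : Set (FormBundle n d N)) (γ : X → FormBundle n d N) :
    Prop where
  smooth : SmoothForm 𝓘(ℝ, E n) γ
  embedding : IsEmbedding (fun x => (γ x).pt)
  volume_ne_zero : ∀ x, pullVolume om γ x ≠ 0
  mem : ∀ x, γ x ∈ M

variable [T2Space X] [SigmaCompactSpace X] [IsManifold 𝓘(ℝ, E n) ∞ X]

/-- `∫_{γ(K)} θ - ℋ ω`, where `X` carries the orientation of the `n`-form `ν`. -/
def action (om : N → Form n d) (L : N → NVec n d → ℝ) (ν : X → Form n n) (K : Set X)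
    (γ : X → FormBundle n d N) : ℝ :=
  integralForm ν K (fun x => pullTheta γ x - hamiltonian om L (γ x) • pullVolume om γ x)

/-- `Γ` is a critical point of `ℐ [Γ] = ∫_Γ θ - ℋ ω`: for each compact `K`, the first variation at
`s = 0` of the action on `K` vanishes along each smooth deformation `Γ_s` of `Γ = Γ_0` in `ℳ` with
support in `K`. Since `ℳ` may have a boundary, `Γ_s` has to be in `ℳ` only for small `s ≥ 0`, and
the derivative is taken from the right. -/
def IsCritical (om : N → Form n d) (L : N → NVec n d → ℝ) (M : Set (FormBundle n d N))
    (γ : X → FormBundle n d N) : Prop :=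
  ∀ (K : Set X) (σ : ℝ → X → FormBundle n d N), IsCompact K →
    SmoothForm (𝓘(ℝ, ℝ).prod 𝓘(ℝ, E n)) (fun a : ℝ × X => σ a.1 a.2) →
    σ 0 = γ → (∀ s, ∀ x, x ∉ K → σ s x = γ x) →
    (∃ ε > 0, ∀ s, 0 ≤ s → s < ε → ∀ x, σ s x ∈ M) →
    HasDerivWithinAt (fun s => action om L (pullVolume om γ) K (σ s)) 0 (Ici 0) 0

/-- The submanifold `{(q, p + π (q)) : (q, p) ∈ Γ}`. -/
def shift (γ : X → FormBundle n d N) (π : X → Form n d) (x : X) : FormBundle n d N :=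
  ⟨(γ x).pt, (γ x).form + π x⟩

end Curves

end LepageDedecker

end

noncomputable section

namespace LepageDedecker

/-! ### Smooth multilinear algebra: forms, decomposable n-vectors and the frames that span them -/

section Multilinear

variable {n d m : ℕ}

/-! In charts let v be the coordinate frame tangent to Π(Γ) at q, and z_v = v₁ ∧ ⋯ ∧ vₙ / ω(v). The
integrand of the action is p(v) - ℋ(q, p) ω(v), and the whole proof rests on its first-order
behaviour. This is governed by the envelope principle: every z ∈ Z_q(p) is a critical point of W(q,
·, p), so inserting a smooth section z(q, p) into W gives a smooth local extension of ℋ with ∂ℋ/∂p =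
z (`exists_localHamiltonian`).

Vertical variations. If the base is fixed and the form moves in a direction ζ tangent to ℳ_q, the
integrand changes at the rate ⟨z_v - z₀, ζ⟩ ω(v), for any z₀ ∈ Z_q(p). The fundamental lemma of the
calculus of variations forces this to vanish (`planeAt_sub_apply_eq_zero`), and hypothesis (b) turns
the resulting equations into z_Γ ∈ Z_q(p) (`planeAt_mem`). On the boundary of ℳ_q only inward
directions are allowed, but of two opposite directions one is always allowed, and criticality is an
equality, so the whole tangent space is reached.

Independence of p. Once z_v ∈ Z_q(p), the excess ω(v) (W(q, z_v, p) - ℋ(q, p)) vanishes together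
with its differential. Hence the integrand agrees to first order with ω(v) L(q, z_v), which does not
contain p, and the first variation depends only on the velocity of the base
(`coeff_initialDeriv_actionForm`). Criticality therefore passes from γ to any γ' over the same base
whose forms also correspond to the tangent planes (`IsCritical.congr_base`), provided that the base
velocities of deformations of γ' are realised by deformations of γ inside ℳ. Locally this is done by
keeping the fibre coordinate constant in a straightening of ℳ. Globally, a partition of unity that
slows down time writes the velocity as a linear combination of velocities of such lifts, and the
first variation is linear in the velocity.

Shifts. Adding π ∈ (T_z D^ω)^⊥ to p leaves ∂W/∂z unchanged, so the planes still correspond. The form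
ω is such an annihilator because ⟨·, ω⟩ = 1 on D^ω, and W(q, z, p + cω) = W(q, z, p) + c shows that
ℋ grows by c. -/

@[simp] theorem wedge_apply (v : Fin n → E d) (p : Form n d) : wedge v p = p v := rfl

theorem contDiff_wedge : ContDiff ℝ ∞ (wedge : (Fin n → E d) → NVec n d) := by
  let f : ContinuousMultilinearMap ℝ (fun _ : Fin n => E d) (NVec n d) :=
    (ContinuousLinearMap.flipAlternating
      (ContinuousLinearMap.id ℝ (Form n d))).toContinuousMultilinearMap
  exact ContinuousMultilinearMap.contDiff (𝕜 := ℝ) (E := fun _ : Fin n => E d) (F := NVec n d) f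

theorem contDiff_form_apply :
    ContDiff ℝ ∞ (fun a : Form n d × (Fin n → E d) => a.1 a.2) :=
  (contDiff_wedge.comp contDiff_snd).clm_apply contDiff_fst

/-- Antisymmetrisation, divided by `n!`: a continuous left inverse of the inclusion of forms into
multilinear maps. -/
def antisymmetrize (n d : ℕ) :
    ContinuousMultilinearMap ℝ (fun _ : Fin n => E d) ℝ →L[ℝ] Form n d :=
  LinearMap.mkContinuous
    { toFun := fun f => ((n.factorial : ℝ)⁻¹) • ContinuousMultilinearMap.alternatization f
      map_add' := fun f g => by rw [map_add, smul_add]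
      map_smul' := fun c f => by
        ext v
        change (n.factorial : ℝ)⁻¹ * ContinuousMultilinearMap.alternatization (c • f) v =
          c * ((n.factorial : ℝ)⁻¹ * ContinuousMultilinearMap.alternatization f v)
        rw [mul_left_comm c]
        congr 1
        rw [ContinuousMultilinearMap.alternatization_apply_apply,
          ContinuousMultilinearMap.alternatization_apply_apply, Finset.mul_sum]
        refine Finset.sum_congr rfl fun σ _ => ?_
        exact (mul_smul_comm (Equiv.Perm.sign σ) c (f (v ∘ σ))).symm }
    1 (fun f => by
      rw [one_mul]
      refine ContinuousAlternatingMap.opNorm_le_bound _ (norm_nonneg _) fun v => ?_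
      have hfac : (0 : ℝ) < n.factorial := by positivity
      simp only [LinearMap.coe_mk, AddHom.coe_mk, ContinuousAlternatingMap.smul_apply,
        ContinuousMultilinearMap.alternatization_apply_apply, norm_smul, norm_inv,
        Real.norm_natCast]
      rw [inv_mul_le_iff₀ hfac]
      refine (norm_sum_le _ _).trans ?_
      have : ∀ σ ∈ (Finset.univ : Finset (Equiv.Perm (Fin n))),
          ‖Equiv.Perm.sign σ • f (v ∘ σ)‖ ≤ ‖f‖ * ∏ i, ‖v i‖ := fun σ _ => by
        rw [Units.smul_def, zsmul_eq_mul, norm_mul]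
        have h1 : ‖(((Equiv.Perm.sign σ : ℤˣ) : ℤ) : ℝ)‖ = 1 := by
          rcases Int.units_eq_one_or (Equiv.Perm.sign σ) with h | h <;> simp [h]
        rw [h1, one_mul]
        refine (f.le_opNorm _).trans_eq ?_
        congr 1
        exact Equiv.prod_comp σ (fun i => ‖v i‖)
      refine (Finset.sum_le_sum this).trans_eq ?_
      simp [Finset.card_univ, Fintype.card_perm])

theorem antisymmetrize_coe (p : Form n d) :
    antisymmetrize n d p.toContinuousMultilinearMap = p := by
  ext v
  have h := congrArg (fun f : (E d) [⋀^Fin n]→ₗ[ℝ] ℝ => f v)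
    (AlternatingMap.coe_alternatization p.toAlternatingMap)
  have hfac : (n.factorial : ℝ) ≠ 0 := by positivity
  simp only [MultilinearMap.alternatization_apply, AlternatingMap.smul_apply,
    Fintype.card_fin, nsmul_eq_mul] at h
  simp only [antisymmetrize, LinearMap.mkContinuous_apply, LinearMap.coe_mk, AddHom.coe_mk,
    ContinuousAlternatingMap.smul_apply, ContinuousMultilinearMap.alternatization_apply_apply,
    smul_eq_mul]
  rw [inv_mul_eq_iff_eq_mul₀ hfac]
  exact h

/-- As a multilinear map the pull-back is linear in the form and multilinear in the linear map,
hence smooth. Applying `antisymmetrize`, which fixes forms, carries this smoothness over to the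
space of forms. -/
theorem contDiff_pullback :
    ContDiff ℝ ∞ (fun a : Form n d × (E m →L[ℝ] E d) => a.1.compContinuousLinearMap a.2) := by
  have h : (fun a : Form n d × (E m →L[ℝ] E d) => a.1.compContinuousLinearMap a.2) =
      fun a => antisymmetrize n m
        (ContinuousMultilinearMap.compContinuousLinearMapContinuousMultilinear ℝ
          (fun _ : Fin n => E m) (fun _ => E d) ℝ (fun _ => a.2)
          (ContinuousAlternatingMap.toContinuousMultilinearMapCLM ℝ a.1)) := by
    funext a
    rw [← antisymmetrize_coe (a.1.compContinuousLinearMap a.2)]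
    rfl
  rw [h]
  refine (antisymmetrize n m).contDiff.comp (ContDiff.clm_apply ?_ ?_)
  · exact (ContinuousMultilinearMap.contDiff _).comp (contDiff_pi.2 fun _ => contDiff_snd)
  · exact (ContinuousLinearMap.contDiff _).comp contDiff_fst

/-- Pulled back to ℝⁿ along u, an n-form is a multiple of the determinant. -/
theorem form_linearCombination (p : Form n d) (C : Matrix (Fin n) (Fin n) ℝ) (u : Fin n → E d) :
    p (fun i => ∑ k, C i k • u k) = C.det * p u := by
  have h := AlternatingMap.eq_smul_basis_det (Pi.basisFun ℝ (Fin n))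
    (p.toAlternatingMap.compLinearMap (Fintype.linearCombination ℝ u))
  have h2 := congrArg (fun f : (Fin n → ℝ) [⋀^Fin n]→ₗ[ℝ] ℝ => f C) h
  have h3 : (fun i => Fintype.linearCombination ℝ u (Pi.basisFun ℝ (Fin n) i)) = u := by
    funext i
    rw [Pi.basisFun_apply, Fintype.linearCombination_apply_single, one_smul]
  calc p (fun i => ∑ k, C i k • u k)
      = p (fun i => Fintype.linearCombination ℝ u (Pi.basisFun ℝ (Fin n) i)) *
          (Pi.basisFun ℝ (Fin n)).det C := h2
    _ = C.det * p u := by rw [h3, mul_comm, Pi.basisFun_det]; rfl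

theorem wedge_linearCombination (C : Matrix (Fin n) (Fin n) ℝ) (u : Fin n → E d) :
    wedge (fun i => ∑ k, C i k • u k) = C.det • wedge u := by
  ext p
  exact form_linearCombination p C u

/-- The determinant of the components of `n` vectors given by a linear map to `ℝⁿ`. -/
def detForm (A : E d →L[ℝ] (Fin n → ℝ)) : Form n d :=
  { (Matrix.detRowAlternating (n := Fin n) (R := ℝ)).compLinearMap A.toLinearMap with
    cont := by
      change Continuous fun v : Fin n → E d => Matrix.det (fun i => A (v i))
      exact Continuous.matrix_det (continuous_pi fun i => A.continuous.comp (continuous_apply i)) }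

theorem detForm_apply (A : E d →L[ℝ] (Fin n → ℝ)) (v : Fin n → E d) :
    detForm A v = Matrix.det (Matrix.of fun i => A (v i)) := rfl

theorem linearIndependent_of_form_ne_zero {p : Form n d} {u : Fin n → E d} (h : p u ≠ 0) :
    LinearIndependent ℝ u := by
  by_contra hu
  exact h (p.toAlternatingMap.map_linearDependent u hu)

/-- The component `j` of the `i`-th column of cofactors, used to recover a frame from the
`n`-vector it spans. -/
def frameForm (A : E d →L[ℝ] (Fin n → ℝ)) (i : Fin n) (j : Fin d) : Form n d :=
  detForm (ContinuousLinearMap.pi fun k =>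
    if k = i then EuclideanSpace.proj j else (ContinuousLinearMap.proj k).comp A)

/-- Cramer's rule: the determinant with one column replaced by the j-th components is an entry of
adjugate times frame. The left side is an n-form in v, so this entry depends linearly on the
n-vector alone. -/
theorem frameForm_apply (A : E d →L[ℝ] (Fin n → ℝ)) (i : Fin n) (j : Fin d) (v : Fin n → E d) :
    frameForm A i j v =
      ∑ k, (Matrix.of fun i => A (v i)).adjugate i k * v k j := by
  have h : frameForm A i j v =
      Matrix.cramer (Matrix.of fun i => A (v i)) (fun k => v k j) i := by
    rw [Matrix.cramer_apply, frameForm, detForm_apply]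
    congr 1
    ext k l
    by_cases hl : l = i <;> simp [hl]
  rw [h, Matrix.cramer_eq_adjugate_mulVec]
  rfl

/-- A frame depending linearly on the `n`-vector. -/
def frameMap (A : E d →L[ℝ] (Fin n → ℝ)) : NVec n d →L[ℝ] (Fin n → E d) :=
  ContinuousLinearMap.pi fun i =>
    (EuclideanSpace.equiv (Fin d) ℝ).symm.toContinuousLinearMap.comp
      (ContinuousLinearMap.pi fun j => ContinuousLinearMap.apply ℝ ℝ (frameForm A i j))

theorem frameMap_wedge (A : E d →L[ℝ] (Fin n → ℝ)) (v : Fin n → E d) :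
    frameMap A (wedge v) =
      fun i => ∑ k, (Matrix.of fun i => A (v i)).adjugate i k • v k := by
  funext i
  ext j
  have : frameMap A (wedge v) i j = frameForm A i j v := rfl
  rw [this, frameForm_apply]
  simp

/-- Take A dual to u and let C be the matrix of the A (v i). The frame adj(C) v depends linearly on
the n-vector spanned by v, equals u when v = u, and spans the same line of n-vectors as v wherever
det C ≠ 0. The scalar det(adj C) that it introduces is removed by normalising with p. -/
theorem exists_frameMap (u : Fin n → E d) (hu : LinearIndependent ℝ u) :
    ∃ R : NVec n d →L[ℝ] (Fin n → E d), R (wedge u) = u ∧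
      ∀ᶠ z in 𝓝 (wedge u), z ∈ range (wedge : (Fin n → E d) → NVec n d) →
        ∀ p : Form n d, z p = 1 → (p (R z))⁻¹ • wedge (R z) = z := by
  obtain ⟨A, hA⟩ := LinearMap.exists_leftInverse_of_injective (Fintype.linearCombination ℝ u)
    (LinearMap.ker_eq_bot.2 (linearIndependent_iff_injective_fintypeLinearCombination.1 hu))
  have hAu : (Matrix.of fun i => LinearMap.toContinuousLinearMap A (u i)) = 1 := by
    ext i j
    have := congrArg (fun f => f (Pi.single i (1 : ℝ)) j) hA
    simpa [Matrix.one_apply, Pi.single_apply, eq_comm] using this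
  refine ⟨frameMap (LinearMap.toContinuousLinearMap A), ?_, ?_⟩
  · rw [frameMap_wedge, hAu]
    funext i
    simp [Matrix.one_apply]
  · have hcont : Continuous fun z : NVec n d => z (detForm (LinearMap.toContinuousLinearMap A)) :=
      (ContinuousLinearMap.apply ℝ ℝ _).continuous
    have h1 : (wedge u) (detForm (LinearMap.toContinuousLinearMap A)) ≠ 0 := by
      rw [wedge_apply, detForm_apply, hAu]
      simp
    filter_upwards [hcont.continuousAt.eventually_ne h1]
    rintro _ hz ⟨v, rfl⟩ p hp
    rw [wedge_apply, detForm_apply] at hz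
    rw [wedge_apply] at hp
    set C := (Matrix.of fun i => LinearMap.toContinuousLinearMap A (v i)) with hC
    have hdet : C.adjugate.det ≠ 0 := by
      rw [Matrix.det_adjugate]
      exact pow_ne_zero _ hz
    rw [frameMap_wedge, wedge_linearCombination, form_linearCombination, hp, mul_one, smul_smul,
      inv_mul_cancel₀ hdet, one_smul]

end Multilinear

/-! ### Coordinates on the bundle of forms and changes of chart -/

section Charts

variable {n d : ℕ} {N : Type*} [TopologicalSpace N] [ChartedSpace (E d) N]
  [IsManifold 𝓘(ℝ, E d) ∞ N]

theorem fromChart_self (c : N) : fromChart c c = ContinuousLinearMap.id ℝ (E d) :=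
  ContinuousLinearMap.ext fun _ => tangentCoordChange_self (mem_extChartAt_source c)

theorem fromChart_toChart {c q : N} (h : q ∈ (extChartAt 𝓘(ℝ, E d) c).source) (v : E d) :
    fromChart c q (toChart c q v) = v := by
  have hq := mem_extChartAt_source (I := 𝓘(ℝ, E d)) q
  exact (tangentCoordChange_comp ⟨⟨hq, h⟩, hq⟩).trans (tangentCoordChange_self hq)

theorem toChart_fromChart {c q : N} (h : q ∈ (extChartAt 𝓘(ℝ, E d) c).source) (v : E d) :
    toChart c q (fromChart c q v) = v := by
  have hq := mem_extChartAt_source (I := 𝓘(ℝ, E d)) q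
  exact (tangentCoordChange_comp ⟨⟨h, hq⟩, h⟩).trans (tangentCoordChange_self h)

theorem coord_ofCoord {c : N} {a : E d × Form n d}
    (h : a.1 ∈ (extChartAt 𝓘(ℝ, E d) c).target) : coord c (ofCoord c a) = a := by
  refine Prod.ext ((extChartAt 𝓘(ℝ, E d) c).right_inv h) ?_
  ext v
  have hs := (extChartAt 𝓘(ℝ, E d) c).map_target h
  change a.2 (fun i => toChart c _ (fromChart c _ (v i))) = a.2 v
  congr 1
  funext i
  exact toChart_fromChart hs (v i)

theorem ofCoord_coord {c : N} {m : FormBundle n d N}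
    (h : m.pt ∈ (extChartAt 𝓘(ℝ, E d) c).source) : ofCoord c (coord c m) = m := by
  obtain ⟨q, p⟩ := m
  have hq : (extChartAt 𝓘(ℝ, E d) c).symm (extChartAt 𝓘(ℝ, E d) c q) = q :=
    (extChartAt 𝓘(ℝ, E d) c).left_inv h
  simp only [ofCoord, coord]
  rw [hq]
  congr 1
  ext v
  change p (fun i => fromChart c q (toChart c q (v i))) = p v
  simp only [fromChart_toChart h]

theorem coord_change {b c : N} {m : FormBundle n d N}
    (hb : m.pt ∈ (extChartAt 𝓘(ℝ, E d) b).source) (hc : m.pt ∈ (extChartAt 𝓘(ℝ, E d) c).source) :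
    (coord c m).2 =
      (coord b m).2.compContinuousLinearMap (tangentCoordChange 𝓘(ℝ, E d) c b m.pt) := by
  ext v
  change m.form (fun i => fromChart c m.pt (v i)) = m.form (fun i => fromChart b m.pt _)
  congr 1
  funext i
  exact (tangentCoordChange_comp ⟨⟨hc, hb⟩, mem_extChartAt_source m.pt⟩).symm

@[simp] theorem coord_self_snd (q : N) (p : Form n d) :
    (coord q (⟨q, p⟩ : FormBundle n d N)).2 = p := by
  ext v
  change p (fun i => fromChart q q (v i)) = p v
  simp [fromChart_self]

variable {F H : Type*} [NormedAddCommGroup F] [NormedSpace ℝ F] [TopologicalSpace H]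
    {I : ModelWithCorners ℝ F H} {A : Type*} [TopologicalSpace A] [ChartedSpace H A]

theorem contMDiffAt_tangentCoordChange {b c : N} {q : A → N} {a : A}
    (hq : ContMDiffAt I 𝓘(ℝ, E d) ∞ q a)
    (hb : q a ∈ (extChartAt 𝓘(ℝ, E d) b).source) (hc : q a ∈ (extChartAt 𝓘(ℝ, E d) c).source) :
    ContMDiffAt I 𝓘(ℝ, E d →L[ℝ] E d) ∞
      (fun x => tangentCoordChange 𝓘(ℝ, E d) b c (q x)) a := by
  have : IsManifold 𝓘(ℝ, E d) (∞ + 1) N := by simpa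
  have hcore : (tangentBundleCore 𝓘(ℝ, E d) N).IsContMDiff 𝓘(ℝ, E d) ∞ :=
    tangentBundleCore.isContMDiff
  have h := hcore.contMDiffOn_coordChange (achart (E d) b) (achart (E d) c)
  rw [extChartAt_source] at hb hc
  exact (h.contMDiffAt (((chartAt (E d) b).open_source.inter
    (chartAt (E d) c).open_source).mem_nhds ⟨hb, hc⟩)).comp a hq

theorem contMDiffAt_coord_change {f : A → FormBundle n d N} {a : A} {b c : N}
    (hq : ContMDiffAt I 𝓘(ℝ, E d) ∞ (fun x => (f x).pt) a)
    (hb : (f a).pt ∈ (extChartAt 𝓘(ℝ, E d) b).source)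
    (hc : (f a).pt ∈ (extChartAt 𝓘(ℝ, E d) c).source)
    (hf : ContMDiffAt I 𝓘(ℝ, Form n d) ∞ (fun x => (coord b (f x)).2) a) :
    ContMDiffAt I 𝓘(ℝ, Form n d) ∞ (fun x => (coord c (f x)).2) a := by
  have h1 : ContMDiffAt I 𝓘(ℝ, Form n d × (E d →L[ℝ] E d)) ∞ (fun x => ((coord b (f x)).2,
      tangentCoordChange 𝓘(ℝ, E d) c b (f x).pt)) a :=
    hf.prodMk_space (contMDiffAt_tangentCoordChange hq hc hb)
  have h2 := (contDiff_pullback.contMDiff.contMDiffAt).comp a h1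
  refine h2.congr_of_eventuallyEq ?_
  filter_upwards [hq.continuousAt.preimage_mem_nhds
      ((isOpen_extChartAt_source (I := 𝓘(ℝ, E d)) b).mem_nhds hb),
    hq.continuousAt.preimage_mem_nhds
      ((isOpen_extChartAt_source (I := 𝓘(ℝ, E d)) c).mem_nhds hc)] with x hxb hxc
  exact coord_change hxb hxc

theorem SmoothForm.contMDiffAt_coord {f : A → FormBundle n d N} (hf : SmoothForm I f) {a : A}
    {c : N} (hc : (f a).pt ∈ (extChartAt 𝓘(ℝ, E d) c).source) :
    ContMDiffAt I 𝓘(ℝ, Form n d) ∞ (fun x => (coord c (f x)).2) a :=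
  contMDiffAt_coord_change hf.1.contMDiffAt (mem_extChartAt_source _) hc (hf.2 a)

theorem smoothForm_of_coord {f : A → FormBundle n d N}
    (h : ∀ a, ContMDiffAt I 𝓘(ℝ, E d) ∞ (fun x => (f x).pt) a ∧
      ∃ c, (f a).pt ∈ (extChartAt 𝓘(ℝ, E d) c).source ∧
        ContMDiffAt I 𝓘(ℝ, Form n d) ∞ (fun x => (coord c (f x)).2) a) :
    SmoothForm I f := by
  refine ⟨fun a => (h a).1, fun a => ?_⟩
  obtain ⟨hq, c, hc, hf⟩ := h a
  exact contMDiffAt_coord_change hq hc (mem_extChartAt_source _) hf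

theorem SmoothForm.comp {f : N → FormBundle n d N}
    (hpt : ∀ q, (f q).pt = q) (hf : SmoothForm 𝓘(ℝ, E d) f) {g : A → N} {a : A} {c : N}
    (hg : ContMDiffAt I 𝓘(ℝ, E d) ∞ g a) (hc : g a ∈ (extChartAt 𝓘(ℝ, E d) c).source) :
    ContMDiffAt I 𝓘(ℝ, Form n d) ∞ (fun x => (coord c (f (g x))).2) a :=
  (hf.contMDiffAt_coord (a := g a) (c := c) (by rwa [hpt])).comp a hg

/-- The form `ω` in the coordinates of the chart centred at `c`. -/
def localForm (om : N → Form n d) (c : N) (y : E d) : Form n d :=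
  (coord c (⟨(extChartAt 𝓘(ℝ, E d) c).symm y,
    om ((extChartAt 𝓘(ℝ, E d) c).symm y)⟩ : FormBundle n d N)).2

theorem contDiffAt_localForm {om : N → Form n d}
    (hom : SmoothForm 𝓘(ℝ, E d) (fun q : N => (⟨q, om q⟩ : FormBundle n d N)))
    {c : N} {y : E d} (hy : y ∈ (extChartAt 𝓘(ℝ, E d) c).target) :
    ContDiffAt ℝ ∞ (localForm om c) y := by
  rw [← contMDiffAt_iff_contDiffAt]
  refine hom.comp (fun _ => rfl) ?_ ((extChartAt 𝓘(ℝ, E d) c).map_target hy)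
  exact (contMDiffOn_extChartAt_symm c).contMDiffAt
    ((isOpen_extChartAt_target (I := 𝓘(ℝ, E d)) c).mem_nhds hy)

end Charts

/-! ### Planes of unit volume: a smooth retraction and the annihilator of the tangent space -/

section Planes

variable {n d : ℕ} {N : Type*}

instance : IsBoundedSMul ℝ (NVec n d) :=
  NormedSpace.toIsBoundedSMul (𝕜 := ℝ) (E := NVec n d)

@[simp] theorem pushNVec_apply (A : E d →L[ℝ] E d) (z : NVec n d) (p : Form n d) :
    pushNVec A z p = z (p.compContinuousLinearMap A) := rfl

theorem pushNVec_wedge (A : E d →L[ℝ] E d) (v : Fin n → E d) :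
    pushNVec A (wedge v) = wedge (fun i => A (v i)) := rfl

theorem smul_mem_range_wedge (hn : 1 ≤ n) (t : ℝ) (v : Fin n → E d) :
    t • wedge v ∈ range (wedge : (Fin n → E d) → NVec n d) := by
  refine ⟨Function.update v ⟨0, hn⟩ (t • v ⟨0, hn⟩), ?_⟩
  ext p
  simp [ContinuousAlternatingMap.map_update_smul]

theorem inv_smul_wedge_mem_planes (hn : 1 ≤ n) {om : N → Form n d} {q : N} {v : Fin n → E d}
    (h : om q v ≠ 0) : (om q v)⁻¹ • wedge v ∈ planes om q := by
  refine ⟨smul_mem_range_wedge hn _ _, ?_⟩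
  change (om q v)⁻¹ * om q v = 1
  exact inv_mul_cancel₀ h

/-- A smooth retraction onto the decomposable `n`-vectors of unit volume, near one of them, for a
volume form depending smoothly on a parameter. -/
theorem exists_retraction (hn : 1 ≤ n) {Y : Type*} [NormedAddCommGroup Y] [NormedSpace ℝ Y]
    {om : Y → Form n d} {y₀ : Y} (hom : ContDiffAt ℝ ∞ om y₀) {u : Fin n → E d}
    (hu : om y₀ u = 1) :
    ∃ R : NVec n d → (Fin n → E d), ContDiff ℝ ∞ R ∧ R (wedge u) = u ∧
      ContDiffAt ℝ ∞ (fun a : Y × NVec n d => (om a.1 (R a.2))⁻¹ • wedge (R a.2)) (y₀, wedge u) ∧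
      ∀ᶠ a : Y × NVec n d in 𝓝 (y₀, wedge u),
        (om a.1 (R a.2))⁻¹ • wedge (R a.2) ∈ planes om a.1 ∧
        (a.2 ∈ planes om a.1 → (om a.1 (R a.2))⁻¹ • wedge (R a.2) = a.2) := by
  obtain ⟨R, hRu, hR⟩ := exists_frameMap u
    (linearIndependent_of_form_ne_zero (p := om y₀) (by rw [hu]; exact one_ne_zero))
  have hRc : ContDiff ℝ ∞ (fun z => R z) :=
    ContinuousLinearMap.contDiff (𝕜 := ℝ) (E := NVec n d) (F := Fin n → E d) R
  have hRc' : ContDiffAt ℝ ∞ (fun a : Y × NVec n d => R a.2) (y₀, wedge u) :=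
    (hRc.comp contDiff_snd).contDiffAt
  have hsm : ContDiffAt ℝ ∞ (fun a : Y × NVec n d => om a.1 (R a.2)) (y₀, wedge u) :=
    (contDiff_form_apply (n := n) (d := d)).contDiffAt.comp _
      ((hom.comp (y₀, wedge u) contDiffAt_fst).prodMk hRc')
  have hne : om y₀ (R (wedge u)) ≠ 0 := by rw [hRu, hu]; exact one_ne_zero
  refine ⟨R, hRc, hRu, (hsm.inv hne).smul (contDiff_wedge.contDiffAt.comp _ hRc'), ?_⟩
  filter_upwards [continuous_snd.continuousAt.eventually hR,
    hsm.continuousAt.eventually_ne hne] with a ha ha'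
  exact ⟨inv_smul_wedge_mem_planes hn ha', fun h => ha h.1 _ h.2⟩

/-- The annihilator only controls limits of secants. The retraction r onto D^ω upgrades this to a
derivative: the image of its differential lies in the tangent cone, so z ↦ ⟨r z, p⟩ has zero
derivative, and this function is ⟨z, p⟩ on D^ω. -/
theorem hasFDerivWithinAt_of_mem_tangentAnnihilator (hn : 1 ≤ n) {om : N → Form n d} {q : N}
    {z₀ : NVec n d} (hz₀ : z₀ ∈ planes om q) {p : Form n d}
    (hp : p ∈ tangentAnnihilator om q z₀) :
    HasFDerivWithinAt (fun z : NVec n d => z p) (0 : NVec n d →L[ℝ] ℝ) (planes om q) z₀ := by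
  have hz₀' := hz₀
  obtain ⟨⟨u, rfl⟩, hu⟩ := hz₀
  obtain ⟨R, -, -, hR, hR'⟩ := exists_retraction hn (Y := ℝ) (om := fun _ => om q) (y₀ := 0)
    contDiffAt_const hu
  set r : NVec n d → NVec n d := fun z => (om q (R z))⁻¹ • wedge (R z) with hrdef
  have hincl : ContDiffAt ℝ ∞ (fun z : NVec n d => ((0 : ℝ), z)) (wedge u) :=
    contDiffAt_const.prodMk contDiffAt_id
  have hr : ContDiffAt ℝ ∞ r (wedge u) := ContDiffAt.comp (wedge u) hR hincl
  have hr' : ∀ᶠ z in 𝓝 (wedge u : NVec n d), r z ∈ planes om q ∧ (z ∈ planes om q → r z = z) :=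
    hincl.continuousAt.eventually hR'
  set z₀ : NVec n d := wedge u
  have hD := (hr.differentiableAt (by simp)).hasFDerivAt
  have hr₀ : r z₀ = z₀ := hr'.self_of_nhds.2 hz₀'
  have hset : {z | r z ∈ planes om q} ∈ 𝓝 z₀ := hr'.mono fun z hz => hz.1
  have hmem : ∀ ζ, fderiv ℝ r z₀ ζ ∈ tangent (planes om q) z₀ := fun ζ => by
    refine Submodule.subset_span ?_
    -- The set of points that r sends into D^ω is a neighbourhood of z₀, so every vector is in its
    -- tangent cone.
    have h1 := (hD.hasFDerivWithinAt (s := {z | r z ∈ planes om q})).mapsTo_tangent_cone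
      (by rw [tangentConeAt_of_mem_nhds hset]; exact mem_univ ζ)
    rw [hr₀] at h1
    exact tangentConeAt_mono (by rintro _ ⟨z, hz, rfl⟩; exact hz) h1
  have h2 : HasFDerivAt (fun z => r z p) (0 : NVec n d →L[ℝ] ℝ) z₀ := by
    have h3 := (ContinuousLinearMap.apply ℝ ℝ p).hasFDerivAt.comp z₀ hD
    have h4 : (ContinuousLinearMap.apply ℝ ℝ p).comp (fderiv ℝ r z₀) = 0 :=
      ContinuousLinearMap.ext fun ζ => hp _ (hmem ζ)
    rw [h4] at h3
    exact h3
  refine h2.hasFDerivWithinAt.congr_of_eventuallyEq ?_ (by rw [hr₀])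
  filter_upwards [nhdsWithin_le_nhds hr', self_mem_nhdsWithin] with z hz hz'
  rw [hz.2 hz']

/-- Pairing with ω is constant on D^ω, so it maps the tangent cone into that of a single point,
which is zero. -/
theorem volume_mem_tangentAnnihilator {om : N → Form n d} {q : N} (z₀ : NVec n d) :
    om q ∈ tangentAnnihilator om q z₀ := by
  intro ζ hζ
  let T : NVec n d →L[ℝ] ℝ := ContinuousLinearMap.apply ℝ ℝ (om q)
  have hle : tangent (planes om q) z₀ ≤ LinearMap.ker T.toLinearMap := by
    refine Submodule.span_le.2 fun ζ hζ => ?_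
    have h1 := (T.hasFDerivAt.hasFDerivWithinAt (s := planes om q)).mapsTo_tangent_cone hζ
    have h2 : T '' planes om q ⊆ {1} := by
      rintro _ ⟨z, hz, rfl⟩
      exact hz.2
    have h3 := tangentConeAt_mono h2 h1
    have h4 : ¬AccPt (T z₀) (𝓟 ({1} : Set ℝ)) := by
      intro h
      rw [accPt_iff_nhds] at h
      obtain ⟨y, ⟨-, hy⟩, hne⟩ := h univ univ_mem
      rw [mem_singleton_iff] at hy
      obtain ⟨y', ⟨hy', hy''⟩, -⟩ := h {1}ᶜ (isOpen_compl_singleton.mem_nhds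
        (by rw [mem_compl_singleton_iff, ← hy]; exact hne.symm))
      exact hy' hy''
    exact tangentConeAt_subset_zero h4 h3
  exact hle hζ

end Planes

/-! ### Constancy of functions with zero differential along a connected submanifold -/

section Constancy

variable {V : Type*} [NormedAddCommGroup V] [NormedSpace ℝ V]

/-- A function whose differential along a connected submanifold vanishes is constant on it. -/
theorem IsSubmanifold.eq_of_hasFDerivWithinAt_zero {A : Set V} (hA : IsSubmanifold A)
    (hc : IsPreconnected A) {g : V → ℝ}
    (hg : ∀ a ∈ A, HasFDerivWithinAt g (0 : V →L[ℝ] ℝ) A a) {a b : V} (ha : a ∈ A) (hb : b ∈ A) :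
    g a = g b := by
  have hloc : ∀ a ∈ A, ∀ᶠ x in 𝓝[A] a, g x = g a := by
    intro a ha
    obtain ⟨Φ, S, haΦ, -, hΦ', hS⟩ := hA a ha
    have hta : Φ a ∈ Φ.target := Φ.map_source haΦ
    obtain ⟨ε, hε, hball⟩ := Metric.isOpen_iff.1 Φ.open_target _ hta
    -- In straightened coordinates the submanifold is locally a ball of a linear subspace. It is
    -- convex, so the mean value inequality applies with bound 0.
    have hconv : Convex ℝ (Metric.ball (Φ a) ε ∩ (S : Set V)) :=
      (convex_ball _ _).inter S.convex
    have hmaps : MapsTo Φ.symm (Metric.ball (Φ a) ε ∩ (S : Set V)) A := fun v hv => by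
      rw [hS _ (Φ.map_target (hball hv.1)), Φ.right_inv (hball hv.1)]
      exact hv.2
    have hder : ∀ v ∈ Metric.ball (Φ a) ε ∩ (S : Set V),
        HasFDerivWithinAt (g ∘ Φ.symm) (0 : V →L[ℝ] ℝ)
          (Metric.ball (Φ a) ε ∩ (S : Set V)) v := fun v hv => by
      have h1 := ((hΦ'.contDiffAt (Φ.open_target.mem_nhds (hball hv.1))).differentiableAt
        (by simp)).hasFDerivAt.hasFDerivWithinAt (s := Metric.ball (Φ a) ε ∩ (S : Set V))
      simpa using (hg _ (hmaps hv)).comp v h1 hmaps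
    have hcont := Φ.continuousAt haΦ
    filter_upwards [nhdsWithin_le_nhds (hcont.preimage_mem_nhds (Metric.ball_mem_nhds _ hε)),
      nhdsWithin_le_nhds (Φ.open_source.mem_nhds haΦ), self_mem_nhdsWithin] with x hx hxs hxA
    have hxv : Φ x ∈ Metric.ball (Φ a) ε ∩ (S : Set V) := ⟨hx, (hS x hxs).1 hxA⟩
    have hav : Φ a ∈ Metric.ball (Φ a) ε ∩ (S : Set V) :=
      ⟨Metric.mem_ball_self hε, (hS a haΦ).1 ha⟩
    have hbd := hconv.norm_image_sub_le_of_norm_hasFDerivWithin_le (C := 0) hder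
      (fun v _ => by simp) hav hxv
    have : g (Φ.symm (Φ x)) - g (Φ.symm (Φ a)) = 0 := by
      simpa using hbd
    rw [Φ.left_inv hxs, Φ.left_inv haΦ] at this
    linarith
  exact hc.induction₂ (fun x y => g x = g y) (fun x hx => (hloc x hx).mono fun y hy => hy.symm)
    (fun x y z _ _ _ h h' => h.trans h') (fun x y _ _ h => h.symm) ha hb

end Constancy

/-! ### The envelope principle -/

section Envelope

variable {A V P Q : Type*} [NormedAddCommGroup A] [NormedSpace ℝ A] [NormedAddCommGroup V]
  [NormedSpace ℝ V] [NormedAddCommGroup P] [NormedSpace ℝ P] [NormedAddCommGroup Q]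
  [NormedSpace ℝ Q]

/-- Substituting a critical value of a parameter into a function: the derivative of the parameter
does not contribute. -/
theorem hasFDerivAt_envelope {T : Type*} [NormedAddCommGroup T] [NormedSpace ℝ T]
    {w : A × V × P → ℝ} {Dw : A × V × P →L[ℝ] ℝ} {a : T → A} {a' : T →L[ℝ] A}
    {p : T → P} {p' : T →L[ℝ] P} {z : T → V} {t₀ : T}
    (hw : HasFDerivAt w Dw (a t₀, z t₀, p t₀)) (hcrit : ∀ ζ, Dw (0, ζ, 0) = 0)
    (ha : HasFDerivAt a a' t₀) (hp : HasFDerivAt p p' t₀) (hz : DifferentiableAt ℝ z t₀) :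
    HasFDerivAt (fun t => w (a t, z t, p t))
      (Dw.comp (a'.prod ((0 : T →L[ℝ] V).prod p'))) t₀ := by
  have h := hw.comp t₀ (ha.prodMk (hz.hasFDerivAt.prodMk hp))
  have h' : Dw.comp (a'.prod ((fderiv ℝ z t₀).prod p')) =
      Dw.comp (a'.prod ((0 : T →L[ℝ] V).prod p')) := by
    ext t
    have h1 : (a' t, fderiv ℝ z t₀ t, p' t) = (a' t, (0 : V), p' t) + (0, fderiv ℝ z t₀ t, 0) := by
      simp
    change Dw (a' t, fderiv ℝ z t₀ t, p' t) = Dw (a' t, 0, p' t)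
    rw [h1, map_add, hcrit, add_zero]
  rw [h'] at h
  exact h

theorem hasFDerivAt_mk_fst_snd (a : A) (p : P) (z : V) :
    HasFDerivAt (fun z : V => (a, z, p))
      ((0 : V →L[ℝ] A).prod ((ContinuousLinearMap.id ℝ V).prod (0 : V →L[ℝ] P))) z :=
  (hasFDerivAt_const _ _).prodMk ((hasFDerivAt_id _).prodMk (hasFDerivAt_const _ _))

/-- The excess function `w (a, z (a, v), p) - w (a, f (a, p), p)` vanishes to second order. -/
theorem hasFDerivAt_excess {w : A × V × P → ℝ} {Dw : A × V × P →L[ℝ] ℝ} {a₀ : A} {z₀ : V}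
    {p₀ : P} {v₀ : Q} (hw : HasFDerivAt w Dw (a₀, z₀, p₀)) (hcrit : ∀ ζ, Dw (0, ζ, 0) = 0)
    {f : A × P → V} (hf : DifferentiableAt ℝ f (a₀, p₀)) (hf₀ : f (a₀, p₀) = z₀)
    {z : A × Q → V} (hz : DifferentiableAt ℝ z (a₀, v₀)) (hz₀ : z (a₀, v₀) = z₀)
    {c : A × Q → ℝ} (hc : DifferentiableAt ℝ c (a₀, v₀)) :
    HasFDerivAt (fun t : A × Q × P => c (t.1, t.2.1) *
      (w (t.1, z (t.1, t.2.1), t.2.2) - w (t.1, f (t.1, t.2.2), t.2.2)))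
      (0 : A × Q × P →L[ℝ] ℝ) (a₀, v₀, p₀) := by
  have h1 : HasFDerivAt (fun t : A × Q × P => t.1) (ContinuousLinearMap.fst ℝ A (Q × P))
    (a₀, v₀, p₀) := hasFDerivAt_fst
  have h2 : HasFDerivAt (fun t : A × Q × P => t.2.2)
      ((ContinuousLinearMap.snd ℝ Q P).comp (ContinuousLinearMap.snd ℝ A (Q × P)))
      (a₀, v₀, p₀) := hasFDerivAt_snd.comp _ hasFDerivAt_snd
  have h3 : DifferentiableAt ℝ (fun t : A × Q × P => (t.1, t.2.1)) (a₀, v₀, p₀) := by fun_prop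
  have h4 : DifferentiableAt ℝ (fun t : A × Q × P => (t.1, t.2.2)) (a₀, v₀, p₀) := by fun_prop
  have hz' : DifferentiableAt ℝ (fun t : A × Q × P => z (t.1, t.2.1)) (a₀, v₀, p₀) :=
    DifferentiableAt.comp (a₀, v₀, p₀) hz h3
  have hf' : DifferentiableAt ℝ (fun t : A × Q × P => f (t.1, t.2.2)) (a₀, v₀, p₀) :=
    DifferentiableAt.comp (a₀, v₀, p₀) hf h4
  have hc' : DifferentiableAt ℝ (fun t : A × Q × P => c (t.1, t.2.1)) (a₀, v₀, p₀) :=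
    DifferentiableAt.comp (a₀, v₀, p₀) hc h3
  have h5 := hasFDerivAt_envelope (z := fun t : A × Q × P => z (t.1, t.2.1)) (t₀ := (a₀, v₀, p₀))
    (by rw [← hz₀] at hw; exact hw) hcrit h1 h2 hz'
  have h6 := hasFDerivAt_envelope (z := fun t : A × Q × P => f (t.1, t.2.2)) (t₀ := (a₀, v₀, p₀))
    (by rw [← hf₀] at hw; exact hw) hcrit h1 h2 hf'
  have h7 := hc'.hasFDerivAt.mul (h5.sub h6)
  -- Both substitutions have the same derivative by the envelope principle, and the bracket vanishes
  -- at the point, so both terms of the product rule are zero.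
  have h8 : c (a₀, v₀) • (Dw.comp ((ContinuousLinearMap.fst ℝ A (Q × P)).prod
        ((0 : A × Q × P →L[ℝ] V).prod
          ((ContinuousLinearMap.snd ℝ Q P).comp (ContinuousLinearMap.snd ℝ A (Q × P))))) -
        Dw.comp ((ContinuousLinearMap.fst ℝ A (Q × P)).prod ((0 : A × Q × P →L[ℝ] V).prod
          ((ContinuousLinearMap.snd ℝ Q P).comp (ContinuousLinearMap.snd ℝ A (Q × P)))))) +
      (w (a₀, z (a₀, v₀), p₀) - w (a₀, f (a₀, p₀), p₀)) •
        fderiv ℝ (fun t : A × Q × P => c (t.1, t.2.1)) (a₀, v₀, p₀) = 0 := by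
    rw [hz₀, hf₀, sub_self, sub_self, smul_zero, zero_smul, zero_add]
  exact h8 ▸ h7

theorem hasFDerivAt_comp_fst_snd_fst {g : A × Q → ℝ} {g' : A × Q →L[ℝ] ℝ} {a₀ : A} {v₀ : Q}
    (p₀ : P) (hg : HasFDerivAt g g' (a₀, v₀)) :
    HasFDerivAt (fun t : A × Q × P => g (t.1, t.2.1))
      (g'.comp ((ContinuousLinearMap.fst ℝ A (Q × P)).prod
        ((ContinuousLinearMap.fst ℝ Q P).comp (ContinuousLinearMap.snd ℝ A (Q × P)))))
      (a₀, v₀, p₀) := by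
  have h : HasFDerivAt (fun t : A × Q × P => (t.1, t.2.1))
      ((ContinuousLinearMap.fst ℝ A (Q × P)).prod
        ((ContinuousLinearMap.fst ℝ Q P).comp (ContinuousLinearMap.snd ℝ A (Q × P))))
      (a₀, v₀, p₀) :=
    hasFDerivAt_fst.prodMk (HasFDerivAt.comp (a₀, v₀, p₀) hasFDerivAt_fst hasFDerivAt_snd)
  exact HasFDerivAt.comp (a₀, v₀, p₀) hg h

/-- Criticality of g is known only along S. Composing with a retraction onto S gives a function of
an unconstrained variable whose partial derivative is zero in every direction. -/
theorem fderiv_apply_eq_zero_of_retraction {w : A × V × P → ℝ} {a₀ : A} {z₀ : V} {p₀ : P}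
    (hw : DifferentiableAt ℝ w (a₀, z₀, p₀)) {g : V → ℝ} {S : Set V}
    (hg : HasFDerivWithinAt g (0 : V →L[ℝ] ℝ) S z₀) {ρ : V → V} (hρ : DifferentiableAt ℝ ρ z₀)
    (hρ₀ : ρ z₀ = z₀) (hS : ∀ᶠ z in 𝓝 z₀, ρ z ∈ S) (h : ∀ z, w (a₀, z, p₀) = g (ρ z)) (ζ : V) :
    fderiv ℝ w (a₀, z₀, p₀) (0, ζ, 0) = 0 := by
  have h1 := hw.hasFDerivAt.comp z₀ (hasFDerivAt_mk_fst_snd a₀ p₀ z₀)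
  have h2 : HasFDerivAt (g ∘ ρ) ((0 : V →L[ℝ] ℝ).comp (fderiv ℝ ρ z₀)) z₀ :=
    HasFDerivWithinAt.comp_hasFDerivAt z₀ (t := S) (by rw [hρ₀]; exact hg) hρ.hasFDerivAt hS
  have h4 : (w ∘ fun z : V => (a₀, z, p₀)) = g ∘ ρ := funext h
  rw [h4] at h1
  have h6 := congrArg (fun T : V →L[ℝ] ℝ => T ζ) (h1.unique h2)
  simpa using h6

theorem contDiffAt_graph {w : A × V × P → ℝ} {f : A × P → V} {a₀ : A} {z₀ : V} {p₀ : P}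
    (hw : ContDiffAt ℝ ∞ w (a₀, z₀, p₀)) (hf : ContDiffAt ℝ ∞ f (a₀, p₀))
    (hf₀ : f (a₀, p₀) = z₀) : ContDiffAt ℝ ∞ (fun a : A × P => w (a.1, f a, a.2)) (a₀, p₀) :=
  ContDiffAt.comp (a₀, p₀) (f := fun a : A × P => (a.1, f a, a.2)) (g := w)
    (by rw [hf₀]; exact hw) (contDiffAt_fst.prodMk (hf.prodMk contDiffAt_snd))

/-- This is ∂ℋ/∂p = z: by the envelope principle the variation of f with p does not contribute, and
with z frozen the function is affine in p with linear part T. -/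
theorem fderiv_graph_apply {w : A × V × P → ℝ} {f : A × P → V} {a₀ : A} {z₀ : V} {p₀ : P}
    (hw : DifferentiableAt ℝ w (a₀, z₀, p₀))
    (hcrit : ∀ ζ, fderiv ℝ w (a₀, z₀, p₀) (0, ζ, 0) = 0)
    (hf : DifferentiableAt ℝ f (a₀, p₀)) (hf₀ : f (a₀, p₀) = z₀)
    {T : P →L[ℝ] ℝ} {k : ℝ} (hT : ∀ p, w (a₀, z₀, p) = T p - k) (p : P) :
    fderiv ℝ (fun a : A × P => w (a.1, f a, a.2)) (a₀, p₀) (0, p) = T p := by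
  have hDh := hasFDerivAt_envelope (z := f) (t₀ := (a₀, p₀)) (by rw [hf₀]; exact hw.hasFDerivAt)
    hcrit hasFDerivAt_fst hasFDerivAt_snd hf
  rw [hDh.fderiv]
  have h1 : HasFDerivAt (fun p : P => (a₀, z₀, p))
    ((0 : P →L[ℝ] A).prod ((0 : P →L[ℝ] V).prod (ContinuousLinearMap.id ℝ P))) p₀ :=
    (hasFDerivAt_const _ _).prodMk ((hasFDerivAt_const _ _).prodMk (hasFDerivAt_id _))
  have h2 := hw.hasFDerivAt.comp p₀ h1
  have h3 : (w ∘ fun p : P => (a₀, z₀, p)) = fun p => T p - k := funext hT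
  rw [h3] at h2
  exact congrArg (fun T : P →L[ℝ] ℝ => T p) (h2.unique (T.hasFDerivAt.sub_const _))

end Envelope

/-- The value does not depend on the element chosen in Z_q(p), since W(q, ·, p) has zero
differential along this connected submanifold. -/
theorem hamiltonian_eq {n d : ℕ} {N : Type*} {om : N → Form n d} {L : N → NVec n d → ℝ}
    {m : FormBundle n d N} (hc : IsConnected (Z om L m))
    (hs : IsSubmanifold (Z om L m)) {z : NVec n d} (hz : z ∈ Z om L m) :
    hamiltonian om L m = W L m.pt z m.form := by
  have hne : (Z om L m).Nonempty := ⟨z, hz⟩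
  rw [hamiltonian, dif_pos hne]
  exact hs.eq_of_hasFDerivWithinAt_zero hc.isPreconnected (g := fun z => W L m.pt z m.form)
    (fun a ha => ha.2.mono fun z hz => hz.1) hne.some_mem hz

/-! ### The Hamiltonian and the Lagrangian in charts -/

section LocalHamiltonian

variable {n d : ℕ} {N : Type*} [TopologicalSpace N] [ChartedSpace (E d) N]
  [IsManifold 𝓘(ℝ, E d) ∞ N]

/-- The Lagrangian density in the coordinates of the chart centred at `c`. -/
def localLagrangian (L : N → NVec n d → ℝ) (c : N) (y : E d) (z : NVec n d) : ℝ :=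
  L ((extChartAt 𝓘(ℝ, E d) c).symm y)
    (pushNVec (fromChart c ((extChartAt 𝓘(ℝ, E d) c).symm y)) z)

/-- The Lagrangian density as a homogeneous function of frames, in the coordinates of the chart
centred at `c`. -/
def frameLagrangian (om : N → Form n d) (L : N → NVec n d → ℝ) (c : N)
    (a : E d × (Fin n → E d)) : ℝ :=
  localForm om c a.1 a.2 * localLagrangian L c a.1 ((localForm om c a.1 a.2)⁻¹ • wedge a.2)

theorem pushNVec_fromChart_mem_planes {om : N → Form n d} {c : N} {y : E d}
    (hy : y ∈ (extChartAt 𝓘(ℝ, E d) c).target) {z : NVec n d} :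
    pushNVec (fromChart c ((extChartAt 𝓘(ℝ, E d) c).symm y)) z ∈
        planes om ((extChartAt 𝓘(ℝ, E d) c).symm y) ↔ z ∈ planes (localForm om c) y := by
  have hs := (extChartAt 𝓘(ℝ, E d) c).map_target hy
  refine and_congr ⟨?_, ?_⟩ Iff.rfl
  · rintro ⟨v, hv⟩
    refine ⟨fun i => toChart c ((extChartAt 𝓘(ℝ, E d) c).symm y) (v i), ?_⟩
    rw [← pushNVec_wedge, hv]
    ext p
    change z _ = z p
    congr 1
    ext w
    change p (fun i => toChart c _ (fromChart c _ (w i))) = p w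
    congr 1
    funext i
    exact toChart_fromChart hs (w i)
  · rintro ⟨v, rfl⟩
    exact ⟨_, rfl⟩

theorem localForm_center (om : N → Form n d) (c : N) :
    localForm om c (extChartAt 𝓘(ℝ, E d) c c) = om c := by
  rw [localForm, extChartAt_to_inv]
  exact coord_self_snd _ _

theorem pushNVec_fromChart_self (c : N) (z : NVec n d) : pushNVec (fromChart c c) z = z := by
  ext p
  rw [pushNVec_apply, fromChart_self]
  rfl

theorem localLagrangian_center (L : N → NVec n d → ℝ) (c : N) (z : NVec n d) :
    localLagrangian L c (extChartAt 𝓘(ℝ, E d) c c) z = L c z := by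
  rw [localLagrangian, extChartAt_to_inv, pushNVec_fromChart_self]

theorem planes_center (om : N → Form n d) (c : N) :
    planes (localForm om c) (extChartAt 𝓘(ℝ, E d) c c) = planes om c := by
  simp only [planes, localForm_center]

theorem contDiffAt_localForm_apply {om : N → Form n d} (hom : IsSpaceTimeVolume om) {c : N}
    {a : E d × (Fin n → E d)} (ha : a.1 ∈ (extChartAt 𝓘(ℝ, E d) c).target) :
    ContDiffAt ℝ ∞ (fun a : E d × (Fin n → E d) => localForm om c a.1 a.2) a :=
  (contDiff_form_apply (n := n) (d := d)).contDiffAt.comp _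
    (((contDiffAt_localForm hom.smooth ha).comp a contDiffAt_fst).prodMk contDiffAt_snd)

theorem contDiffAt_localLagrangian_frame {om : N → Form n d} (hom : IsSpaceTimeVolume om)
    {L : N → NVec n d → ℝ} (hL : SmoothLagrangian om L) {c : N} {y₀ : E d}
    (hy₀ : y₀ ∈ (extChartAt 𝓘(ℝ, E d) c).target) {v₀ : Fin n → E d}
    (hv₀ : 0 < localForm om c y₀ v₀) :
    ContDiffAt ℝ ∞ (fun a : E d × (Fin n → E d) =>
      localLagrangian L c a.1 ((localForm om c a.1 a.2)⁻¹ • wedge a.2)) (y₀, v₀) := by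
  have h1 : ContDiffAt ℝ ∞ (fun a : E d × (Fin n → E d) => localForm om c a.1 a.2) (y₀, v₀) :=
    contDiffAt_localForm_apply hom hy₀
  refine (hL c).contDiffAt (Filter.inter_mem ?_ ?_)
  · exact continuous_fst.continuousAt.preimage_mem_nhds
      ((isOpen_extChartAt_target (I := 𝓘(ℝ, E d)) c).mem_nhds hy₀)
  · exact h1.continuousAt.eventually_const_lt hv₀

variable {om : N → Form n d} {L : N → NVec n d → ℝ} {M : Set (FormBundle n d N)} {r : ℕ}

/-- A smooth retraction, written in a chart, onto the decomposable `n`-vectors of unit volume, along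
which the Lagrangian density is smooth. -/
theorem exists_localRetraction (hn : 1 ≤ n) (hom : IsSpaceTimeVolume om)
    (hL : SmoothLagrangian om L) {c : N} {y₀ : E d} (hy₀ : y₀ ∈ (extChartAt 𝓘(ℝ, E d) c).target)
    {z₀ : NVec n d} (hz₀ : z₀ ∈ planes (localForm om c) y₀) :
    ∃ ret : E d × NVec n d → NVec n d, ContDiffAt ℝ ∞ ret (y₀, z₀) ∧ ret (y₀, z₀) = z₀ ∧
      ContDiffAt ℝ ∞ (fun a => localLagrangian L c a.1 (ret a)) (y₀, z₀) ∧
      ∀ᶠ a in 𝓝 (y₀, z₀), ret a ∈ planes (localForm om c) a.1 ∧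
        (a.2 ∈ planes (localForm om c) a.1 → ret a = a.2) := by
  obtain ⟨⟨u, rfl⟩, hu⟩ := hz₀
  rw [wedge_apply] at hu
  obtain ⟨R, hRc, hRu, hret, hret'⟩ :=
    exists_retraction hn (contDiffAt_localForm hom.smooth hy₀) hu
  refine ⟨_, hret, ?_, ?_, hret'⟩
  · simp only [hRu, hu, inv_one, one_smul]
  · have h1 := contDiffAt_localLagrangian_frame hom hL hy₀
      (v₀ := R (wedge u)) (by rw [hRu, hu]; exact one_pos)
    exact h1.comp (y₀, wedge u) (contDiffAt_fst.prodMk (hRc.comp contDiff_snd).contDiffAt)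

set_option maxHeartbeats 1000000 in
/-- Near a point of `ℳ` the Hamiltonian is the restriction of a smooth function, whose vertical
derivative is the corresponding plane. If the plane is spanned by a frame `v₀`, then
`p (v) - ℋ (q, p) ω (v)` agrees to first order with the homogeneous Lagrangian of `(q, v)`. -/
theorem LegendreCorrespondenceHypothesis.exists_localHamiltonian (hn : 1 ≤ n)
    (hom : IsSpaceTimeVolume om) (hL : SmoothLagrangian om L)
    (hM : LegendreCorrespondenceHypothesis om L M r) {m : FormBundle n d N} (hm : m ∈ M)
    {z₀ : NVec n d} (hz₀ : z₀ ∈ Z om L m) :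
    ∃ h : E d × Form n d → ℝ, ContDiffAt ℝ ∞ h (coord m.pt m) ∧
      (∀ᶠ a in 𝓝 (coord m.pt m), ofCoord m.pt a ∈ M →
        hamiltonian om L (ofCoord m.pt a) = h a) ∧
      (∀ p, fderiv ℝ h (coord m.pt m) (0, p) = z₀ p) ∧
      ∀ v₀ : Fin n → E d, om m.pt v₀ ≠ 0 → (om m.pt v₀)⁻¹ • wedge v₀ = z₀ →
        ∀ t, fderiv ℝ (fun a : E d × (Fin n → E d) × Form n d =>
            a.2.2 a.2.1 - h (a.1, a.2.2) * localForm om m.pt a.1 a.2.1)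
            (extChartAt 𝓘(ℝ, E d) m.pt m.pt, v₀, m.form) t =
          fderiv ℝ (frameLagrangian om L m.pt) (extChartAt 𝓘(ℝ, E d) m.pt m.pt, v₀)
            (t.1, t.2.1) := by
  obtain ⟨U, f, hU, hmU, hf, hf₀, hfZ⟩ := hM.smooth_section m hm z₀ hz₀
  obtain ⟨c, p₀⟩ := m
  have hcoord : coord c (⟨c, p₀⟩ : FormBundle n d N) = (extChartAt 𝓘(ℝ, E d) c c, p₀) :=
    Prod.ext rfl (coord_self_snd c p₀)
  simp only [hcoord, pushNVec_fromChart_self] at *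
  set y₀ := extChartAt 𝓘(ℝ, E d) c c with hy₀def
  have hy₀ : y₀ ∈ (extChartAt 𝓘(ℝ, E d) c).target := mem_extChartAt_target c
  have hfc : ContDiffAt ℝ ∞ f (y₀, p₀) := hf.contDiffAt (hU.mem_nhds hmU)
  have hcrit : HasFDerivWithinAt (fun z' => W L c z' p₀) (0 : NVec n d →L[ℝ] ℝ) (planes om c) z₀ :=
    hz₀.2
  have hz₀pl : z₀ ∈ planes om c := hz₀.1
  have hz₀pl' : z₀ ∈ planes (localForm om c) y₀ := by rw [planes_center]; exact hz₀pl
  obtain ⟨ret, hret, hret₀, hlam, hret'⟩ := exists_localRetraction hn hom hL hy₀ hz₀pl'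
  obtain ⟨lam, hlamdef⟩ : ∃ lam : E d × NVec n d → ℝ,
    lam = fun a => localLagrangian L c a.1 (ret a) := ⟨_, rfl⟩
  rw [← hlamdef] at hlam
  -- This is W with z replaced by its retraction: a smooth function of an unconstrained n-vector
  -- that agrees with W on planes of unit volume near z₀.
  obtain ⟨w, hwdef⟩ : ∃ w : E d × NVec n d × Form n d → ℝ,
    w = fun a => ret (a.1, a.2.1) a.2.2 - lam (a.1, a.2.1) := ⟨_, rfl⟩
  have hpr : ContDiffAt ℝ ∞ (fun a : E d × NVec n d × Form n d => (a.1, a.2.1)) (y₀, z₀, p₀) :=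
    contDiffAt_fst.prodMk (contDiff_fst.comp contDiff_snd).contDiffAt
  have hw : ContDiffAt ℝ ∞ w (y₀, z₀, p₀) := by
    rw [hwdef]
    exact ((ContDiffAt.comp (y₀, z₀, p₀) hret hpr).clm_apply
      (contDiff_snd.comp contDiff_snd).contDiffAt).sub (ContDiffAt.comp (y₀, z₀, p₀) hlam hpr)
  have hwd := hw.differentiableAt (by simp)
  have hretz : ContDiffAt ℝ ∞ (fun z : NVec n d => ret (y₀, z)) z₀ :=
    ContDiffAt.comp z₀ hret (contDiffAt_const.prodMk contDiffAt_id)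
  have hmemz : ∀ᶠ z : NVec n d in 𝓝 z₀, ret (y₀, z) ∈ planes om c := by
    have h3 : ContinuousAt (fun z : NVec n d => (y₀, z)) z₀ := by fun_prop
    filter_upwards [h3.eventually hret'] with z hz
    rw [← planes_center]
    exact hz.1
  have hDw0 : ∀ ζ, fderiv ℝ w (y₀, z₀, p₀) (0, ζ, 0) = 0 :=
    fderiv_apply_eq_zero_of_retraction (V := NVec n d) hwd hcrit
      (hretz.differentiableAt (by simp)) hret₀ hmemz fun z => by
        simp only [hwdef, hlamdef, W, hy₀def, localLagrangian_center]
  -- The smooth section f of the correspondence extends off ℳ in the chart, and with it the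
  -- Hamiltonian.
  refine ⟨fun a => w (a.1, f a, a.2), contDiffAt_graph (V := NVec n d) hw hfc hf₀, ?_, ?_, ?_⟩
  · have h1 : ∀ᶠ a : E d × Form n d in 𝓝 (y₀, p₀), f a ∈ planes (localForm om c) a.1 →
        ret (a.1, f a) = f a := by
      have h2 : Tendsto (fun a : E d × Form n d => (a.1, f a)) (𝓝 (y₀, p₀)) (𝓝 (y₀, z₀)) := by
        rw [← hf₀]
        exact continuousAt_fst.prodMk hfc.continuousAt
      exact (h2.eventually hret').mono fun a ha => ha.2
    filter_upwards [h1, hU.mem_nhds hmU, continuous_fst.continuousAt.preimage_mem_nhds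
      ((isOpen_extChartAt_target (I := 𝓘(ℝ, E d)) c).mem_nhds hy₀)] with a ha haU hat haM
    have hZ := hfZ a haU hat haM
    have hpl := (pushNVec_fromChart_mem_planes (om := om) hat).1 hZ.1
    rw [hamiltonian_eq (hM.connected _ haM) (hM.submanifold _ haM) hZ]
    simp only [hwdef, hlamdef, ha hpl, W]
    have h3 : pushNVec (fromChart c (ofCoord c a).pt) (f a) (ofCoord c a).form = f a a.2 := by
      rw [pushNVec_apply]
      have := congrArg Prod.snd (coord_ofCoord (n := n) hat)
      exact congrArg (f a) this
    rw [h3]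
    rfl
  · exact fderiv_graph_apply (V := NVec n d) (P := Form n d) (T := z₀) (k := lam (y₀, z₀)) hwd hDw0
      (hfc.differentiableAt (by simp)) hf₀ fun p => by simp only [hwdef, hret₀]
  · intro v₀ hv₀ hz t
    have hv₀' : localForm om c y₀ v₀ ≠ 0 := by rw [localForm_center]; exact hv₀
    have hc : ContDiffAt ℝ ∞ (fun a : E d × (Fin n → E d) => localForm om c a.1 a.2) (y₀, v₀) :=
      contDiffAt_localForm_apply hom hy₀
    obtain ⟨zv, hzvdef⟩ : ∃ zv : E d × (Fin n → E d) → NVec n d,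
      zv = fun a => (localForm om c a.1 a.2)⁻¹ • wedge a.2 := ⟨_, rfl⟩
    have hzv₀ : zv (y₀, v₀) = z₀ := by
      simp only [hzvdef, localForm_center, hy₀def]
      exact hz
    have hzv : ContDiffAt ℝ ∞ zv (y₀, v₀) := by
      rw [hzvdef]
      exact (hc.inv hv₀').smul (contDiff_wedge.comp contDiff_snd).contDiffAt
    have hexc := hasFDerivAt_excess (V := NVec n d) (P := Form n d) hwd.hasFDerivAt hDw0 (hfc.differentiableAt (by simp)) hf₀
      (hzv.differentiableAt (by simp)) hzv₀ (hc.differentiableAt (by simp))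
    have hret'' : ∀ᶠ a in 𝓝 (y₀, v₀), localForm om c a.1 a.2 ≠ 0 ∧
        ret (a.1, zv a) = zv a := by
      have h1 : Tendsto (fun a : E d × (Fin n → E d) => (a.1, zv a)) (𝓝 (y₀, v₀))
          (𝓝 (y₀, z₀)) := by
        rw [← hzv₀]
        exact continuousAt_fst.prodMk hzv.continuousAt
      filter_upwards [h1.eventually hret', hc.continuousAt.eventually_ne hv₀'] with a ha ha'
      refine ⟨ha', ha.2 ?_⟩
      rw [hzvdef]
      exact inv_smul_wedge_mem_planes hn ha'
    -- The volume of v₀ may be negative, while `SmoothLagrangian` speaks of positively oriented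
    -- frames. Smoothness is obtained from `lam`, because the normalised plane has volume 1 whatever
    -- the sign for v₀.
    have hfl : ContDiffAt ℝ ∞ (frameLagrangian om L c) (y₀, v₀) := by
      have h1 : ContDiffAt ℝ ∞ (fun a : E d × (Fin n → E d) => lam (a.1, zv a)) (y₀, v₀) := by
        rw [← hzv₀] at hlam
        exact ContDiffAt.comp (y₀, v₀) hlam (contDiffAt_fst.prodMk hzv)
      refine (hc.mul h1).congr_of_eventuallyEq ?_
      filter_upwards [hret''] with a ha
      simp only [frameLagrangian, hlamdef, ha.2]
      simp only [hzvdef]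
    have hpr : ContinuousAt (fun a : E d × (Fin n → E d) × Form n d => (a.1, a.2.1))
      (y₀, v₀, p₀) := by fun_prop
    have hfl' := hasFDerivAt_comp_fst_snd_fst p₀ (hfl.differentiableAt (by simp)).hasFDerivAt
    have hsum := hexc.add hfl'
    -- With p(v) = ω(v) ⟨z_v, p⟩, adding and subtracting ω(v) L(q, z_v) splits the integrand into
    -- the excess and the homogeneous Lagrangian. The excess has zero derivative.
    have heq : (fun a : E d × (Fin n → E d) × Form n d =>
        a.2.2 a.2.1 - w (a.1, f (a.1, a.2.2), a.2.2) * localForm om c a.1 a.2.1) =ᶠ[𝓝 (y₀, v₀, p₀)]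
        fun t => localForm om c t.1 t.2.1 * (w (t.1, zv (t.1, t.2.1), t.2.2) -
          w (t.1, f (t.1, t.2.2), t.2.2)) + frameLagrangian om L c (t.1, t.2.1) := by
      filter_upwards [hpr.eventually hret''] with a ha
      obtain ⟨ha1, ha2⟩ := ha
      have h1 : w (a.1, zv (a.1, a.2.1), a.2.2) = (localForm om c a.1 a.2.1)⁻¹ * a.2.2 a.2.1 -
          localLagrangian L c a.1 ((localForm om c a.1 a.2.1)⁻¹ • wedge a.2.1) := by
        simp only [hwdef, hlamdef, ha2]
        rw [hzvdef]
        rfl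
      rw [h1, frameLagrangian]
      field_simp
      ring
    rw [(hsum.congr_of_eventuallyEq heq).fderiv]
    simp

end LocalHamiltonian

/-! ### One-sided differentiation under the integral sign -/

section DominatedDerivative

open MeasureTheory

variable {Y : Type*} [NormedAddCommGroup Y] [NormedSpace ℝ Y]

/-- For `s ≥ 0`, the function `g` agrees near `(0, y)` with a continuously differentiable one. -/
def IsOneSidedSmoothAt (g : ℝ → Y → ℝ) (y : Y) : Prop :=
  ∃ G : ℝ × Y → ℝ, ContDiffAt ℝ 1 G (0, y) ∧ ∀ᶠ a in 𝓝 ((0 : ℝ), y), 0 ≤ a.1 → g a.1 a.2 = G a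

theorem hasDerivWithinAt_Ici_of_eventually_eq {g : ℝ → Y → ℝ} {G : ℝ × Y → ℝ} {y : Y}
    (hG : DifferentiableAt ℝ G (0, y))
    (h : ∀ᶠ a in 𝓝 ((0 : ℝ), y), 0 ≤ a.1 → g a.1 a.2 = G a) :
    HasDerivWithinAt (fun s => g s y) (fderiv ℝ G (0, y) (1, 0)) (Ici 0) 0 := by
  have h1 : HasDerivAt (fun s : ℝ => (s, y)) ((1 : ℝ), (0 : Y)) 0 :=
    (hasDerivAt_id 0).prodMk (hasDerivAt_const 0 y)
  have h2 := hG.hasFDerivAt.comp_hasDerivAt (0 : ℝ) h1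
  have h3 : ContinuousAt (fun s : ℝ => (s, y)) 0 := by fun_prop
  refine h2.hasDerivWithinAt.congr_of_eventuallyEq ?_ (h.self_of_nhds le_rfl)
  filter_upwards [nhdsWithin_le_nhds (h3.eventually h), self_mem_nhdsWithin] with s hs hs0
  exact hs hs0

theorem IsOneSidedSmoothAt.hasDerivWithinAt {g : ℝ → Y → ℝ} {y : Y}
    (h : IsOneSidedSmoothAt g y) :
    HasDerivWithinAt (fun s => g s y) (derivWithin (fun s => g s y) (Ici 0) 0) (Ici 0) 0 := by
  obtain ⟨G, hG, h⟩ := h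
  exact (hasDerivWithinAt_Ici_of_eventually_eq
    (hG.differentiableAt (by simp)) h).differentiableWithinAt.hasDerivWithinAt

theorem derivWithin_Ici_eventuallyEq {g : ℝ → Y → ℝ} {G : ℝ × Y → ℝ} {y : Y}
    (hG : ContDiffAt ℝ 1 G (0, y)) (h : ∀ᶠ a in 𝓝 ((0 : ℝ), y), 0 ≤ a.1 → g a.1 a.2 = G a) :
    ∀ᶠ y' in 𝓝 y, HasDerivWithinAt (fun s => g s y') (fderiv ℝ G (0, y') (1, 0)) (Ici 0) 0 ∧
      derivWithin (fun s => g s y') (Ici 0) 0 = fderiv ℝ G (0, y') (1, 0) := by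
  have h3 : ContinuousAt (fun y' : Y => ((0 : ℝ), y')) y := by fun_prop
  filter_upwards [h3.eventually (hG.eventually (by simp)), h3.eventually h.eventually_nhds]
    with y' h1 h2
  have h4 := hasDerivWithinAt_Ici_of_eventually_eq (h1.differentiableAt (by simp)) h2
  exact ⟨h4, h4.derivWithin (uniqueDiffWithinAt_Ici 0)⟩

theorem continuousAt_fderiv_apply {G : ℝ × Y → ℝ} {y : Y} (hG : ContDiffAt ℝ 1 G (0, y))
    (v : ℝ × Y) : ContinuousAt (fun y' => fderiv ℝ G (0, y') v) y := by
  have h1 : ContinuousAt (fderiv ℝ G) (0, y) :=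
    (hG.fderiv_right (m := 0) (by simp)).continuousAt
  have h3 : ContinuousAt (fun y' : Y => ((0 : ℝ), y')) y := by fun_prop
  have h4 : ContinuousAt (fun y' => fderiv ℝ G (0, y')) y :=
    ContinuousAt.comp (f := fun y' : Y => ((0 : ℝ), y')) h1 h3
  exact h4.clm_apply continuousAt_const

theorem IsOneSidedSmoothAt.continuousAt_derivWithin {g : ℝ → Y → ℝ} {y : Y}
    (h : IsOneSidedSmoothAt g y) :
    ContinuousAt (fun y => derivWithin (fun s => g s y) (Ici 0) 0) y := by
  obtain ⟨G, hG, h⟩ := h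
  refine (continuousAt_fderiv_apply hG (1, 0)).congr ?_
  filter_upwards [derivWithin_Ici_eventuallyEq hG h] with y' hy'
  exact hy'.2.symm

/-- A C¹ function is locally Lipschitz, and compactness makes the time ε and the constant C uniform.
This supplies the dominating constant for the difference quotients. -/
theorem exists_uniform_lipschitz {g : ℝ → Y → ℝ} {K : Set Y} (hK : IsCompact K)
    (hg : ∀ y ∈ K, IsOneSidedSmoothAt g y) :
    ∃ ε > 0, ∃ C : ℝ, ∀ s, 0 ≤ s → s < ε → ∀ y ∈ K,
      |g s y - g 0 y| ≤ C * s ∧ ContinuousAt (g s) y := by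
  refine hK.induction_on (p := fun S => ∃ ε > 0, ∃ C : ℝ, ∀ s, 0 ≤ s → s < ε → ∀ y ∈ S,
    |g s y - g 0 y| ≤ C * s ∧ ContinuousAt (g s) y) ?_ ?_ ?_ ?_
  · exact ⟨1, one_pos, 0, by simp⟩
  · rintro S T hST ⟨ε, hε, C, h⟩
    exact ⟨ε, hε, C, fun s hs hs' y hy => h s hs hs' y (hST hy)⟩
  · rintro S T ⟨ε, hε, C, h⟩ ⟨ε', hε', C', h'⟩
    refine ⟨min ε ε', lt_min hε hε', max C C', fun s hs hs' y hy => ?_⟩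
    rcases hy with hy | hy
    · obtain ⟨h1, h2⟩ := h s hs (hs'.trans_le (min_le_left _ _)) y hy
      exact ⟨h1.trans (mul_le_mul_of_nonneg_right (le_max_left _ _) hs), h2⟩
    · obtain ⟨h1, h2⟩ := h' s hs (hs'.trans_le (min_le_right _ _)) y hy
      exact ⟨h1.trans (mul_le_mul_of_nonneg_right (le_max_right _ _) hs), h2⟩
  · intro y hy
    obtain ⟨G, hG, h⟩ := hg y hy
    obtain ⟨C, t, ht, hlip⟩ := hG.exists_lipschitzOnWith
    have hcont : ∀ᶠ a in 𝓝 ((0 : ℝ), y), ContinuousAt G a :=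
      (hG.eventually (by simp)).mono fun a ha => ha.continuousAt
    have ht' : ∀ᶠ a in 𝓝 ((0 : ℝ), y), a ∈ t := ht
    have hall := ht'.and (hcont.and h.eventually_nhds)
    rw [nhds_prod_eq] at hall
    obtain ⟨S, hS, T, hT, hST⟩ := Filter.eventually_prod_iff.1 hall
    obtain ⟨ε, hε, hball⟩ := Metric.eventually_nhds_iff.1 hS
    refine ⟨{y | T y}, nhdsWithin_le_nhds hT, ε, hε, C, fun s hs hs' y' hy' => ?_⟩
    have hSs : S s := hball (by rw [Real.dist_eq, sub_zero, abs_of_nonneg hs]; exact hs')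
    have hS0 : S 0 := hball (by rw [dist_self]; exact hε)
    obtain ⟨h1, h2, h3⟩ := hST hSs hy'
    obtain ⟨h1', -, h3'⟩ := hST hS0 hy'
    refine ⟨?_, ?_⟩
    · rw [h3.self_of_nhds hs, h3'.self_of_nhds le_rfl, ← Real.dist_eq]
      refine (hlip.dist_le_mul _ h1 _ h1').trans_eq ?_
      rw [Prod.dist_eq, dist_self, Real.dist_eq, sub_zero, abs_of_nonneg hs, max_eq_left hs]
    · have h4 : ContinuousAt (fun y'' : Y => (s, y'')) y' := by fun_prop
      have h5 : ContinuousAt (fun y'' => G (s, y'')) y' :=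
        ContinuousAt.comp (f := fun y'' : Y => (s, y'')) h2 h4
      refine h5.congr ?_
      filter_upwards [h4.eventually h3] with y'' hy''
      exact (hy'' hs).symm

variable [MeasurableSpace Y] [BorelSpace Y] {μ : Measure Y}
  [IsFiniteMeasureOnCompacts μ]

omit [NormedSpace ℝ Y] in
theorem integrableOn_mul_of_continuousAt {K : Set Y} (hK : IsCompact K) {β : Y → ℝ}
    (hβ : AEStronglyMeasurable β (μ.restrict K)) (hβ1 : ∀ y ∈ K, ‖β y‖ ≤ 1) {f : Y → ℝ}
    (hf : ∀ y ∈ K, ContinuousAt f y) : IntegrableOn (fun y => β y * f y) K μ := by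
  have h1 : IntegrableOn f K μ :=
    ContinuousOn.integrableOn_compact hK fun y hy => (hf y hy).continuousWithinAt
  refine Integrable.bdd_mul (c := 1) h1 hβ ?_
  exact (ae_restrict_iff' hK.measurableSet).2 (ae_of_all _ hβ1)

/-- Differentiation from the right of an integral over a compact set. -/
theorem hasDerivWithinAt_integral_of_oneSidedSmooth {g : ℝ → Y → ℝ} {K : Set Y}
    (hK : IsCompact K) (hg : ∀ y ∈ K, IsOneSidedSmoothAt g y) {β : Y → ℝ}
    (hβ : AEStronglyMeasurable β (μ.restrict K)) (hβ1 : ∀ y ∈ K, ‖β y‖ ≤ 1) :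
    HasDerivWithinAt (fun s => ∫ y in K, β y * g s y ∂μ)
      (∫ y in K, β y * derivWithin (fun s => g s y) (Ici 0) 0 ∂μ) (Ici 0) 0 := by
  obtain ⟨ε, hε, C, hC⟩ := exists_uniform_lipschitz hK hg
  have hint : ∀ s, 0 ≤ s → s < ε → IntegrableOn (fun y => β y * g s y) K μ := fun s hs hs' =>
    integrableOn_mul_of_continuousAt hK hβ hβ1 fun y hy => (hC s hs hs' y hy).2
  rw [← hasDerivWithinAt_Ioi_iff_Ici, hasDerivWithinAt_iff_tendsto_slope' self_notMem_Ioi]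
  have hsmall : ∀ᶠ s in 𝓝[>] (0 : ℝ), 0 < s ∧ s < ε :=
    Ioo_mem_nhdsGT hε
  have heq : (fun s => ∫ y in K, β y * (s⁻¹ * (g s y - g 0 y)) ∂μ) =ᶠ[𝓝[>] 0]
      slope (fun s => ∫ y in K, β y * g s y ∂μ) 0 := by
    filter_upwards [hsmall] with s hs
    rw [slope_def_field, ← integral_sub (hint s hs.1.le hs.2) (hint 0 le_rfl hε), sub_zero,
      ← integral_div]
    refine integral_congr_ae (ae_of_all _ fun y => ?_)
    simp only
    ring
  refine Tendsto.congr' heq ?_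
  -- The constant C is integrable because K has finite measure.
  refine tendsto_integral_filter_of_dominated_convergence (fun _ => C) ?_ ?_ ?_ ?_
  · filter_upwards [hsmall] with s hs
    have h1 := ((hint s hs.1.le hs.2).sub (hint 0 le_rfl hε)).aestronglyMeasurable.const_mul s⁻¹
    refine h1.congr (ae_of_all _ fun y => ?_)
    simp only [Pi.sub_apply]
    ring
  · filter_upwards [hsmall] with s hs
    refine (ae_restrict_iff' hK.measurableSet).2 (ae_of_all _ fun y hy => ?_)
    rw [norm_mul, norm_mul, norm_inv, Real.norm_of_nonneg hs.1.le]
    have h1 := (hC s hs.1.le hs.2 y hy).1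
    have h2 : s⁻¹ * ‖g s y - g 0 y‖ ≤ C := by
      rw [inv_mul_le_iff₀ hs.1, Real.norm_eq_abs, mul_comm]
      exact h1
    calc ‖β y‖ * (s⁻¹ * ‖g s y - g 0 y‖) ≤ 1 * (s⁻¹ * ‖g s y - g 0 y‖) :=
          mul_le_mul_of_nonneg_right (hβ1 y hy)
            (mul_nonneg (inv_nonneg.2 hs.1.le) (norm_nonneg _))
      _ ≤ C := by rw [one_mul]; exact h2
  · exact integrable_const_iff.2 (Or.inr ⟨by simpa using hK.measure_lt_top⟩)
  · refine (ae_restrict_iff' hK.measurableSet).2 (ae_of_all _ fun y hy => ?_)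
    have h1 := (hg y hy).hasDerivWithinAt
    rw [← hasDerivWithinAt_Ioi_iff_Ici, hasDerivWithinAt_iff_tendsto_slope' self_notMem_Ioi] at h1
    refine (h1.const_mul (β y)).congr fun s => ?_
    rw [slope_def_field, sub_zero]
    ring

end DominatedDerivative

/-! ### Differentials in arbitrary charts -/

section Frames

variable {n d : ℕ} {N : Type*} [TopologicalSpace N] [ChartedSpace (E d) N]
  [IsManifold 𝓘(ℝ, E d) ∞ N] {X : Type*} [TopologicalSpace X] [ChartedSpace (E n) X]
  [IsManifold 𝓘(ℝ, E n) ∞ X]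

/-- The frame of tangent vectors to `N`, in the chart at `b`, that are the images under the
differential of `g` of the coordinate vectors of the chart of `X` centred at `c`. -/
def localFrame (c : X) (b : N) (g : X → N) (y : E n) : Fin n → E d := fun i =>
  fderiv ℝ (fun y' => extChartAt 𝓘(ℝ, E d) b (g ((extChartAt 𝓘(ℝ, E n) c).symm y'))) y
    (EuclideanSpace.single i 1)

/-- The chain rule for transition map, g in the preferred charts, transition map. The last
transition is then inverted by `fromChart`. -/
theorem mfderiv_fromChart {g : X → N} {c : X} {b : N} {x : X}
    (hx : x ∈ (extChartAt 𝓘(ℝ, E n) c).source) (hg : MDifferentiableAt 𝓘(ℝ, E n) 𝓘(ℝ, E d) g x)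
    (hb : g x ∈ (extChartAt 𝓘(ℝ, E d) b).source) (i : Fin n) :
    mfderiv 𝓘(ℝ, E n) 𝓘(ℝ, E d) g x (fromChart c x (EuclideanSpace.single i 1)) =
      fromChart b (g x) (localFrame c b g (extChartAt 𝓘(ℝ, E n) c x) i) := by
  have h1 : HasFDerivAt ((extChartAt 𝓘(ℝ, E n) x) ∘ (extChartAt 𝓘(ℝ, E n) c).symm)
      (fromChart c x) (extChartAt 𝓘(ℝ, E n) c x) := by
    have := hasFDerivWithinAt_tangentCoordChange (I := 𝓘(ℝ, E n)) (x := c) (y := x) (z := x)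
      ⟨hx, mem_extChartAt_source x⟩
    exact this.hasFDerivAt (by simp)
  have h2 : HasFDerivAt (writtenInExtChartAt 𝓘(ℝ, E n) 𝓘(ℝ, E d) x g)
      (mfderiv 𝓘(ℝ, E n) 𝓘(ℝ, E d) g x) (extChartAt 𝓘(ℝ, E n) x x) := by
    have := hg.hasMFDerivAt.2
    exact this.hasFDerivAt (by simp)
  have h3 : HasFDerivAt ((extChartAt 𝓘(ℝ, E d) b) ∘ (extChartAt 𝓘(ℝ, E d) (g x)).symm)
      (toChart b (g x)) (extChartAt 𝓘(ℝ, E d) (g x) (g x)) := by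
    have := hasFDerivWithinAt_tangentCoordChange (I := 𝓘(ℝ, E d)) (x := g x) (y := b) (z := g x)
      ⟨mem_extChartAt_source _, hb⟩
    exact this.hasFDerivAt (by simp)
  have hyx : (extChartAt 𝓘(ℝ, E n) c).symm (extChartAt 𝓘(ℝ, E n) c x) = x :=
    (extChartAt 𝓘(ℝ, E n) c).left_inv hx
  have hx1 : ((extChartAt 𝓘(ℝ, E n) x) ∘ (extChartAt 𝓘(ℝ, E n) c).symm)
      (extChartAt 𝓘(ℝ, E n) c x) = extChartAt 𝓘(ℝ, E n) x x := congrArg _ hyx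
  have hg1 : writtenInExtChartAt 𝓘(ℝ, E n) 𝓘(ℝ, E d) x g (extChartAt 𝓘(ℝ, E n) x x) =
      extChartAt 𝓘(ℝ, E d) (g x) (g x) := by
    simp only [writtenInExtChartAt, Function.comp_apply, extChartAt_to_inv]
  rw [← hg1] at h3
  have h4 := h3.comp _ h2
  rw [← hx1] at h4
  have h5 := h4.comp _ h1
  have hcont : ContinuousAt (extChartAt 𝓘(ℝ, E n) c).symm (extChartAt 𝓘(ℝ, E n) c x) :=
    continuousAt_extChartAt_symm' hx
  have heq : (fun y' => extChartAt 𝓘(ℝ, E d) b (g ((extChartAt 𝓘(ℝ, E n) c).symm y')))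
      =ᶠ[𝓝 (extChartAt 𝓘(ℝ, E n) c x)]
      ((extChartAt 𝓘(ℝ, E d) b ∘ (extChartAt 𝓘(ℝ, E d) (g x)).symm) ∘
        writtenInExtChartAt 𝓘(ℝ, E n) 𝓘(ℝ, E d) x g) ∘
        (extChartAt 𝓘(ℝ, E n) x) ∘ (extChartAt 𝓘(ℝ, E n) c).symm := by
    have hs1 : (extChartAt 𝓘(ℝ, E n) x).source ∈ 𝓝 ((extChartAt 𝓘(ℝ, E n) c).symm
        (extChartAt 𝓘(ℝ, E n) c x)) := by
      rw [hyx]; exact extChartAt_source_mem_nhds x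
    have hs2 : g ⁻¹' (extChartAt 𝓘(ℝ, E d) (g x)).source ∈ 𝓝 ((extChartAt 𝓘(ℝ, E n) c).symm
        (extChartAt 𝓘(ℝ, E n) c x)) := by
      rw [hyx]; exact hg.continuousAt.preimage_mem_nhds (extChartAt_source_mem_nhds (g x))
    filter_upwards [hcont.preimage_mem_nhds hs1, hcont.preimage_mem_nhds hs2] with y' hy1 hy2
    simp only [writtenInExtChartAt, Function.comp_apply]
    rw [(extChartAt 𝓘(ℝ, E n) x).left_inv hy1, (extChartAt 𝓘(ℝ, E d) (g x)).left_inv hy2]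
  rw [localFrame, (h5.congr_of_eventuallyEq heq).fderiv]
  exact (fromChart_toChart hb _).symm

end Frames

theorem fderiv_apply_eq_zero_of_const {Y V : Type*} [NormedAddCommGroup Y] [NormedSpace ℝ Y]
    [NormedAddCommGroup V] [NormedSpace ℝ V] {f : ℝ × Y → V} (h : ∀ a, f a = f (0, a.2)) (y : Y) :
    fderiv ℝ f (0, y) (1, 0) = 0 := by
  by_cases hf : DifferentiableAt ℝ f (0, y)
  · have h1 : HasDerivAt (fun s : ℝ => (s, y)) ((1 : ℝ), (0 : Y)) 0 :=
      (hasDerivAt_id 0).prodMk (hasDerivAt_const 0 y)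
    have h2 := hf.hasFDerivAt.comp_hasDerivAt (0 : ℝ) h1
    have h3 : (f ∘ fun s : ℝ => (s, y)) = fun _ => f (0, y) := funext fun s => h (s, y)
    rw [h3] at h2
    exact h2.unique (hasDerivAt_const _ _)
  · rw [fderiv_zero_of_not_differentiableAt hf]
    rfl

/-! ### The integrand of the action in charts and its first variation -/

section LocalAction

variable {n d : ℕ} {N : Type*} [TopologicalSpace N] [ChartedSpace (E d) N]
  [IsManifold 𝓘(ℝ, E d) ∞ N] {X : Type*} [TopologicalSpace X] [ChartedSpace (E n) X]
  [IsManifold 𝓘(ℝ, E n) ∞ X]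

/-- The integrand `γ^* (θ - ℋ ω)` of the action. -/
def actionForm (om : N → Form n d) (L : N → NVec n d → ℝ) (γ : X → FormBundle n d N) (x : X) :
    Form n n :=
  pullTheta γ x - hamiltonian om L (γ x) • pullVolume om γ x

theorem coeff_pullTheta {γ : X → FormBundle n d N} {c : X} {b : N} {x : X}
    (hx : x ∈ (extChartAt 𝓘(ℝ, E n) c).source)
    (hγ : MDifferentiableAt 𝓘(ℝ, E n) 𝓘(ℝ, E d) (fun x => (γ x).pt) x)
    (hb : (γ x).pt ∈ (extChartAt 𝓘(ℝ, E d) b).source) :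
    coeff c (pullTheta γ) x =
      (coord b (γ x)).2 (localFrame c b (fun x => (γ x).pt) (extChartAt 𝓘(ℝ, E n) c x)) := by
  change (γ x).form (fun i => dbase γ x (fromChart c x (EuclideanSpace.single i 1))) =
    (γ x).form (fun i => fromChart b (γ x).pt _)
  congr 1
  funext i
  exact mfderiv_fromChart hx hγ hb i

theorem localForm_extChartAt (om : N → Form n d) {b q : N}
    (hb : q ∈ (extChartAt 𝓘(ℝ, E d) b).source) :
    localForm om b (extChartAt 𝓘(ℝ, E d) b q) = (coord b (⟨q, om q⟩ : FormBundle n d N)).2 := by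
  rw [localForm, (extChartAt 𝓘(ℝ, E d) b).left_inv hb]

theorem coeff_pullVolume {om : N → Form n d} {γ : X → FormBundle n d N} {c : X} {b : N} {x : X}
    (hx : x ∈ (extChartAt 𝓘(ℝ, E n) c).source)
    (hγ : MDifferentiableAt 𝓘(ℝ, E n) 𝓘(ℝ, E d) (fun x => (γ x).pt) x)
    (hb : (γ x).pt ∈ (extChartAt 𝓘(ℝ, E d) b).source) :
    coeff c (pullVolume om γ) x =
      localForm om b (extChartAt 𝓘(ℝ, E d) b (γ x).pt)
        (localFrame c b (fun x => (γ x).pt) (extChartAt 𝓘(ℝ, E n) c x)) := by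
  rw [localForm_extChartAt om hb]
  exact coeff_pullTheta (γ := fun x => ⟨(γ x).pt, om (γ x).pt⟩) hx hγ hb

omit [IsManifold 𝓘(ℝ, E d) ∞ N] in
theorem coeff_actionForm {om : N → Form n d} {L : N → NVec n d → ℝ} {γ : X → FormBundle n d N}
    {c x : X} :
    coeff c (actionForm om L γ) x =
      coeff c (pullTheta γ) x - hamiltonian om L (γ x) * coeff c (pullVolume om γ) x := rfl

/-- The base point of `P s x`, in charts. -/
def baseRep (c : X) (b : N) (P : ℝ → X → FormBundle n d N) (a : ℝ × E n) : E d :=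
  extChartAt 𝓘(ℝ, E d) b (P a.1 ((extChartAt 𝓘(ℝ, E n) c).symm a.2)).pt

/-- The form of `P s x`, in charts. -/
def formRep (c : X) (b : N) (P : ℝ → X → FormBundle n d N) (a : ℝ × E n) : Form n d :=
  (coord b (P a.1 ((extChartAt 𝓘(ℝ, E n) c).symm a.2))).2

/-- The coordinate frame of the base of `P s`, in charts. -/
def frameRep (c : X) (b : N) (P : ℝ → X → FormBundle n d N) (a : ℝ × E n) : Fin n → E d :=
  localFrame c b (fun x => (P a.1 x).pt) a.2

variable {P : ℝ → X → FormBundle n d N} {c : X} {b : N} {a : ℝ × E n}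

theorem contMDiffAt_prod_extChartAt_symm (ha : a.2 ∈ (extChartAt 𝓘(ℝ, E n) c).target) :
    ContMDiffAt 𝓘(ℝ, ℝ × E n) (𝓘(ℝ, ℝ).prod 𝓘(ℝ, E n)) ∞
      (fun a : ℝ × E n => (a.1, (extChartAt 𝓘(ℝ, E n) c).symm a.2)) a := by
  refine contDiff_fst.contMDiff.contMDiffAt.prodMk ?_
  have h1 : ContMDiffAt 𝓘(ℝ, E n) 𝓘(ℝ, E n) ∞ (extChartAt 𝓘(ℝ, E n) c).symm a.2 :=
    (contMDiffOn_extChartAt_symm c).contMDiffAt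
      ((isOpen_extChartAt_target (I := 𝓘(ℝ, E n)) c).mem_nhds ha)
  exact h1.comp a contDiff_snd.contMDiff.contMDiffAt

theorem contDiffAt_baseRep (ha : a.2 ∈ (extChartAt 𝓘(ℝ, E n) c).target)
    (hP : ContMDiffAt (𝓘(ℝ, ℝ).prod 𝓘(ℝ, E n)) 𝓘(ℝ, E d) ∞ (fun a : ℝ × X => (P a.1 a.2).pt)
      (a.1, (extChartAt 𝓘(ℝ, E n) c).symm a.2))
    (hb : (P a.1 ((extChartAt 𝓘(ℝ, E n) c).symm a.2)).pt ∈ (extChartAt 𝓘(ℝ, E d) b).source) :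
    ContDiffAt ℝ ∞ (baseRep c b P) a := by
  rw [← contMDiffAt_iff_contDiffAt]
  have h1 := contMDiffAt_prod_extChartAt_symm ha
  rw [extChartAt_source] at hb
  have h2 := (contMDiffAt_extChartAt' (I := 𝓘(ℝ, E d)) (n := ∞) hb)
  have h3 := ContMDiffAt.comp (f := fun a : ℝ × X => (P a.1 a.2).pt)
    (g := extChartAt 𝓘(ℝ, E d) b) (a.1, (extChartAt 𝓘(ℝ, E n) c).symm a.2) h2 hP
  exact ContMDiffAt.comp (f := fun a : ℝ × E n => (a.1, (extChartAt 𝓘(ℝ, E n) c).symm a.2))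
    (g := extChartAt 𝓘(ℝ, E d) b ∘ fun a : ℝ × X => (P a.1 a.2).pt) a h3 h1

theorem contDiffAt_formRep (ha : a.2 ∈ (extChartAt 𝓘(ℝ, E n) c).target)
    (hP : ContMDiffAt (𝓘(ℝ, ℝ).prod 𝓘(ℝ, E n)) 𝓘(ℝ, Form n d) ∞
      (fun a : ℝ × X => (coord b (P a.1 a.2)).2)
      (a.1, (extChartAt 𝓘(ℝ, E n) c).symm a.2)) :
    ContDiffAt ℝ ∞ (formRep c b P) a := by
  rw [← contMDiffAt_iff_contDiffAt]
  exact ContMDiffAt.comp (f := fun a : ℝ × E n => (a.1, (extChartAt 𝓘(ℝ, E n) c).symm a.2))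
    (g := fun a : ℝ × X => (coord b (P a.1 a.2)).2) a hP (contMDiffAt_prod_extChartAt_symm ha)

omit [IsManifold 𝓘(ℝ, E d) ∞ N] [IsManifold 𝓘(ℝ, E n) ∞ X] in
theorem contDiffAt_frameRep (h : ContDiffAt ℝ ∞ (baseRep c b P) a) :
    ContDiffAt ℝ ∞ (frameRep c b P) a := by
  refine contDiffAt_pi.2 fun i => ?_
  have h1 : ContDiffAt ℝ ∞ (fun a : ℝ × E n => fderiv ℝ (fun y => baseRep c b P (a.1, y)) a.2) a := by
    refine ContDiffAt.fderiv (n := ∞) (f := fun (a : ℝ × E n) y => baseRep c b P (a.1, y))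
      (g := fun a : ℝ × E n => a.2) ?_ contDiffAt_snd (by simp)
    exact ContDiffAt.comp (g := baseRep c b P)
      (f := fun z : (ℝ × E n) × E n => (z.1.1, z.2)) (a, a.2) h (by fun_prop)
  exact h1.clm_apply contDiffAt_const

variable {om : N → Form n d} {L : N → NVec n d → ℝ} {M : Set (FormBundle n d N)} {r : ℕ}

/-- The local expression of the action of a deformation `P s` in `ℳ`, and its first variation. -/
theorem LegendreCorrespondenceHypothesis.exists_localAction (hn : 1 ≤ n)
    (hom : IsSpaceTimeVolume om) (hL : SmoothLagrangian om L)
    (hM : LegendreCorrespondenceHypothesis om L M r) {x₀ : X}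
    (hx₀ : x₀ ∈ (extChartAt 𝓘(ℝ, E n) c).source)
    (hpt : ContMDiffAt (𝓘(ℝ, ℝ).prod 𝓘(ℝ, E n)) 𝓘(ℝ, E d) ∞ (fun a : ℝ × X => (P a.1 a.2).pt)
      (0, x₀))
    (hform : ContMDiffAt (𝓘(ℝ, ℝ).prod 𝓘(ℝ, E n)) 𝓘(ℝ, Form n d) ∞
      (fun a : ℝ × X => (coord (P 0 x₀).pt (P a.1 a.2)).2) (0, x₀))
    (hmem : P 0 x₀ ∈ M) {z₀ : NVec n d} (hz₀ : z₀ ∈ Z om L (P 0 x₀)) {y₀ : E n} {v₀ : Fin n → E d}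
    (hy₀ : y₀ = extChartAt 𝓘(ℝ, E n) c x₀) (hv₀ : v₀ = frameRep c (P 0 x₀).pt P (0, y₀)) :
    ∃ G : ℝ × E n → ℝ, ContDiffAt ℝ ∞ G (0, y₀) ∧
      (∀ᶠ a in 𝓝 ((0 : ℝ), y₀), P a.1 ((extChartAt 𝓘(ℝ, E n) c).symm a.2) ∈ M →
        coeff c (actionForm om L (P a.1)) ((extChartAt 𝓘(ℝ, E n) c).symm a.2) = G a) ∧
      (om (P 0 x₀).pt v₀ ≠ 0 → (om (P 0 x₀).pt v₀)⁻¹ • wedge v₀ = z₀ →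
        fderiv ℝ G (0, y₀) (1, 0) = fderiv ℝ (frameLagrangian om L (P 0 x₀).pt)
          (extChartAt 𝓘(ℝ, E d) (P 0 x₀).pt (P 0 x₀).pt, v₀)
          (fderiv ℝ (baseRep c (P 0 x₀).pt P) (0, y₀) (1, 0),
            fderiv ℝ (frameRep c (P 0 x₀).pt P) (0, y₀) (1, 0))) ∧
      ((∀ s x, (P s x).pt = (P 0 x).pt) →
        fderiv ℝ G (0, y₀) (1, 0) =
          (fderiv ℝ (formRep c (P 0 x₀).pt P) (0, y₀) (1, 0)) v₀ -
          z₀ (fderiv ℝ (formRep c (P 0 x₀).pt P) (0, y₀) (1, 0)) * om (P 0 x₀).pt v₀) := by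
  obtain ⟨h, hh, hheq, hhv, hexc⟩ := hM.exists_localHamiltonian hn hom hL hmem hz₀
  obtain ⟨b, hb⟩ : ∃ b, b = (P 0 x₀).pt := ⟨_, rfl⟩
  have hyt : y₀ ∈ (extChartAt 𝓘(ℝ, E n) c).target := hy₀ ▸ (extChartAt 𝓘(ℝ, E n) c).map_source hx₀
  have hyx : (extChartAt 𝓘(ℝ, E n) c).symm y₀ = x₀ := by
    rw [hy₀]; exact (extChartAt 𝓘(ℝ, E n) c).left_inv hx₀
  have hbs : (P 0 x₀).pt ∈ (extChartAt 𝓘(ℝ, E d) b).source := by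
    rw [hb]; exact mem_extChartAt_source _
  have hcoord : coord (P 0 x₀).pt (P 0 x₀) = (extChartAt 𝓘(ℝ, E d) b b, (P 0 x₀).form) := by
    rw [hb]
    exact Prod.ext rfl (coord_self_snd _ _)
  rw [hcoord] at hh hheq hhv
  rw [← hb] at hform hv₀ hheq hexc ⊢
  have hQ : ContDiffAt ℝ ∞ (baseRep c b P) (0, y₀) :=
    contDiffAt_baseRep hyt (by rw [hyx]; exact hpt) (by rw [hyx]; exact hbs)
  have hp : ContDiffAt ℝ ∞ (formRep c b P) (0, y₀) :=
    contDiffAt_formRep hyt (by rw [hyx]; exact hform)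
  have hF := contDiffAt_frameRep hQ
  have hQ₀ : baseRep c b P (0, y₀) = extChartAt 𝓘(ℝ, E d) b b := by
    simp only [baseRep, hyx, hb]
  have hp₀ : formRep c b P (0, y₀) = (P 0 x₀).form := by
    simp only [formRep, hyx, hb]
    exact coord_self_snd _ _
  -- The integrand as a function of independent variables: base point q, frame v and form p.
  obtain ⟨Gh, hGh⟩ : ∃ Gh : E d × (Fin n → E d) × Form n d → ℝ,
    Gh = fun a => a.2.2 a.2.1 - h (a.1, a.2.2) * localForm om b a.1 a.2.1 := ⟨_, rfl⟩
  have hGhc : ContDiffAt ℝ ∞ Gh (extChartAt 𝓘(ℝ, E d) b b, v₀, (P 0 x₀).form) := by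
    rw [hGh]
    refine ContDiffAt.sub ?_ (ContDiffAt.mul ?_ ?_)
    · exact ((contDiff_form_apply (n := n) (d := d)).comp (((contDiff_snd).comp contDiff_snd).prodMk
        (contDiff_fst.comp contDiff_snd))).contDiffAt
    · exact ContDiffAt.comp (f := fun a : E d × (Fin n → E d) × Form n d => (a.1, a.2.2))
        (extChartAt 𝓘(ℝ, E d) b b, v₀, (P 0 x₀).form) hh (by fun_prop)
    · exact ContDiffAt.comp (f := fun a : E d × (Fin n → E d) × Form n d => (a.1, a.2.1))
        (g := fun a : E d × (Fin n → E d) => localForm om b a.1 a.2)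
        (extChartAt 𝓘(ℝ, E d) b b, v₀, (P 0 x₀).form)
        (contDiffAt_localForm_apply hom (mem_extChartAt_target b)) (by fun_prop)
  have hR : ContDiffAt ℝ ∞ (fun a => (baseRep c b P a, frameRep c b P a, formRep c b P a))
      (0, y₀) := hQ.prodMk (hF.prodMk hp)
  have hR₀ : (baseRep c b P (0, y₀), frameRep c b P (0, y₀), formRep c b P (0, y₀)) =
    (extChartAt 𝓘(ℝ, E d) b b, v₀, (P 0 x₀).form) := by rw [hQ₀, hp₀, hv₀]
  rw [← hR₀] at hGhc
  have hder : ∀ t, fderiv ℝ (fun a => Gh (baseRep c b P a, frameRep c b P a, formRep c b P a))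
      (0, y₀) t = fderiv ℝ Gh (extChartAt 𝓘(ℝ, E d) b b, v₀, (P 0 x₀).form)
        (fderiv ℝ (baseRep c b P) (0, y₀) t, fderiv ℝ (frameRep c b P) (0, y₀) t,
          fderiv ℝ (formRep c b P) (0, y₀) t) := fun t => by
    have h1 := (hGhc.differentiableAt (by simp)).hasFDerivAt.comp (0, y₀)
      ((hQ.differentiableAt (by simp)).hasFDerivAt.prodMk
        ((hF.differentiableAt (by simp)).hasFDerivAt.prodMk
          (hp.differentiableAt (by simp)).hasFDerivAt))
    rw [hR₀] at h1
    exact congrArg (fun T : ℝ × E n →L[ℝ] ℝ => T t) h1.fderiv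
  refine ⟨fun a => Gh (baseRep c b P a, frameRep c b P a, formRep c b P a),
    ContDiffAt.comp (0, y₀) hGhc hR, ?_, ?_, ?_⟩
  · have hpt' : ∀ᶠ a : ℝ × X in 𝓝 (0, x₀),
        ContMDiffAt (𝓘(ℝ, ℝ).prod 𝓘(ℝ, E n)) 𝓘(ℝ, E d) 1 (fun a : ℝ × X => (P a.1 a.2).pt) a ∧
        (P a.1 a.2).pt ∈ (extChartAt 𝓘(ℝ, E d) b).source := by
      have h1 : ContMDiffAt (𝓘(ℝ, ℝ).prod 𝓘(ℝ, E n)) 𝓘(ℝ, E d) 1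
        (fun a : ℝ × X => (P a.1 a.2).pt) (0, x₀) := hpt.of_le (by simp)
      have : IsManifold 𝓘(ℝ, E n) 1 X := IsManifold.of_le (n := ∞) (by simp)
      have : IsManifold 𝓘(ℝ, E d) 1 N := IsManifold.of_le (n := ∞) (by simp)
      refine ((contMDiffAt_iff_contMDiffAt_nhds (by simp)).1 h1).and ?_
      exact hpt.continuousAt.preimage_mem_nhds
        ((isOpen_extChartAt_source (I := 𝓘(ℝ, E d)) b).mem_nhds hbs)
    have hchart : Tendsto (fun a : ℝ × E n => (a.1, (extChartAt 𝓘(ℝ, E n) c).symm a.2))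
        (𝓝 (0, y₀)) (𝓝 (0, x₀)) := by
      have := (contMDiffAt_prod_extChartAt_symm (a := ((0 : ℝ), y₀)) hyt).continuousAt
      rw [ContinuousAt, hyx] at this
      exact this
    have hQp : Tendsto (fun a => (baseRep c b P a, formRep c b P a)) (𝓝 (0, y₀))
        (𝓝 (extChartAt 𝓘(ℝ, E d) b b, (P 0 x₀).form)) := by
      rw [← hQ₀, ← hp₀]
      exact hQ.continuousAt.prodMk hp.continuousAt
    filter_upwards [hchart.eventually hpt', hQp.eventually hheq,
      continuous_snd.continuousAt.preimage_mem_nhds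
        ((isOpen_extChartAt_target (I := 𝓘(ℝ, E n)) c).mem_nhds hyt)] with a ha1 ha2 ha3 haM
    obtain ⟨ha1, ha1'⟩ := ha1
    have hxs := (extChartAt 𝓘(ℝ, E n) c).map_target ha3
    have hslice : MDifferentiableAt 𝓘(ℝ, E n) 𝓘(ℝ, E d) (fun x => (P a.1 x).pt)
        ((extChartAt 𝓘(ℝ, E n) c).symm a.2) := by
      have h1 : ContMDiffAt 𝓘(ℝ, E n) (𝓘(ℝ, ℝ).prod 𝓘(ℝ, E n)) 1 (fun x : X => (a.1, x))
        ((extChartAt 𝓘(ℝ, E n) c).symm a.2) := contMDiffAt_const.prodMk contMDiffAt_id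
      exact (ContMDiffAt.comp _ ha1 h1).mdifferentiableAt (by simp)
    have hof : ofCoord b (baseRep c b P a, formRep c b P a) =
      P a.1 ((extChartAt 𝓘(ℝ, E n) c).symm a.2) := ofCoord_coord ha1'
    rw [hof] at ha2
    rw [coeff_actionForm, coeff_pullTheta hxs hslice ha1', coeff_pullVolume hxs hslice ha1',
      (extChartAt 𝓘(ℝ, E n) c).right_inv ha3, ha2 haM, hGh]
    rfl
  · intro hv hz
    rw [hder, hGh]
    exact hexc v₀ hv hz _
  -- With the base fixed, q and v do not vary. What remains is the derivative of `Gh` in p, computed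
  -- along the line p₀ + t p, where the derivative of the local Hamiltonian is z₀.
  · intro hconst
    have hQc : ∀ a, baseRep c b P a = baseRep c b P (0, a.2) := fun a => by
      simp only [baseRep, hconst a.1]
    have hFc : ∀ a, frameRep c b P a = frameRep c b P (0, a.2) := fun a => by
      simp only [frameRep, hconst a.1]
    rw [hder, fderiv_apply_eq_zero_of_const hQc, fderiv_apply_eq_zero_of_const hFc]
    generalize fderiv ℝ (formRep c b P) (0, y₀) (1, 0) = p
    have hline : HasDerivAt (fun t : ℝ => (P 0 x₀).form + t • p) p 0 := by
      simpa using ((hasDerivAt_id (0 : ℝ)).smul_const p).const_add (P 0 x₀).form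
    have h1 : HasDerivAt (fun t : ℝ => (extChartAt 𝓘(ℝ, E d) b b, v₀, (P 0 x₀).form + t • p))
        ((0 : E d), (0 : Fin n → E d), p) 0 :=
      (hasDerivAt_const _ _).prodMk ((hasDerivAt_const _ _).prodMk hline)
    have h1' : HasDerivAt (fun t : ℝ => (extChartAt 𝓘(ℝ, E d) b b, (P 0 x₀).form + t • p))
        ((0 : E d), p) 0 := (hasDerivAt_const _ _).prodMk hline
    have hz : (P 0 x₀).form + (0 : ℝ) • p = (P 0 x₀).form := by rw [zero_smul, add_zero]
    rw [hR₀] at hGhc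
    have h2 := HasFDerivAt.comp_hasDerivAt_of_eq (0 : ℝ)
      (hGhc.differentiableAt (by simp)).hasFDerivAt h1 (by rw [hz])
    have h3 := HasFDerivAt.comp_hasDerivAt_of_eq (0 : ℝ)
      (hh.differentiableAt (by simp)).hasFDerivAt h1' (by rw [hz])
    rw [hhv] at h3
    have h4 : HasDerivAt (fun t : ℝ => ((P 0 x₀).form + t • p) v₀) (p v₀) 0 := by
      have : HasDerivAt (fun t : ℝ => (P 0 x₀).form v₀ + t * p v₀) (p v₀) 0 := by
        simpa using ((hasDerivAt_id (0 : ℝ)).mul_const (p v₀)).const_add ((P 0 x₀).form v₀)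
      exact this
    have h5 := h4.sub (h3.mul_const (localForm om b (extChartAt 𝓘(ℝ, E d) b b) v₀))
    rw [localForm_center] at h5
    refine h2.unique ?_
    convert h5 using 1
    funext t
    simp only [hGh, Function.comp_apply, Pi.sub_apply, localForm_center]

end LocalAction

/-! ### Top-degree forms and their coefficients -/

section Coefficients

variable {n : ℕ} {X : Type*} [TopologicalSpace X] [ChartedSpace (E n) X]
  [IsManifold 𝓘(ℝ, E n) ∞ X]

/-- The frame v is a matrix times the coordinate frame, and D is the determinant of that matrix, the
same for all forms. -/
theorem exists_det_coeff {c x : X} (hx : x ∈ (extChartAt 𝓘(ℝ, E n) c).source)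
    (v : Fin n → E n) :
    ∃ D : ℝ, ∀ p : Form n n, p v = D * p (fun i => fromChart c x (EuclideanSpace.single i 1)) := by
  refine ⟨Matrix.det (Matrix.of fun i k => (toChart c x (v i)) k), fun p => ?_⟩
  rw [← form_linearCombination]
  congr 1
  funext i
  have h1 := (EuclideanSpace.basisFun (Fin n) ℝ).sum_repr (toChart c x (v i))
  simp only [EuclideanSpace.basisFun_repr, EuclideanSpace.basisFun_apply] at h1
  conv_lhs => rw [← fromChart_toChart hx (v i), ← h1]
  rw [map_sum]
  simp only [map_smul, Matrix.of_apply]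

theorem eq_of_coeff_eq {c x : X} (hx : x ∈ (extChartAt 𝓘(ℝ, E n) c).source)
    {α β : X → Form n n} (h : coeff c α x = coeff c β x) : α x = β x := by
  ext v
  obtain ⟨D, hD⟩ := exists_det_coeff hx v
  rw [hD, hD]
  exact congrArg _ h

theorem coeff_ne_zero {c x : X} (hx : x ∈ (extChartAt 𝓘(ℝ, E n) c).source)
    {ν : X → Form n n} (h : ν x ≠ 0) : coeff c ν x ≠ 0 := fun h0 =>
  h (eq_of_coeff_eq hx (β := fun _ => 0) h0)

/-- The form `α` is continuous at the points of `K`. -/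
def CoeffContinuousOn (α : X → Form n n) (K : Set X) : Prop :=
  ∀ c, ∀ x ∈ K, x ∈ (extChartAt 𝓘(ℝ, E n) c).source →
    ContinuousAt (fun y => coeff c α ((extChartAt 𝓘(ℝ, E n) c).symm y))
      (extChartAt 𝓘(ℝ, E n) c x)

theorem CoeffContinuousOn.mono {α : X → Form n n} {K K' : Set X} (h : CoeffContinuousOn α K)
    (hK : K' ⊆ K) : CoeffContinuousOn α K' := fun c x hx => h c x (hK hx)

/-- The one-sided derivative at `s = 0` of a family of forms. -/
def initialDeriv (α : ℝ → X → Form n n) (x : X) : Form n n :=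
  derivWithin (fun s => α s x) (Ici 0) 0

/-- Top-degree forms at x are a line spanned by ν x, so a family of forms is differentiated through
its scalar ratio to ν. -/
theorem hasDerivWithinAt_form {ν : X → Form n n} (hν0 : ∀ x, ν x ≠ 0) {α : ℝ → X → Form n n} {c x : X}
    (hx : x ∈ (extChartAt 𝓘(ℝ, E n) c).source) {a : ℝ}
    (h : HasDerivWithinAt (fun s => coeff c (α s) x) a (Ici 0) 0) :
    initialDeriv α x = (a / coeff c ν x) • ν x ∧ coeff c (initialDeriv α) x = a := by
  have h0 := coeff_ne_zero hx (hν0 x)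
  have h1 : (fun s => α s x) = fun s => (coeff c (α s) x / coeff c ν x) • ν x := by
    funext s
    refine eq_of_coeff_eq hx (β := fun x => (coeff c (α s) x / coeff c ν x) • ν x) ?_
    change _ = coeff c (α s) x / coeff c ν x * coeff c ν x
    field_simp
  have h2 := (h.div_const (coeff c ν x)).smul_const (ν x)
  rw [← h1] at h2
  have h3 : initialDeriv α x = (a / coeff c ν x) • ν x :=
    h2.derivWithin (uniqueDiffWithinAt_Ici 0)
  refine ⟨h3, ?_⟩
  rw [coeff, h3]
  change a / coeff c ν x * coeff c ν x = a
  field_simp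

end Coefficients

/-! ### Integration of forms with a partition of unity -/

section IntegralForm

open MeasureTheory

variable {n : ℕ} {X : Type*} [TopologicalSpace X] [ChartedSpace (E n) X]
  [T2Space X] [SigmaCompactSpace X] [IsManifold 𝓘(ℝ, E n) ∞ X]

theorem tsupport_chartPartition_subset (c : X) :
    tsupport (chartPartition (n := n) X c) ⊆ (extChartAt 𝓘(ℝ, E n) c).source := by
  rw [extChartAt_source]
  exact (SmoothPartitionOfUnity.exists_isSubordinate_chartAt_source 𝓘(ℝ, E n) X).choose_spec c

/-- The part of `K` on which the partition function of index `c` may be nonzero, in the chart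
centred at `c`. -/
def chartCompact (c : X) (K : Set X) : Set (E n) :=
  extChartAt 𝓘(ℝ, E n) c '' (K ∩ tsupport (chartPartition (n := n) X c))

/-- The weight with which coefficients are integrated in the chart centred at `c`. -/
def chartWeight (ν : X → Form n n) (c : X) (y : E n) : ℝ :=
  chartPartition (n := n) X c ((extChartAt 𝓘(ℝ, E n) c).symm y) *
    SignType.sign (coeff c ν ((extChartAt 𝓘(ℝ, E n) c).symm y))

variable {K : Set X} {ν : X → Form n n}

theorem isCompact_chartCompact (hK : IsCompact K) (c : X) : IsCompact (chartCompact (n := n) c K) :=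
  (hK.inter_right (isClosed_tsupport _)).image_of_continuousOn
    ((continuousOn_extChartAt c).mono fun _ hx => tsupport_chartPartition_subset c hx.2)

theorem mem_chartCompact {c : X} {y : E n} (hy : y ∈ chartCompact (n := n) c K) :
    ∃ x ∈ K, x ∈ tsupport (chartPartition (n := n) X c) ∧
      x ∈ (extChartAt 𝓘(ℝ, E n) c).source ∧
      extChartAt 𝓘(ℝ, E n) c x = y ∧ (extChartAt 𝓘(ℝ, E n) c).symm y = x ∧
      y ∈ (extChartAt 𝓘(ℝ, E n) c).target := by
  obtain ⟨x, ⟨hxK, hx⟩, rfl⟩ := hy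
  have hs := tsupport_chartPartition_subset c hx
  exact ⟨x, hxK, hx, hs, rfl, (extChartAt 𝓘(ℝ, E n) c).left_inv hs,
    (extChartAt 𝓘(ℝ, E n) c).map_source hs⟩

theorem setIntegral_chart_eq (hK : IsCompact K) (ν α : X → Form n n) (c : X) :
    (∫ y in (extChartAt 𝓘(ℝ, E n) c).target,
      let x := (extChartAt 𝓘(ℝ, E n) c).symm y
      chartPartition (n := n) X c x *
        K.indicator (fun x => SignType.sign (coeff c ν x) * coeff c α x) x) =
    ∫ y in chartCompact c K, chartWeight ν c y *
      coeff c α ((extChartAt 𝓘(ℝ, E n) c).symm y) := by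
  have hsub : chartCompact c K ⊆ (extChartAt 𝓘(ℝ, E n) c).target := fun y hy => by
    obtain ⟨x, -, -, -, -, -, h⟩ := mem_chartCompact hy
    exact h
  have h1 : ∀ y ∈ (extChartAt 𝓘(ℝ, E n) c).target \ chartCompact c K,
      chartPartition (n := n) X c ((extChartAt 𝓘(ℝ, E n) c).symm y) *
        K.indicator (fun x => SignType.sign (coeff c ν x) * coeff c α x)
          ((extChartAt 𝓘(ℝ, E n) c).symm y) = 0 := by
    rintro y ⟨hyt, hy⟩
    by_contra hne
    refine hy ⟨(extChartAt 𝓘(ℝ, E n) c).symm y, ⟨?_, ?_⟩, (extChartAt 𝓘(ℝ, E n) c).right_inv hyt⟩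
    · by_contra hxK
      exact hne (by rw [indicator_of_notMem hxK, mul_zero])
    · exact subset_tsupport _ (left_ne_zero_of_mul hne)
  refine (setIntegral_eq_of_subset_of_forall_sdiff_eq_zero
    (isOpen_extChartAt_target (I := 𝓘(ℝ, E n)) c).measurableSet hsub h1).trans ?_
  refine setIntegral_congr_fun (isCompact_chartCompact hK c).measurableSet fun y hy => ?_
  obtain ⟨x, hxK, -, -, -, hyx, -⟩ := mem_chartCompact hy
  simp only [hyx, indicator_of_mem hxK, chartWeight]
  ring

/-- By local finiteness only finitely many partition functions meet the compact K. The finite set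
depends on K alone, so one sum serves for all forms and for families of forms. -/
theorem exists_integralForm_eq_sum (hK : IsCompact K) :
    ∃ S : Finset X, (∀ c, (tsupport (chartPartition (n := n) X c) ∩ K).Nonempty → c ∈ S) ∧
      ∀ ν α : X → Form n n, integralForm ν K α = ∑ c ∈ S, ∫ y in chartCompact c K,
        chartWeight ν c y * coeff c α ((extChartAt 𝓘(ℝ, E n) c).symm y) := by
  have hfin := (chartPartition (n := n) X).locallyFinite.closure.finite_nonempty_inter_compact hK
  have hS : ∀ c, (tsupport (chartPartition (n := n) X c) ∩ K).Nonempty → c ∈ hfin.toFinset :=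
    fun c hc => by simpa [tsupport] using hc
  refine ⟨hfin.toFinset, hS, fun ν α => ?_⟩
  simp only [integralForm, setIntegral_chart_eq hK]
  refine finsum_eq_sum_of_support_subset _ fun c hc => hS c ?_
  by_contra hne
  have h1 : chartCompact (n := n) c K = ∅ := by
    rw [chartCompact, inter_comm, not_nonempty_iff_eq_empty.1 hne, image_empty]
  simp [h1] at hc

/-- The sign function is continuous away from 0, and the coefficient of a nonvanishing ν is never 0.
-/
theorem continuousAt_chartWeight (hν : CoeffContinuousOn ν K) (hν0 : ∀ x, ν x ≠ 0) {c x : X}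
    (hxK : x ∈ K) (hx : x ∈ (extChartAt 𝓘(ℝ, E n) c).source) :
    ContinuousAt (chartWeight ν c) (extChartAt 𝓘(ℝ, E n) c x) := by
  have hyx := (extChartAt 𝓘(ℝ, E n) c).left_inv hx
  refine ContinuousAt.mul ?_ ?_
  · have h1 : ContinuousAt (extChartAt 𝓘(ℝ, E n) c).symm (extChartAt 𝓘(ℝ, E n) c x) :=
      continuousAt_extChartAt_symm' hx
    exact ContinuousAt.comp (g := chartPartition (n := n) X c)
      ((chartPartition (n := n) X c).contMDiff.continuous.continuousAt) h1
  · have h1 : ContinuousAt SignType.sign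
        (coeff c ν ((extChartAt 𝓘(ℝ, E n) c).symm (extChartAt 𝓘(ℝ, E n) c x))) :=
      continuousAt_sign_of_ne_zero (by rw [hyx]; exact coeff_ne_zero hx (hν0 x))
    have h2 := ContinuousAt.comp (f := fun y => coeff c ν ((extChartAt 𝓘(ℝ, E n) c).symm y)) h1
      (hν c x hxK hx)
    exact ContinuousAt.comp (g := fun s : SignType => (s : ℝ))
      (continuous_of_discreteTopology.continuousAt) h2

theorem abs_chartWeight_le (ν : X → Form n n) (c : X) (y : E n) : ‖chartWeight ν c y‖ ≤ 1 := by
  rw [chartWeight, norm_mul]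
  refine mul_le_one₀ ?_ (norm_nonneg _) ?_
  · rw [Real.norm_of_nonneg ((chartPartition (n := n) X).nonneg c _)]
    exact (chartPartition (n := n) X).le_one c _
  · generalize SignType.sign (coeff c ν ((extChartAt 𝓘(ℝ, E n) c).symm y)) = s
    cases s <;> simp

theorem aestronglyMeasurable_chartWeight (hK : IsCompact K) (hν : CoeffContinuousOn ν K)
    (hν0 : ∀ x, ν x ≠ 0) (c : X) :
    AEStronglyMeasurable (chartWeight ν c) (volume.restrict (chartCompact c K)) := by
  refine ContinuousOn.aestronglyMeasurable (fun y hy => ?_)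
    (isCompact_chartCompact hK c).measurableSet
  obtain ⟨x, hxK, -, hxs, rfl, -, -⟩ := mem_chartCompact hy
  exact (continuousAt_chartWeight hν hν0 hxK hxs).continuousWithinAt

theorem integrableOn_chartWeight_mul (hK : IsCompact K) (hν : CoeffContinuousOn ν K)
    (hν0 : ∀ x, ν x ≠ 0) {α : X → Form n n} (hα : CoeffContinuousOn α K) (c : X) :
    IntegrableOn (fun y => chartWeight ν c y * coeff c α ((extChartAt 𝓘(ℝ, E n) c).symm y))
      (chartCompact c K) := by
  refine integrableOn_mul_of_continuousAt (isCompact_chartCompact hK c)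
    (aestronglyMeasurable_chartWeight hK hν hν0 c) (fun y _ => abs_chartWeight_le ν c y)
    fun y hy => ?_
  obtain ⟨x, hxK, -, hxs, rfl, -, -⟩ := mem_chartCompact hy
  exact hα c x hxK hxs

theorem integralForm_smul (hK : IsCompact K) (a : ℝ) (α : X → Form n n) :
    integralForm ν K (fun x => a • α x) = a * integralForm ν K α := by
  obtain ⟨S, -, hS⟩ := exists_integralForm_eq_sum (n := n) hK
  rw [hS, hS, Finset.mul_sum]
  refine Finset.sum_congr rfl fun c _ => ?_
  rw [← integral_const_mul]
  congr 1
  funext y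
  change chartWeight ν c y * (a * coeff c α _) = _
  ring

theorem integralForm_eq_sum (hK : IsCompact K) (hν : CoeffContinuousOn ν K)
    (hν0 : ∀ x, ν x ≠ 0) {ι : Type*} (I : Finset ι) {α : ι → X → Form n n} {β : X → Form n n}
    (hα : ∀ i ∈ I, CoeffContinuousOn (α i) K) (hβ : ∀ x ∈ K, β x = ∑ i ∈ I, α i x) :
    integralForm ν K β = ∑ i ∈ I, integralForm ν K (α i) := by
  obtain ⟨S, -, hS⟩ := exists_integralForm_eq_sum (n := n) hK
  simp only [hS]
  rw [Finset.sum_comm]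
  refine Finset.sum_congr rfl fun c _ => ?_
  rw [← integral_finsetSum _ fun i hi => integrableOn_chartWeight_mul hK hν hν0 (hα i hi) c]
  refine setIntegral_congr_fun (isCompact_chartCompact hK c).measurableSet fun y hy => ?_
  obtain ⟨x, hxK, -, -, -, hyx, -⟩ := mem_chartCompact hy
  simp only [hyx]
  rw [← Finset.mul_sum, coeff, hβ x hxK, ContinuousAlternatingMap.sum_apply]
  rfl

/-- Orienting by ν turns the coefficient κ · coeff ν into κ |coeff ν| ≥ 0, so no chart contributes
negatively. A chart whose partition function is positive at x₀ contributes strictly, by continuity.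
-/
theorem integralForm_pos (hK : IsCompact K) (hν : CoeffContinuousOn ν K) (hν0 : ∀ x, ν x ≠ 0)
    {α : X → Form n n} (hα : CoeffContinuousOn α K) {κ : X → ℝ} (hκ : ∀ x ∈ K, 0 ≤ κ x)
    (hακ : ∀ x ∈ K, α x = κ x • ν x) {x₀ : X} (hx₀ : K ∈ 𝓝 x₀) (hκ₀ : 0 < κ x₀) :
    0 < integralForm ν K α := by
  obtain ⟨S, hSmem, hS⟩ := exists_integralForm_eq_sum (n := n) hK
  have hval : ∀ c, ∀ x ∈ K, x ∈ (extChartAt 𝓘(ℝ, E n) c).source →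
      chartWeight ν c (extChartAt 𝓘(ℝ, E n) c x) *
        coeff c α ((extChartAt 𝓘(ℝ, E n) c).symm (extChartAt 𝓘(ℝ, E n) c x)) =
      chartPartition (n := n) X c x * (κ x * |coeff c ν x|) := by
    intro c x hxK hx
    rw [chartWeight, (extChartAt 𝓘(ℝ, E n) c).left_inv hx]
    have h1 : coeff c α x = κ x * coeff c ν x := by
      rw [coeff, hακ x hxK]; rfl
    rw [h1, ← sign_mul_self (coeff c ν x)]
    ring
  have hnn : ∀ c, ∀ y ∈ chartCompact (n := n) c K,
      0 ≤ chartWeight ν c y * coeff c α ((extChartAt 𝓘(ℝ, E n) c).symm y) := by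
    intro c y hy
    obtain ⟨x, hxK, -, hxs, rfl, -, -⟩ := mem_chartCompact hy
    rw [hval c x hxK hxs]
    exact mul_nonneg ((chartPartition (n := n) X).nonneg c x)
      (mul_nonneg (hκ x hxK) (abs_nonneg _))
  obtain ⟨c, hc⟩ := (chartPartition (n := n) X).exists_pos_of_mem (mem_univ x₀)
  have hcx : x₀ ∈ tsupport (chartPartition (n := n) X c) := subset_tsupport _ hc.ne'
  have hxK := mem_of_mem_nhds hx₀
  have hxs := tsupport_chartPartition_subset c hcx
  rw [hS]
  refine Finset.sum_pos' (fun c _ =>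
    setIntegral_nonneg (isCompact_chartCompact hK c).measurableSet (hnn c))
    ⟨c, hSmem c ⟨x₀, hcx, hxK⟩, ?_⟩
  rw [setIntegral_pos_iff_support_of_nonneg_ae
    ((ae_restrict_iff' (isCompact_chartCompact hK c).measurableSet).2 (ae_of_all _ (hnn c)))
    (integrableOn_chartWeight_mul hK hν hν0 hα c)]
  have hcont : ContinuousAt (fun y => chartWeight ν c y *
      coeff c α ((extChartAt 𝓘(ℝ, E n) c).symm y)) (extChartAt 𝓘(ℝ, E n) c x₀) :=
    (continuousAt_chartWeight hν hν0 hxK hxs).mul (hα c x₀ hxK hxs)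
  have hne : chartWeight ν c (extChartAt 𝓘(ℝ, E n) c x₀) *
        coeff c α ((extChartAt 𝓘(ℝ, E n) c).symm (extChartAt 𝓘(ℝ, E n) c x₀)) ≠ 0 := by
    rw [hval c x₀ hxK hxs]
    exact mul_ne_zero hc.ne' (mul_ne_zero hκ₀.ne' (abs_ne_zero.2 (coeff_ne_zero hxs (hν0 x₀))))
  have hnhds : chartCompact c K ∈ 𝓝 (extChartAt 𝓘(ℝ, E n) c x₀) := by
    have h1 : ContinuousAt (extChartAt 𝓘(ℝ, E n) c).symm (extChartAt 𝓘(ℝ, E n) c x₀) :=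
      continuousAt_extChartAt_symm' hxs
    have h2 : K ∩ Function.support (chartPartition (n := n) X c) ∈
        𝓝 ((extChartAt 𝓘(ℝ, E n) c).symm (extChartAt 𝓘(ℝ, E n) c x₀)) := by
      rw [(extChartAt 𝓘(ℝ, E n) c).left_inv hxs]
      exact Filter.inter_mem hx₀
        ((chartPartition (n := n) X c).contMDiff.continuous.isOpen_support.mem_nhds hc.ne')
    filter_upwards [h1.preimage_mem_nhds h2, (isOpen_extChartAt_target (I := 𝓘(ℝ, E n)) c).mem_nhds
      ((extChartAt 𝓘(ℝ, E n) c).map_source hxs)] with y hy hyt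
    exact ⟨_, ⟨hy.1, subset_tsupport _ hy.2⟩, (extChartAt 𝓘(ℝ, E n) c).right_inv hyt⟩
  refine Measure.measure_pos_of_mem_nhds volume (x := extChartAt 𝓘(ℝ, E n) c x₀) ?_
  exact Filter.inter_mem (hcont.eventually_ne hne) hnhds

/-- For `s ≥ 0`, the family of forms `α s` is smooth near `(0, x)`. -/
def OneSidedSmoothFormAt (α : ℝ → X → Form n n) (x : X) : Prop :=
  ∀ c, x ∈ (extChartAt 𝓘(ℝ, E n) c).source →
    IsOneSidedSmoothAt (fun s y => coeff c (α s) ((extChartAt 𝓘(ℝ, E n) c).symm y))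
      (extChartAt 𝓘(ℝ, E n) c x)

omit [T2Space X] [SigmaCompactSpace X] in
theorem OneSidedSmoothFormAt.coeff_initialDeriv (hν0 : ∀ x, ν x ≠ 0) {α : ℝ → X → Form n n} {x : X}
    (h : OneSidedSmoothFormAt α x) {c : X} (hx : x ∈ (extChartAt 𝓘(ℝ, E n) c).source) :
    coeff c (initialDeriv α) x = derivWithin (fun s => coeff c (α s) x) (Ici 0) 0 := by
  have h1 := (h c hx).hasDerivWithinAt
  simp only [(extChartAt 𝓘(ℝ, E n) c).left_inv hx] at h1
  exact (hasDerivWithinAt_form hν0 hx h1).2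

theorem hasDerivWithinAt_integralForm (hK : IsCompact K) (hν : CoeffContinuousOn ν K)
    (hν0 : ∀ x, ν x ≠ 0) {α : ℝ → X → Form n n} (hα : ∀ x ∈ K, OneSidedSmoothFormAt α x) :
    HasDerivWithinAt (fun s => integralForm ν K (α s)) (integralForm ν K (initialDeriv α))
      (Ici 0) 0 := by
  obtain ⟨S, -, hS⟩ := exists_integralForm_eq_sum (n := n) hK
  simp only [hS]
  refine HasDerivWithinAt.fun_sum fun c _ => ?_
  have h1 := hasDerivWithinAt_integral_of_oneSidedSmooth (μ := volume)
    (g := fun s y => coeff c (α s) ((extChartAt 𝓘(ℝ, E n) c).symm y))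
    (isCompact_chartCompact hK c) (fun y hy => by
      obtain ⟨x, hxK, -, hxs, rfl, -, -⟩ := mem_chartCompact hy
      exact hα x hxK c hxs)
    (aestronglyMeasurable_chartWeight hK hν hν0 c) (fun y _ => abs_chartWeight_le ν c y)
  refine h1.congr_deriv ?_
  refine setIntegral_congr_fun (isCompact_chartCompact hK c).measurableSet fun y hy => ?_
  obtain ⟨x, hxK, -, hxs, rfl, hyx, -⟩ := mem_chartCompact hy
  simp only [hyx, (hα x hxK).coeff_initialDeriv hν0 hxs]

omit [T2Space X] [SigmaCompactSpace X] in
theorem coeffContinuousOn_initialDeriv (hν0 : ∀ x, ν x ≠ 0) {α : ℝ → X → Form n n}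
    (hα : ∀ x ∈ K, ∀ᶠ x' in 𝓝 x, OneSidedSmoothFormAt α x') :
    CoeffContinuousOn (initialDeriv α) K := by
  intro c x hxK hx
  refine ((hα x hxK).self_of_nhds c hx).continuousAt_derivWithin.congr ?_
  have h1 : ContinuousAt (extChartAt 𝓘(ℝ, E n) c).symm (extChartAt 𝓘(ℝ, E n) c x) :=
    continuousAt_extChartAt_symm' hx
  have h2 := hα x hxK
  rw [← (extChartAt 𝓘(ℝ, E n) c).left_inv hx] at h2
  filter_upwards [h1.eventually h2, (isOpen_extChartAt_target (I := 𝓘(ℝ, E n)) c).mem_nhds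
    ((extChartAt 𝓘(ℝ, E n) c).map_source hx)] with y hy hyt
  exact (hy.coeff_initialDeriv hν0 ((extChartAt 𝓘(ℝ, E n) c).map_target hyt)).symm

end IntegralForm

/-- Symmetry of second derivatives: the time derivative of the moving frame is the space derivative
of the velocity. -/
theorem fderiv_fderiv_comm {Y V : Type*} [NormedAddCommGroup Y] [NormedSpace ℝ Y]
    [NormedAddCommGroup V] [NormedSpace ℝ V] {B : ℝ × Y → V} {y₀ : Y}
    (hB : ContDiffAt ℝ ∞ B (0, y₀)) (w : Y) :
    fderiv ℝ (fun a : ℝ × Y => fderiv ℝ (fun y => B (a.1, y)) a.2 w) (0, y₀) (1, 0) =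
      fderiv ℝ (fun y => fderiv ℝ B (0, y) (1, 0)) y₀ w := by
  have hD : DifferentiableAt ℝ (fderiv ℝ B) (0, y₀) :=
    (hB.fderiv_right (m := ∞) (by simp)).differentiableAt (by simp)
  have hev : ∀ᶠ a in 𝓝 ((0 : ℝ), y₀), DifferentiableAt ℝ B a :=
    ((hB.of_le (m := 1) (by simp)).eventually (by simp)).mono fun a ha =>
      ha.differentiableAt (by simp)
  have h1 : (fun a : ℝ × Y => fderiv ℝ (fun y => B (a.1, y)) a.2 w) =ᶠ[𝓝 (0, y₀)]
      fun a => fderiv ℝ B a (0, w) := by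
    filter_upwards [hev] with a ha
    have h2 : HasFDerivAt (fun y : Y => (a.1, y)) (ContinuousLinearMap.inr ℝ ℝ Y) a.2 :=
      hasFDerivAt_prodMk_right a.1 a.2
    have h3 := HasFDerivAt.comp (g := B) (f := fun y : Y => (a.1, y)) a.2 ha.hasFDerivAt h2
    rw [show (fun y => B (a.1, y)) = B ∘ fun y => (a.1, y) from rfl, h3.fderiv]
    rfl
  have h4 : HasFDerivAt (fun a => fderiv ℝ B a (0, w))
      ((ContinuousLinearMap.apply ℝ V ((0 : ℝ), w)).comp (fderiv ℝ (fderiv ℝ B) (0, y₀)))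
      (0, y₀) :=
    (ContinuousLinearMap.apply ℝ V ((0 : ℝ), w)).hasFDerivAt.comp (0, y₀) hD.hasFDerivAt
  have h5 : HasFDerivAt (fun y => fderiv ℝ B (0, y) (1, 0))
      (((ContinuousLinearMap.apply ℝ V ((1 : ℝ), (0 : Y))).comp
        (fderiv ℝ (fderiv ℝ B) (0, y₀))).comp (ContinuousLinearMap.inr ℝ ℝ Y)) y₀ :=
    HasFDerivAt.comp (g := fun a => fderiv ℝ B a ((1 : ℝ), (0 : Y))) (f := fun y : Y => ((0 : ℝ), y))
      y₀ ((ContinuousLinearMap.apply ℝ V ((1 : ℝ), (0 : Y))).hasFDerivAt.comp (0, y₀)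
        hD.hasFDerivAt) (hasFDerivAt_prodMk_right 0 y₀)
  rw [h1.fderiv_eq, h4.fderiv, h5.fderiv]
  have hsymm := hB.isSymmSndFDerivAt (by
    rw [minSmoothness_of_isRCLikeNormedField]
    exact WithTop.coe_le_coe.2 (le_top : (2 : ℕ∞) ≤ ⊤))
  exact hsymm (1, 0) (0, w)

/-! ### Deformations and the first variation as an integral -/

section Deformations

variable {n d : ℕ} {N : Type*} [TopologicalSpace N] [ChartedSpace (E d) N]
  [IsManifold 𝓘(ℝ, E d) ∞ N] {X : Type*} [TopologicalSpace X] [ChartedSpace (E n) X]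
  [IsManifold 𝓘(ℝ, E n) ∞ X]

/-- `σ` is a smooth deformation of `γ` with support in `K` that stays in `M` for small `s ≥ 0`. -/
structure IsDeformation (M : Set (FormBundle n d N)) (γ : X → FormBundle n d N) (K : Set X)
    (σ : ℝ → X → FormBundle n d N) : Prop where
  smooth : SmoothForm (𝓘(ℝ, ℝ).prod 𝓘(ℝ, E n)) (fun a : ℝ × X => σ a.1 a.2)
  zero : σ 0 = γ
  eq_off : ∀ s, ∀ x, x ∉ K → σ s x = γ x
  mem : ∃ ε > 0, ∀ s, 0 ≤ s → s < ε → ∀ x, σ s x ∈ M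

variable {om : N → Form n d} {L : N → NVec n d → ℝ} {M : Set (FormBundle n d N)} {r : ℕ}
  {γ : X → FormBundle n d N} {K : Set X} {σ : ℝ → X → FormBundle n d N}

theorem planeAt_eq_localFrame
    (hγ : MDifferentiable 𝓘(ℝ, E n) 𝓘(ℝ, E d) (fun x => (γ x).pt)) (x : X) :
    (fun i => dbase γ x (EuclideanSpace.single i 1)) =
      localFrame x (γ x).pt (fun x => (γ x).pt) (extChartAt 𝓘(ℝ, E n) x x) := by
  funext i
  have h := mfderiv_fromChart (mem_extChartAt_source x) (hγ x) (mem_extChartAt_source (γ x).pt) i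
  rw [fromChart_self, fromChart_self] at h
  exact h

theorem om_localFrame_ne_zero (hγ : IsCurve om M γ) (x : X) :
    om (γ x).pt (localFrame x (γ x).pt (fun x => (γ x).pt) (extChartAt 𝓘(ℝ, E n) x x)) ≠ 0 := by
  rw [← planeAt_eq_localFrame (hγ.smooth.1.mdifferentiable (by simp)) x]
  have h := coeff_ne_zero (mem_extChartAt_source (I := 𝓘(ℝ, E n)) x) (hγ.volume_ne_zero x)
  rw [coeff, fromChart_self] at h
  exact h

theorem planeAt_eq (hγ : IsCurve om M γ) (x : X) :
    planeAt om γ x =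
      (om (γ x).pt (localFrame x (γ x).pt (fun x => (γ x).pt) (extChartAt 𝓘(ℝ, E n) x x)))⁻¹ •
        wedge (localFrame x (γ x).pt (fun x => (γ x).pt) (extChartAt 𝓘(ℝ, E n) x x)) := by
  rw [← planeAt_eq_localFrame (hγ.smooth.1.mdifferentiable (by simp)) x]
  rfl

theorem IsCurve.coeffContinuousOn_pullVolume (hom : IsSpaceTimeVolume om) (hγ : IsCurve om M γ) :
    CoeffContinuousOn (pullVolume om γ) K := by
  intro c x _ hx
  obtain ⟨b, hb⟩ : ∃ b, b = (γ x).pt := ⟨_, rfl⟩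
  have hbs : (γ x).pt ∈ (extChartAt 𝓘(ℝ, E d) b).source := by
    rw [hb]; exact mem_extChartAt_source _
  have hyt := (extChartAt 𝓘(ℝ, E n) c).map_source hx
  have hyx := (extChartAt 𝓘(ℝ, E n) c).left_inv hx
  have hQ : ContDiffAt ℝ ∞ (baseRep c b fun _ => γ) (0, extChartAt 𝓘(ℝ, E n) c x) := by
    refine contDiffAt_baseRep hyt ?_ (by simpa only [hyx] using hbs)
    exact ContMDiffAt.comp (g := fun x => (γ x).pt) (f := fun a : ℝ × X => a.2) _
      (hγ.smooth.1.contMDiffAt) contMDiffAt_snd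
  have hF := contDiffAt_frameRep hQ
  have h0 : ContinuousAt (fun y : E n => ((0 : ℝ), y)) (extChartAt 𝓘(ℝ, E n) c x) := by fun_prop
  have h1 : ContinuousAt (fun a => localForm om b (baseRep c b (fun _ => γ) a)
      (frameRep c b (fun _ => γ) a)) ((0 : ℝ), extChartAt 𝓘(ℝ, E n) c x) := by
    have h2 : ContDiffAt ℝ ∞ (fun a : E d × (Fin n → E d) => localForm om b a.1 a.2)
        (baseRep c b (fun _ => γ) ((0 : ℝ), extChartAt 𝓘(ℝ, E n) c x),
          frameRep c b (fun _ => γ) ((0 : ℝ), extChartAt 𝓘(ℝ, E n) c x)) := by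
      refine contDiffAt_localForm_apply hom ?_
      simp only [baseRep, hyx]
      exact (extChartAt 𝓘(ℝ, E d) b).map_source hbs
    exact ContinuousAt.comp (f := fun a : ℝ × E n => (baseRep c b (fun _ => γ) a,
      frameRep c b (fun _ => γ) a)) (g := fun a : E d × (Fin n → E d) => localForm om b a.1 a.2)
      h2.continuousAt (hQ.continuousAt.prodMk hF.continuousAt)
  refine (ContinuousAt.comp (f := fun y : E n => ((0 : ℝ), y)) h1 h0).congr ?_
  have hs : ContinuousAt (extChartAt 𝓘(ℝ, E n) c).symm (extChartAt 𝓘(ℝ, E n) c x) :=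
    continuousAt_extChartAt_symm' hx
  have hs1 : (fun x => (γ x).pt) ⁻¹' (extChartAt 𝓘(ℝ, E d) b).source ∈
      𝓝 ((extChartAt 𝓘(ℝ, E n) c).symm (extChartAt 𝓘(ℝ, E n) c x)) := by
    rw [hyx]
    exact hγ.smooth.1.continuous.continuousAt.preimage_mem_nhds
      ((isOpen_extChartAt_source (I := 𝓘(ℝ, E d)) b).mem_nhds hbs)
  filter_upwards [hs.preimage_mem_nhds hs1,
    (isOpen_extChartAt_target (I := 𝓘(ℝ, E n)) c).mem_nhds hyt] with y hy hyt
  rw [coeff_pullVolume ((extChartAt 𝓘(ℝ, E n) c).map_target hyt)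
    (hγ.smooth.1.mdifferentiable (by simp) _) hy, (extChartAt 𝓘(ℝ, E n) c).right_inv hyt]
  rfl

theorem IsDeformation.oneSidedSmoothFormAt (hn : 1 ≤ n) (hom : IsSpaceTimeVolume om)
    (hL : SmoothLagrangian om L) (hM : LegendreCorrespondenceHypothesis om L M r)
    (hσ : IsDeformation M γ K σ) (x : X) :
    OneSidedSmoothFormAt (fun s => actionForm om L (σ s)) x := by
  intro c hx
  obtain ⟨ε, hε, hmem⟩ := hσ.mem
  have hm := hmem 0 le_rfl hε x
  obtain ⟨z₀, hz₀⟩ := (hM.connected _ hm).nonempty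
  obtain ⟨G, hG, hGeq, -⟩ := hM.exists_localAction hn hom hL hx hσ.smooth.1.contMDiffAt
    (hσ.smooth.contMDiffAt_coord (a := ((0 : ℝ), x)) (mem_extChartAt_source _)) hm hz₀ rfl rfl
  refine ⟨G, hG.of_le (by simp), ?_⟩
  filter_upwards [hGeq, continuous_fst.continuousAt.preimage_mem_nhds (Iio_mem_nhds hε)]
    with a ha ha' ha0
  exact ha (hmem _ ha0 ha' _)

variable [T2Space X] [SigmaCompactSpace X]

/-- The right derivative of the action always exists and is the integral of the derivative of the
integrand. Criticality thus becomes an equation that is linear in the infinitesimal variation. -/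
theorem isCritical_iff (hn : 1 ≤ n) (hom : IsSpaceTimeVolume om)
    (hL : SmoothLagrangian om L) (hM : LegendreCorrespondenceHypothesis om L M r)
    (hγ : IsCurve om M γ) :
    IsCritical om L M γ ↔ ∀ (K : Set X) (σ : ℝ → X → FormBundle n d N), IsCompact K →
      IsDeformation M γ K σ →
      integralForm (pullVolume om γ) K (initialDeriv fun s => actionForm om L (σ s)) = 0 := by
  have key : ∀ (K : Set X) (σ : ℝ → X → FormBundle n d N), IsCompact K →
      IsDeformation M γ K σ → HasDerivWithinAt (fun s => action om L (pullVolume om γ) K (σ s))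
        (integralForm (pullVolume om γ) K (initialDeriv fun s => actionForm om L (σ s)))
        (Ici 0) 0 := fun K σ hK hσ =>
    hasDerivWithinAt_integralForm hK (hγ.coeffContinuousOn_pullVolume hom) hγ.volume_ne_zero
      fun x _ => hσ.oneSidedSmoothFormAt hn hom hL hM x
  constructor
  · intro h K σ hK hσ
    exact (uniqueDiffWithinAt_Ici (0 : ℝ)).eq_deriv _ (key K σ hK hσ)
      (h K σ hK hσ.smooth hσ.zero hσ.eq_off hσ.mem)
  · intro h K σ hK h1 h2 h3 h4
    have := key K σ hK ⟨h1, h2, h3, h4⟩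
    rwa [h K σ hK ⟨h1, h2, h3, h4⟩] at this

end Deformations

/-! ### Constructing deformations inside ℳ -/

section Motions

variable {n d : ℕ} {N : Type*} [TopologicalSpace N] [ChartedSpace (E d) N]
  [IsManifold 𝓘(ℝ, E d) ∞ N] {X : Type*} [TopologicalSpace X] [ChartedSpace (E n) X]
  [IsManifold 𝓘(ℝ, E n) ∞ X]

variable {M : Set (FormBundle n d N)} {r : ℕ} {γ : X → FormBundle n d N} {K : Set X}

/-- A family `P u` of maps to `Λⁿ T* N` that starts at `γ`, is smooth for `|u| < η` over `O`, and
takes values in `M` for `0 ≤ u < η` over `O`. -/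
structure IsLocalMotion (M : Set (FormBundle n d N)) (γ : X → FormBundle n d N) (O : Set X) (η : ℝ)
    (P : ℝ → X → FormBundle n d N) : Prop where
  zero : P 0 = γ
  smooth : ∀ u x, |u| < η → x ∈ O →
    ContMDiffAt (𝓘(ℝ, ℝ).prod 𝓘(ℝ, E n)) 𝓘(ℝ, E d) ∞ (fun a : ℝ × X => (P a.1 a.2).pt) (u, x) ∧
      ∃ c, (P u x).pt ∈ (extChartAt 𝓘(ℝ, E d) c).source ∧
        ContMDiffAt (𝓘(ℝ, ℝ).prod 𝓘(ℝ, E n)) 𝓘(ℝ, Form n d) ∞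
          (fun a : ℝ × X => (coord c (P a.1 a.2)).2) (u, x)
  mem : ∀ u x, 0 ≤ u → u < η → x ∈ O → P u x ∈ M

/-- The time change `(s, x) ↦ χ (x) δ sin s`. -/
def cutoffTime (χ : X → ℝ) (δ : ℝ) (a : ℝ × X) : ℝ := χ a.2 * (δ * Real.sin a.1)

omit [IsManifold 𝓘(ℝ, E n) ∞ X] in
theorem contMDiff_cutoffTime {χ : X → ℝ} (hχ : ContMDiff 𝓘(ℝ, E n) 𝓘(ℝ, ℝ) ∞ χ) (δ : ℝ) :
    ContMDiff (𝓘(ℝ, ℝ).prod 𝓘(ℝ, E n)) 𝓘(ℝ, ℝ) ∞ (cutoffTime χ δ) := by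
  have h1 : ContMDiff (𝓘(ℝ, ℝ).prod 𝓘(ℝ, E n)) 𝓘(ℝ, ℝ) ∞
      (fun a : ℝ × X => δ * Real.sin a.1) :=
    ((contDiff_const.mul Real.contDiff_sin).contMDiff (f := fun s : ℝ => δ * Real.sin s)).comp
      contMDiff_fst
  exact (hχ.comp contMDiff_snd).mul h1

omit [TopologicalSpace X] in
theorem abs_cutoffTime_lt {χ : X → ℝ} (hχ0 : ∀ x, 0 ≤ χ x) (hχ1 : ∀ x, χ x ≤ 1) {δ η : ℝ}
    (hδ : 0 < δ) (hδη : δ < η) (a : ℝ × X) : |cutoffTime χ δ a| < η := by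
  rw [cutoffTime, abs_mul, abs_mul, abs_of_nonneg (hχ0 _), abs_of_pos hδ]
  calc χ a.2 * (δ * |Real.sin a.1|) ≤ 1 * (δ * 1) :=
        mul_le_mul (hχ1 _) (mul_le_mul_of_nonneg_left (Real.abs_sin_le_one _) hδ.le)
          (by positivity) zero_le_one
    _ < η := by simpa using hδη

omit [IsManifold 𝓘(ℝ, E n) ∞ X] in
-- A map into a manifold cannot be multiplied by a cutoff, so the cutoff slows down time instead.
-- The sine makes the family smooth for all real s while keeping the time below η in absolute value.
-- It is nonnegative on [0, π], which keeps the family in ℳ there, and it has derivative 1 at 0.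
theorem IsLocalMotion.isDeformation {O : Set X} {η δ : ℝ} {P : ℝ → X → FormBundle n d N}
    (hP : IsLocalMotion M γ O η P) (hγ : SmoothForm 𝓘(ℝ, E n) γ) (hmem : ∀ x, γ x ∈ M)
    {χ : X → ℝ} (hχ : ContMDiff 𝓘(ℝ, E n) 𝓘(ℝ, ℝ) ∞ χ) (hχ0 : ∀ x, 0 ≤ χ x) (hχ1 : ∀ x, χ x ≤ 1)
    (hχO : tsupport χ ⊆ O) (hδ : 0 < δ) (hδη : δ < η)
    (hK : ∀ u x, |u| < η → x ∈ O → x ∉ K → χ x ≠ 0 → P u x = γ x) :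
    IsDeformation M γ K (fun s x => P (cutoffTime χ δ (s, x)) x) := by
  have habs := abs_cutoffTime_lt hχ0 hχ1 hδ hδη
  have hzero : ∀ s x, χ x = 0 → P (cutoffTime χ δ (s, x)) x = γ x := fun s x h => by
    rw [cutoffTime, h, zero_mul, hP.zero]
  refine ⟨smoothForm_of_coord fun a => ?_, ?_, fun s x hx => ?_, Real.pi, Real.pi_pos, ?_⟩
  · obtain ⟨s, x⟩ := a
    by_cases hx : x ∈ tsupport χ
    · obtain ⟨h1, c, hc, h2⟩ := hP.smooth _ x (habs (s, x)) (hχO hx)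
      have h3 : ContMDiffAt (𝓘(ℝ, ℝ).prod 𝓘(ℝ, E n)) (𝓘(ℝ, ℝ).prod 𝓘(ℝ, E n)) ∞
          (fun a : ℝ × X => (cutoffTime χ δ a, a.2)) (s, x) :=
        (contMDiff_cutoffTime hχ δ).contMDiffAt.prodMk contMDiffAt_snd
      exact ⟨ContMDiffAt.comp (g := fun a : ℝ × X => (P a.1 a.2).pt)
        (f := fun a : ℝ × X => (cutoffTime χ δ a, a.2)) (s, x) h1 h3, c, hc,
        ContMDiffAt.comp (g := fun a : ℝ × X => (coord c (P a.1 a.2)).2)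
        (f := fun a : ℝ × X => (cutoffTime χ δ a, a.2)) (s, x) h2 h3⟩
    -- Off the support of χ the time is 0, so the family is locally γ and no smoothness of P is
    -- needed there.
    · have h1 : ∀ᶠ a : ℝ × X in 𝓝 (s, x), P (cutoffTime χ δ a) a.2 = γ a.2 := by
        have h2 : (tsupport χ)ᶜ ∈ 𝓝 x := (isClosed_tsupport χ).isOpen_compl.mem_nhds hx
        filter_upwards [continuous_snd.continuousAt.preimage_mem_nhds h2] with a ha
        exact hzero a.1 a.2 (image_eq_zero_of_notMem_tsupport ha)
      refine ⟨?_, (γ x).pt, ?_, ?_⟩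
      · refine ContMDiffAt.congr_of_eventuallyEq (f := fun a : ℝ × X => (γ a.2).pt) ?_
          (h1.mono fun a ha => congrArg _ ha)
        exact ContMDiffAt.comp (g := fun x => (γ x).pt) (f := fun a : ℝ × X => a.2) (s, x)
          hγ.1.contMDiffAt contMDiffAt_snd
      · have := h1.self_of_nhds
        simp only at this
        rw [this]
        exact mem_extChartAt_source _
      · refine ContMDiffAt.congr_of_eventuallyEq
          (f := fun a : ℝ × X => (coord (γ x).pt (γ a.2)).2) ?_
          (h1.mono fun a ha => congrArg (fun m => (coord (γ x).pt m).2) ha)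
        exact ContMDiffAt.comp (g := fun y => (coord (γ x).pt (γ y)).2)
          (f := fun a : ℝ × X => a.2) (s, x) (hγ.2 x) contMDiffAt_snd
  · funext x
    simp only [cutoffTime, Real.sin_zero, mul_zero, hP.zero]
  · by_cases h : χ x = 0
    · exact hzero s x h
    · exact hK _ x (habs (s, x)) (hχO (subset_tsupport _ h)) hx h
  · intro s hs hs' x
    by_cases h : χ x = 0
    · simp only [hzero s x h, hmem x]
    · refine hP.mem _ x ?_ ((le_abs_self _).trans_lt (habs (s, x))) (hχO (subset_tsupport _ h))
      exact mul_nonneg (hχ0 x) (mul_nonneg hδ.le (Real.sin_nonneg_of_nonneg_of_le_pi hs hs'.le))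

/-- The fibre-preserving diffeomorphism `Ψ` of an open set of coordinates centred at `b` straightens
`M`. -/
structure IsStraightening (M : Set (FormBundle n d N)) (b : N)
    (Ψ : OpenPartialHomeomorph (E d × Form n d) (E d × Form n d)) (S : Submodule ℝ (Form n d))
    (lam : Form n d →L[ℝ] ℝ) : Prop where
  fst : ∀ a ∈ Ψ.source, a.1 ∈ (extChartAt 𝓘(ℝ, E d) b).target ∧ (Ψ a).1 = a.1
  smooth : ContDiffOn ℝ ∞ Ψ Ψ.source
  smooth_symm : ContDiffOn ℝ ∞ Ψ.symm Ψ.target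
  mem_iff : ∀ a ∈ Ψ.source, ofCoord b a ∈ M ↔ (Ψ a).2 ∈ S ∧ 0 ≤ lam (Ψ a).2

open Classical in
/-- The motion of `γ` whose base point moves along `τ` and whose form moves, in straightened
coordinates, in the direction `e`. -/
def localMotion (b : N) (Ψ : OpenPartialHomeomorph (E d × Form n d) (E d × Form n d))
    (γ : X → FormBundle n d N) (τ : ℝ → X → N) (e : Form n d) (u : ℝ) (x : X) :
    FormBundle n d N :=
  -- The value at u = 0 is prescribed separately so that the motion starts at γ on all of X,
  -- including points outside the domain of Ψ. Near x₀ the other formula also gives γ at u = 0, so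
  -- smoothness is not lost.
  ⟨τ u x, if u = 0 then (γ x).form else
    (ofCoord b (Ψ.symm (extChartAt 𝓘(ℝ, E d) b (τ u x), (Ψ (coord b (γ x))).2 + u • e)) :
      FormBundle n d N).form⟩

variable {b : N} {Ψ : OpenPartialHomeomorph (E d × Form n d) (E d × Form n d)}
  {S : Submodule ℝ (Form n d)} {lam : Form n d →L[ℝ] ℝ} {τ : ℝ → X → N} {e : Form n d} {x₀ : X}

theorem IsStraightening.ofCoord_symm (h : IsStraightening M b Ψ S lam) {q : N} {p : Form n d}
    (hq : q ∈ (extChartAt 𝓘(ℝ, E d) b).source) (hp : (extChartAt 𝓘(ℝ, E d) b q, p) ∈ Ψ.target) :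
    (ofCoord b (Ψ.symm (extChartAt 𝓘(ℝ, E d) b q, p)) : FormBundle n d N).pt = q ∧
      coord b (ofCoord b (Ψ.symm (extChartAt 𝓘(ℝ, E d) b q, p)) : FormBundle n d N) =
        Ψ.symm (extChartAt 𝓘(ℝ, E d) b q, p) := by
  obtain ⟨h1, h2⟩ := h.fst _ (Ψ.map_target hp)
  rw [Ψ.right_inv hp] at h2
  refine ⟨?_, coord_ofCoord h1⟩
  rw [ofCoord, ← h2]
  exact (extChartAt 𝓘(ℝ, E d) b).left_inv hq

omit [IsManifold 𝓘(ℝ, E n) ∞ X] in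
-- In straightened coordinates ℳ is given by conditions on the fibre coordinate alone: it lies in S
-- and `lam` of it is nonnegative. The base may therefore move freely, and adding u e with u ≥ 0, e
-- ∈ S and lam e ≥ 0 preserves both conditions.
theorem localMotion_eventually (h : IsStraightening M b Ψ S lam) (hb : b = (γ x₀).pt)
    (hΨ : coord b (γ x₀) ∈ Ψ.source) (hγ : SmoothForm 𝓘(ℝ, E n) γ) (hmem : ∀ x, γ x ∈ M)
    (hτ : ContMDiff (𝓘(ℝ, ℝ).prod 𝓘(ℝ, E n)) 𝓘(ℝ, E d) ∞ (fun a : ℝ × X => τ a.1 a.2))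
    (hτ0 : ∀ x, τ 0 x = (γ x).pt) (heS : e ∈ S) (hel : 0 ≤ lam e) :
    ∀ᶠ a : ℝ × X in 𝓝 (0, x₀), τ a.1 a.2 ∈ (extChartAt 𝓘(ℝ, E d) b).source ∧
      ContMDiffAt (𝓘(ℝ, ℝ).prod 𝓘(ℝ, E n)) 𝓘(ℝ, E d × Form n d) ∞ (fun a : ℝ × X =>
        Ψ.symm (extChartAt 𝓘(ℝ, E d) b (τ a.1 a.2), (Ψ (coord b (γ a.2))).2 + a.1 • e)) a ∧
      coord b (localMotion b Ψ γ τ e a.1 a.2) =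
        Ψ.symm (extChartAt 𝓘(ℝ, E d) b (τ a.1 a.2), (Ψ (coord b (γ a.2))).2 + a.1 • e) ∧
      (0 ≤ a.1 → localMotion b Ψ γ τ e a.1 a.2 ∈ M) ∧
      (τ a.1 a.2 = (γ a.2).pt → a.1 • e = 0 → localMotion b Ψ γ τ e a.1 a.2 = γ a.2) := by
  have hbs : (γ x₀).pt ∈ (extChartAt 𝓘(ℝ, E d) b).source := by
    rw [hb]; exact mem_extChartAt_source _
  have hpair : ∀ x, (γ x).pt ∈ (extChartAt 𝓘(ℝ, E d) b).source →
      ContMDiffAt 𝓘(ℝ, E n) 𝓘(ℝ, E d × Form n d) ∞ (fun x => coord b (γ x)) x := by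
    intro x hx
    refine ContMDiffAt.prodMk_space ?_ (hγ.contMDiffAt_coord hx)
    rw [extChartAt_source] at hx
    exact ContMDiffAt.comp (g := extChartAt 𝓘(ℝ, E d) b) (f := fun x => (γ x).pt) x
      (contMDiffAt_extChartAt' hx) hγ.1.contMDiffAt
  have hQ : ∀ a : ℝ × X, τ a.1 a.2 ∈ (extChartAt 𝓘(ℝ, E d) b).source →
      (γ a.2).pt ∈ (extChartAt 𝓘(ℝ, E d) b).source → coord b (γ a.2) ∈ Ψ.source →
      ContMDiffAt (𝓘(ℝ, ℝ).prod 𝓘(ℝ, E n)) 𝓘(ℝ, E d × Form n d) ∞ (fun a : ℝ × X =>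
        (extChartAt 𝓘(ℝ, E d) b (τ a.1 a.2), (Ψ (coord b (γ a.2))).2 + a.1 • e)) a := by
    intro a hτs hγs hΨs
    have hq : ContMDiffAt (𝓘(ℝ, ℝ).prod 𝓘(ℝ, E n)) 𝓘(ℝ, E d) ∞
        (fun a : ℝ × X => extChartAt 𝓘(ℝ, E d) b (τ a.1 a.2)) a := by
      rw [extChartAt_source] at hτs
      exact ContMDiffAt.comp (g := extChartAt 𝓘(ℝ, E d) b) (f := fun a : ℝ × X => τ a.1 a.2)
        a (contMDiffAt_extChartAt' hτs) hτ.contMDiffAt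
    have h1 : ContMDiffAt 𝓘(ℝ, E n) 𝓘(ℝ, Form n d) ∞ (fun x => (Ψ (coord b (γ x))).2) a.2 := by
      have h2 : ContDiffAt ℝ ∞ (fun a => (Ψ a).2) (coord b (γ a.2)) :=
        ContDiffAt.snd (h.smooth.contDiffAt (Ψ.open_source.mem_nhds hΨs))
      exact ContMDiffAt.comp (g := fun a => (Ψ a).2) (f := fun x => coord b (γ x)) a.2
        h2.contMDiffAt (hpair _ hγs)
    have h2 : ContMDiffAt (𝓘(ℝ, ℝ).prod 𝓘(ℝ, E n)) 𝓘(ℝ, Form n d) ∞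
        (fun a : ℝ × X => a.1 • e) a :=
      ContMDiffAt.comp (g := fun u : ℝ => u • e) (f := fun a : ℝ × X => a.1) a
        (contDiff_id.smul contDiff_const).contMDiff.contMDiffAt contMDiffAt_fst
    exact hq.prodMk_space ((ContMDiffAt.comp (g := fun x => (Ψ (coord b (γ x))).2)
      (f := fun a : ℝ × X => a.2) a h1 contMDiffAt_snd).add h2)
  have hcoordΨ : ∀ x, coord b (γ x) ∈ Ψ.source →
      (extChartAt 𝓘(ℝ, E d) b (γ x).pt, (Ψ (coord b (γ x))).2) = Ψ (coord b (γ x)) := fun x hx =>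
    Prod.ext (h.fst _ hx).2.symm rfl
  have hQ0 : (extChartAt 𝓘(ℝ, E d) b (τ 0 x₀), (Ψ (coord b (γ x₀))).2 + (0 : ℝ) • e) =
      Ψ (coord b (γ x₀)) := by
    rw [hτ0, zero_smul, add_zero, hcoordΨ x₀ hΨ]
  have hQt : ∀ᶠ a : ℝ × X in 𝓝 (0, x₀),
      (extChartAt 𝓘(ℝ, E d) b (τ a.1 a.2), (Ψ (coord b (γ a.2))).2 + a.1 • e) ∈ Ψ.target := by
    refine (hQ (0, x₀) (by simp only [hτ0, hbs]) hbs hΨ).continuousAt.preimage_mem_nhds (Ψ.open_target.mem_nhds ?_)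
    simp only [hQ0]
    exact Ψ.map_source hΨ
  have hτs : ∀ᶠ a : ℝ × X in 𝓝 (0, x₀), τ a.1 a.2 ∈ (extChartAt 𝓘(ℝ, E d) b).source := by
    refine hτ.continuous.continuousAt.preimage_mem_nhds
      ((isOpen_extChartAt_source (I := 𝓘(ℝ, E d)) b).mem_nhds ?_)
    simp only [hτ0, hbs]
  have hγs : ∀ᶠ a : ℝ × X in 𝓝 (0, x₀), (γ a.2).pt ∈ (extChartAt 𝓘(ℝ, E d) b).source :=
    (hγ.1.continuous.comp continuous_snd).continuousAt.preimage_mem_nhds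
      ((isOpen_extChartAt_source (I := 𝓘(ℝ, E d)) b).mem_nhds hbs)
  have hΨs : ∀ᶠ a : ℝ × X in 𝓝 (0, x₀), coord b (γ a.2) ∈ Ψ.source := by
    have h1 : Tendsto (fun a : ℝ × X => a.2) (𝓝 (0, x₀)) (𝓝 x₀) :=
      (continuous_snd (X := ℝ) (Y := X)).tendsto (0, x₀)
    exact h1.eventually ((hpair x₀ hbs).continuousAt.preimage_mem_nhds (Ψ.open_source.mem_nhds hΨ))
  filter_upwards [hQt, hτs, hγs, hΨs] with a hQt hτs hγs hΨs
  obtain ⟨h1, h2⟩ := h.ofCoord_symm hτs hQt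
  have hback : τ a.1 a.2 = (γ a.2).pt → a.1 • e = 0 →
      (ofCoord b (Ψ.symm (extChartAt 𝓘(ℝ, E d) b (τ a.1 a.2),
        (Ψ (coord b (γ a.2))).2 + a.1 • e)) : FormBundle n d N) = γ a.2 := by
    intro ha he
    rw [ha, he, add_zero, hcoordΨ _ hΨs, Ψ.left_inv hΨs, ofCoord_coord hγs]
  have heq : localMotion b Ψ γ τ e a.1 a.2 = ofCoord b (Ψ.symm (extChartAt 𝓘(ℝ, E d) b
      (τ a.1 a.2), (Ψ (coord b (γ a.2))).2 + a.1 • e)) := by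
    by_cases ha : a.1 = 0
    · rw [hback (by rw [ha, hτ0]) (by rw [ha, zero_smul]), localMotion, if_pos ha, ha, hτ0]
    · rw [localMotion, if_neg ha]
      exact congrArg (fun q => (⟨q, _⟩ : FormBundle n d N)) h1.symm
  rw [heq]
  refine ⟨hτs, ?_, h2, fun ha => ?_, hback⟩
  · exact ContMDiffAt.comp (g := Ψ.symm) (f := fun a : ℝ × X =>
      (extChartAt 𝓘(ℝ, E d) b (τ a.1 a.2), (Ψ (coord b (γ a.2))).2 + a.1 • e)) a
      (h.smooth_symm.contDiffAt (Ψ.open_target.mem_nhds hQt)).contMDiffAt (hQ a hτs hγs hΨs)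
  · rw [h.mem_iff _ (Ψ.map_target hQt), Ψ.right_inv hQt]
    have h3 := (h.mem_iff _ hΨs).1 (by rw [ofCoord_coord hγs]; exact hmem _)
    refine ⟨S.add_mem h3.1 (S.smul_mem _ heS), ?_⟩
    rw [map_add, map_smul, smul_eq_mul]
    exact add_nonneg h3.2 (mul_nonneg ha hel)

omit [IsManifold 𝓘(ℝ, E n) ∞ X] in
theorem exists_isLocalMotion (h : IsStraightening M b Ψ S lam) (hb : b = (γ x₀).pt)
    (hΨ : coord b (γ x₀) ∈ Ψ.source) (hγ : SmoothForm 𝓘(ℝ, E n) γ) (hmem : ∀ x, γ x ∈ M)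
    (hτ : ContMDiff (𝓘(ℝ, ℝ).prod 𝓘(ℝ, E n)) 𝓘(ℝ, E d) ∞ (fun a : ℝ × X => τ a.1 a.2))
    (hτ0 : ∀ x, τ 0 x = (γ x).pt) (heS : e ∈ S) (hel : 0 ≤ lam e) :
    ∃ O, IsOpen O ∧ x₀ ∈ O ∧ ∃ η > 0, IsLocalMotion M γ O η (localMotion b Ψ γ τ e) ∧
      ∀ u x, |u| < η → x ∈ O → τ u x = (γ x).pt → u • e = 0 → localMotion b Ψ γ τ e u x = γ x := by
  have hev := localMotion_eventually h hb hΨ hγ hmem hτ hτ0 heS hel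
  have hev' := hev.eventually_nhds
  rw [nhds_prod_eq] at hev'
  obtain ⟨A, hA, B, hB, hAB⟩ := Filter.eventually_prod_iff.1 hev'
  obtain ⟨η, hη, hball⟩ := Metric.eventually_nhds_iff.1 hA
  obtain ⟨O, hOB, hO, hxO⟩ := mem_nhds_iff.1 hB
  have hgood : ∀ u x, |u| < η → x ∈ O → _ := fun u x hu hx =>
    hAB (hball (by rwa [Real.dist_eq, sub_zero])) (hOB hx)
  refine ⟨O, hO, hxO, η, hη, ⟨?_, ?_, ?_⟩, ?_⟩
  · funext x
    simp only [localMotion, hτ0, if_true]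
  · intro u x hu hx
    obtain ⟨h1, h2, h3, -, -⟩ := (hgood u x hu hx).self_of_nhds
    refine ⟨hτ.contMDiffAt, b, h1, ?_⟩
    have h4 : ContMDiffAt (𝓘(ℝ, ℝ).prod 𝓘(ℝ, E n)) 𝓘(ℝ, Form n d) ∞ (fun a : ℝ × X =>
        (Ψ.symm (extChartAt 𝓘(ℝ, E d) b (τ a.1 a.2),
          (Ψ (coord b (γ a.2))).2 + a.1 • e)).2) (u, x) :=
      ContMDiffAt.comp (g := fun a : E d × Form n d => a.2) (f := fun a : ℝ × X =>
        (Ψ.symm (extChartAt 𝓘(ℝ, E d) b (τ a.1 a.2), (Ψ (coord b (γ a.2))).2 + a.1 • e)))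
        (u, x) contDiff_snd.contMDiff.contMDiffAt h2
    refine h4.congr_of_eventuallyEq ?_
    filter_upwards [hgood u x hu hx] with a ha
    rw [ha.2.2.1]
  · intro u x hu0 hu hx
    exact (hgood u x (by rwa [abs_of_nonneg hu0]) hx).self_of_nhds.2.2.2.1 hu0
  · intro u x hu hx
    exact (hgood u x hu hx).self_of_nhds.2.2.2.2

end Motions

theorem tangentConeAt_submodule_subset {V : Type*} [NormedAddCommGroup V] [NormedSpace ℝ V]
    {S : Submodule ℝ V} (hS : IsClosed (S : Set V)) {x : V} (hx : x ∈ S) :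
    tangentConeAt ℝ (S : Set V) x ⊆ S := by
  intro y hy
  obtain ⟨ι, l, hl, c, d, -, hds, hcd⟩ := exists_fun_of_mem_tangentConeAt hy
  refine hS.mem_of_tendsto hcd (hds.mono fun i hi => S.smul_mem _ ?_)
  simpa using S.sub_mem hi hx

/-! ### Tangent directions of the fibres of ℳ -/

section Fibre

variable {n d : ℕ} {N : Type*} [TopologicalSpace N] [ChartedSpace (E d) N]
  [IsManifold 𝓘(ℝ, E d) ∞ N] {M : Set (FormBundle n d N)} {b : N}
  {Ψ : OpenPartialHomeomorph (E d × Form n d) (E d × Form n d)}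
  {S : Submodule ℝ (Form n d)} {lam : Form n d →L[ℝ] ℝ}

/-- The differential of Ψ maps (0, ζ) to (0, e): Ψ preserves base points, and it carries the fibre
into the closed subspace S, whose tangent cone is contained in S. -/
theorem IsStraightening.exists_direction (h : IsStraightening M b Ψ S lam)
    (hS : IsClosed (S : Set (Form n d))) {m : FormBundle n d N} (hb : b = m.pt) (hm : m ∈ M)
    (hΨ : coord b m ∈ Ψ.source) {ζ : Form n d} (hζ : ζ ∈ tangentConeAt ℝ (fibre M m.pt) m.form) :
    ∃ e ∈ S, fderiv ℝ Ψ.symm (Ψ (coord b m)) (0, e) = (0, ζ) := by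
  obtain ⟨q, p⟩ := m
  obtain rfl : b = q := hb
  have hcoord : ∀ p, coord b (⟨b, p⟩ : FormBundle n d N) = (extChartAt 𝓘(ℝ, E d) b b, p) :=
    fun p => Prod.ext rfl (coord_self_snd b p)
  have hof : ∀ p, ofCoord b (extChartAt 𝓘(ℝ, E d) b b, p) = (⟨b, p⟩ : FormBundle n d N) :=
    fun p => by rw [← hcoord, ofCoord_coord (mem_extChartAt_source b)]
  simp only [hcoord] at hΨ ⊢ hζ
  have hD := (h.smooth.contDiffAt (Ψ.open_source.mem_nhds hΨ)).differentiableAt (by simp)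
  have hDs := (h.smooth_symm.contDiffAt (Ψ.open_target.mem_nhds
    (Ψ.map_source hΨ))).differentiableAt (by simp)
  have hline : HasFDerivAt (fun p : Form n d => (extChartAt 𝓘(ℝ, E d) b b, p))
    (ContinuousLinearMap.inr ℝ (E d) (Form n d)) p := hasFDerivAt_prodMk_right _ _
  have hcomp := HasFDerivAt.comp (g := Ψ) p hD.hasFDerivAt hline
  have hsrc : {p | (extChartAt 𝓘(ℝ, E d) b b, p) ∈ Ψ.source} ∈ 𝓝 p :=
    hline.continuousAt.preimage_mem_nhds (Ψ.open_source.mem_nhds hΨ)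
  -- Along the fibre the base component of Ψ is constant.
  have hfst : (fderiv ℝ Ψ (extChartAt 𝓘(ℝ, E d) b b, p) (0, ζ)).1 = 0 := by
    have h1 := HasFDerivAt.comp (g := Prod.fst) p hasFDerivAt_fst hcomp
    have h2 : (Prod.fst ∘ Ψ ∘ fun p : Form n d => (extChartAt 𝓘(ℝ, E d) b b, p)) =ᶠ[𝓝 p]
        fun _ => extChartAt 𝓘(ℝ, E d) b b := by
      filter_upwards [hsrc] with p' hp'
      exact (h.fst _ hp').2
    have h3 := h1.unique ((hasFDerivAt_const (extChartAt 𝓘(ℝ, E d) b b) p).congr_of_eventuallyEq h2)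
    exact congrArg (fun T : Form n d →L[ℝ] E d => T ζ) h3
  refine ⟨(fderiv ℝ Ψ (extChartAt 𝓘(ℝ, E d) b b, p) (0, ζ)).2, ?_, ?_⟩
  · have h1 := HasFDerivAt.comp (g := Prod.snd) p hasFDerivAt_snd hcomp
    have hmem : ∀ p', (⟨b, p'⟩ : FormBundle n d N) ∈ M →
        (extChartAt 𝓘(ℝ, E d) b b, p') ∈ Ψ.source →
        (Ψ (extChartAt 𝓘(ℝ, E d) b b, p')).2 ∈ S := fun p' hp' hs =>
      ((h.mem_iff _ hs).1 (by rw [hof]; exact hp')).1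
    rw [← tangentConeAt_inter_nhds hsrc] at hζ
    have h2 := h1.hasFDerivWithinAt.mapsTo_tangent_cone hζ
    refine tangentConeAt_submodule_subset hS (hmem p hm hΨ) (tangentConeAt_mono ?_ h2)
    rintro - ⟨p', ⟨hp', hs⟩, rfl⟩
    exact hmem p' hp' hs
  · have h1 : (0, (fderiv ℝ Ψ (extChartAt 𝓘(ℝ, E d) b b, p) (0, ζ)).2) =
        fderiv ℝ Ψ (extChartAt 𝓘(ℝ, E d) b b, p) (0, ζ) := Prod.ext hfst.symm rfl
    rw [h1]
    have h2 := HasFDerivAt.comp (g := Ψ.symm) (f := Ψ) _ hDs.hasFDerivAt hD.hasFDerivAt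
    have h3 : (Ψ.symm ∘ Ψ) =ᶠ[𝓝 (extChartAt 𝓘(ℝ, E d) b b, p)] id := by
      filter_upwards [Ψ.open_source.mem_nhds hΨ] with a ha
      exact Ψ.left_inv ha
    have h4 := h2.unique ((hasFDerivAt_id _).congr_of_eventuallyEq h3)
    exact congrArg (fun T : E d × Form n d →L[ℝ] E d × Form n d => T (0, ζ)) h4

end Fibre

/-! ### Vertical variations: tangent planes of critical points correspond to their forms -/

section Vertical

variable {n d : ℕ} {N : Type*} [TopologicalSpace N] [ChartedSpace (E d) N]
  [IsManifold 𝓘(ℝ, E d) ∞ N] {X : Type*} [TopologicalSpace X] [ChartedSpace (E n) X]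
  [IsManifold 𝓘(ℝ, E n) ∞ X]
  {om : N → Form n d} {L : N → NVec n d → ℝ} {M : Set (FormBundle n d N)} {r : ℕ}
  {γ : X → FormBundle n d N}

/-- Only a right derivative of g is given. The chain rule still applies because the time change maps
[0, π] into [0, ∞). -/
theorem hasDerivWithinAt_cutoff {g : ℝ → ℝ} {a c δ : ℝ} (hg : HasDerivWithinAt g a (Ici 0) 0)
    (hc : 0 ≤ c) (hδ : 0 < δ) :
    HasDerivWithinAt (fun s => g (c * (δ * Real.sin s))) (a * (c * δ)) (Ici 0) 0 := by
  have h1 : HasDerivAt (fun s => c * (δ * Real.sin s)) (c * δ) 0 := by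
    simpa using ((Real.hasDerivAt_sin 0).const_mul δ).const_mul c
  have h2 : MapsTo (fun s => c * (δ * Real.sin s)) (Icc 0 Real.pi) (Ici 0) := fun s hs =>
    mul_nonneg hc (mul_nonneg hδ.le (Real.sin_nonneg_of_nonneg_of_le_pi hs.1 hs.2))
  have h3 := HasDerivWithinAt.comp_of_eq (0 : ℝ) hg h1.hasDerivWithinAt h2 (by simp)
  exact h3.mono_of_mem_nhdsWithin (Icc_mem_nhdsGE Real.pi_pos)

variable {b : N} {Ψ : OpenPartialHomeomorph (E d × Form n d) (E d × Form n d)}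
  {S : Submodule ℝ (Form n d)} {lam : Form n d →L[ℝ] ℝ} {e : Form n d} {x₀ : X}

theorem fderiv_formRep_localMotion (h : IsStraightening M b Ψ S lam) (hb : b = (γ x₀).pt)
    (hΨ : coord b (γ x₀) ∈ Ψ.source) (hγ : SmoothForm 𝓘(ℝ, E n) γ) (hmem : ∀ x, γ x ∈ M)
    (heS : e ∈ S) (hel : 0 ≤ lam e) {ζ : Form n d}
    (hζ : fderiv ℝ Ψ.symm (Ψ (coord b (γ x₀))) (0, e) = (0, ζ)) :
    fderiv ℝ (formRep x₀ b (localMotion b Ψ γ (fun _ x => (γ x).pt) e))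
      (0, extChartAt 𝓘(ℝ, E n) x₀ x₀) (1, 0) = ζ := by
  have hev := localMotion_eventually h hb hΨ hγ hmem (τ := fun _ x => (γ x).pt)
    (hγ.1.comp contMDiff_snd) (fun _ => rfl) heS hel
  have hyt := mem_extChartAt_target (I := 𝓘(ℝ, E n)) x₀
  have hyx : (extChartAt 𝓘(ℝ, E n) x₀).symm (extChartAt 𝓘(ℝ, E n) x₀ x₀) = x₀ :=
    extChartAt_to_inv x₀
  have hchart := contMDiffAt_prod_extChartAt_symm
    (a := ((0 : ℝ), extChartAt 𝓘(ℝ, E n) x₀ x₀)) hyt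
  have hev2 := hchart.continuousAt.eventually (by simpa only [hyx] using hev)
  obtain ⟨F, hF⟩ : ∃ F : ℝ × E n → E d × Form n d, F = fun a =>
    Ψ.symm (extChartAt 𝓘(ℝ, E d) b (γ ((extChartAt 𝓘(ℝ, E n) x₀).symm a.2)).pt,
      (Ψ (coord b (γ ((extChartAt 𝓘(ℝ, E n) x₀).symm a.2)))).2 + a.1 • e) := ⟨_, rfl⟩
  have hFs : ContDiffAt ℝ ∞ F (0, extChartAt 𝓘(ℝ, E n) x₀ x₀) := by
    rw [← contMDiffAt_iff_contDiffAt, hF]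
    refine ContMDiffAt.comp
      (f := fun a : ℝ × E n => (a.1, (extChartAt 𝓘(ℝ, E n) x₀).symm a.2))
      (g := fun a : ℝ × X => Ψ.symm (extChartAt 𝓘(ℝ, E d) b (γ a.2).pt,
        (Ψ (coord b (γ a.2))).2 + a.1 • e)) (0, extChartAt 𝓘(ℝ, E n) x₀ x₀) ?_ hchart
    simp only [hyx]
    exact hev.self_of_nhds.2.1
  have heq : formRep x₀ b (localMotion b Ψ γ (fun _ x => (γ x).pt) e)
      =ᶠ[𝓝 (0, extChartAt 𝓘(ℝ, E n) x₀ x₀)] fun a => (F a).2 := by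
    filter_upwards [hev2] with a ha
    rw [formRep, ha.2.2.1, hF]
  have hFd := hFs.differentiableAt (by simp)
  rw [heq.fderiv_eq, hFd.hasFDerivAt.snd.fderiv]
  have h1 : HasDerivAt (fun s : ℝ => (s, extChartAt 𝓘(ℝ, E n) x₀ x₀)) ((1 : ℝ), (0 : E n)) 0 :=
    (hasDerivAt_id 0).prodMk (hasDerivAt_const 0 _)
  have h2 := hFd.hasFDerivAt.comp_hasDerivAt (0 : ℝ) h1
  have hc : (extChartAt 𝓘(ℝ, E d) b (γ x₀).pt, (Ψ (coord b (γ x₀))).2) = Ψ (coord b (γ x₀)) :=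
    Prod.ext (h.fst _ hΨ).2.symm rfl
  have h3 : HasDerivAt (fun s : ℝ => (extChartAt 𝓘(ℝ, E d) b (γ x₀).pt,
      (Ψ (coord b (γ x₀))).2 + s • e)) ((0 : E d), e) 0 := by
    refine (hasDerivAt_const _ _).prodMk ?_
    simpa using ((hasDerivAt_id (0 : ℝ)).smul_const e).const_add (Ψ (coord b (γ x₀))).2
  have hDs := (h.smooth_symm.contDiffAt (Ψ.open_target.mem_nhds
    (Ψ.map_source hΨ))).differentiableAt (by simp)
  have h4 := HasFDerivAt.comp_hasDerivAt_of_eq (0 : ℝ) hDs.hasFDerivAt h3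
    (by rw [zero_smul, add_zero, hc])
  rw [hζ] at h4
  have h5 : (F ∘ fun s : ℝ => (s, extChartAt 𝓘(ℝ, E n) x₀ x₀)) = Ψ.symm ∘ fun s : ℝ =>
      (extChartAt 𝓘(ℝ, E d) b (γ x₀).pt, (Ψ (coord b (γ x₀))).2 + s • e) := by
    funext s
    simp only [hF, Function.comp_apply, hyx]
  rw [h5] at h2
  exact congrArg Prod.snd (h2.unique h4)

theorem CoeffContinuousOn.smul {α : X → Form n n} {K : Set X} (h : CoeffContinuousOn α K) (a : ℝ) :
    CoeffContinuousOn (fun x => a • α x) K := fun c x hxK hx =>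
  continuousAt_const.mul (h c x hxK hx)

variable [T2Space X] [SigmaCompactSpace X]

/-- The fundamental lemma of the calculus of variations. If the pairing were nonzero at x₀, the
density of the vertical variation relative to the volume would keep its sign near x₀, and a bump
function supported there would give a deformation with nonzero first variation. -/
theorem planeAt_sub_apply_eq_zero (hn : 1 ≤ n) (hom : IsSpaceTimeVolume om)
    (hL : SmoothLagrangian om L) (hM : LegendreCorrespondenceHypothesis om L M r)
    (hγ : IsCurve om M γ) (hcrit : IsCritical om L M γ) (h : IsStraightening M b Ψ S lam)
    (hb : b = (γ x₀).pt) (hΨ : coord b (γ x₀) ∈ Ψ.source) (heS : e ∈ S) (hel : 0 ≤ lam e)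
    {ζ : Form n d} (hζ : fderiv ℝ Ψ.symm (Ψ (coord b (γ x₀))) (0, e) = (0, ζ))
    {z₀ : NVec n d} (hz₀ : z₀ ∈ Z om L (γ x₀)) : (planeAt om γ x₀ - z₀) ζ = 0 := by
  by_contra hne
  obtain ⟨P, hPdef⟩ : ∃ P : ℝ → X → FormBundle n d N, P = localMotion b Ψ γ (fun _ x => (γ x).pt) e := ⟨_, rfl⟩
  obtain ⟨O, hO, hxO, η, hη, hP, -⟩ := exists_isLocalMotion h hb hΨ hγ.smooth hγ.mem
    (τ := fun _ x => (γ x).pt) (hγ.smooth.1.comp contMDiff_snd) (fun _ => rfl) heS hel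
  have hPpt : ∀ u x, (P u x).pt = (γ x).pt := fun u x => by rw [hPdef]; rfl
  have hform := fderiv_formRep_localMotion h hb hΨ hγ.smooth hγ.mem heS hel hζ
  rw [← hPdef] at hP hform
  have hP0 : P 0 x₀ = γ x₀ := congrFun hP.zero x₀
  obtain ⟨hs1, c, hc, hs2⟩ := hP.smooth 0 x₀ (by simpa using hη) hxO
  have hy₀ : extChartAt 𝓘(ℝ, E n) x₀ x₀ ∈ (extChartAt 𝓘(ℝ, E n) x₀).target :=
    mem_extChartAt_target x₀
  obtain ⟨G, hG, hGeq, -, hGd⟩ := hM.exists_localAction hn hom hL (c := x₀)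
    (mem_extChartAt_source x₀) hs1
    (contMDiffAt_coord_change (f := fun a : ℝ × X => P a.1 a.2) (a := ((0 : ℝ), x₀))
      hs1 hc (mem_extChartAt_source _) hs2)
    (by rw [hP0]; exact hγ.mem x₀) (z₀ := z₀) (by rw [hP0]; exact hz₀) rfl rfl
  have hGd := hGd fun s x => by rw [hPpt, hPpt]
  have hv₀ : frameRep x₀ (P 0 x₀).pt P (0, extChartAt 𝓘(ℝ, E n) x₀ x₀) =
      localFrame x₀ (γ x₀).pt (fun x => (γ x).pt) (extChartAt 𝓘(ℝ, E n) x₀ x₀) := by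
    simp only [frameRep, hPpt]
  rw [hv₀, hP0, ← hb, hform, hb] at hGd
  have hvne := om_localFrame_ne_zero hγ x₀
  rw [planeAt_eq hγ x₀] at hne
  generalize (localFrame x₀ (γ x₀).pt (fun x => (γ x).pt) (extChartAt 𝓘(ℝ, E n) x₀ x₀) :
    Fin n → E d) = v₀ at hGd hvne hne
  have hGne : fderiv ℝ G (0, extChartAt 𝓘(ℝ, E n) x₀ x₀) (1, 0) ≠ 0 := by
    rw [hGd]
    -- This factors the vertical derivative as ⟨z_Γ - z₀, ζ⟩ ω(v₀), with ω(v₀) ≠ 0.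
    have h1 : ζ v₀ - z₀ ζ * om (γ x₀).pt v₀ =
        (((om (γ x₀).pt v₀)⁻¹ • wedge v₀ - z₀) ζ) * om (γ x₀).pt v₀ := by
      change _ = ((om (γ x₀).pt v₀)⁻¹ * ζ v₀ - z₀ ζ) * om (γ x₀).pt v₀
      field_simp
    rw [h1]
    exact mul_ne_zero hne hvne
  have hν := hγ.coeffContinuousOn_pullVolume (K := univ) hom
  have hν0 := hγ.volume_ne_zero
  -- The density of the uncut variation with respect to the volume γ^* ω.
  obtain ⟨κ, hκdef⟩ : ∃ κ : X → ℝ, κ = fun x =>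
    fderiv ℝ G (0, extChartAt 𝓘(ℝ, E n) x₀ x) (1, 0) / coeff x₀ (pullVolume om γ) x := ⟨_, rfl⟩
  have hκ₀ : κ x₀ ≠ 0 := by
    rw [hκdef]
    exact div_ne_zero hGne (coeff_ne_zero (mem_extChartAt_source x₀) (hν0 x₀))
  have hG1 : ContDiffAt ℝ 1 G (0, extChartAt 𝓘(ℝ, E n) x₀ x₀) := hG.of_le (by simp)
  have hκc : ContinuousAt κ x₀ := by
    have h1 : ContinuousAt (fun x => fderiv ℝ G (0, extChartAt 𝓘(ℝ, E n) x₀ x) (1, 0)) x₀ :=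
      ContinuousAt.comp (f := extChartAt 𝓘(ℝ, E n) x₀) (continuousAt_fderiv_apply hG1 (1, 0))
        (continuousAt_extChartAt x₀)
    have h2 : ContinuousAt (coeff x₀ (pullVolume om γ)) x₀ := by
      refine (ContinuousAt.comp (f := extChartAt 𝓘(ℝ, E n) x₀)
        (hν x₀ x₀ (mem_univ _) (mem_extChartAt_source x₀)) (continuousAt_extChartAt x₀)).congr ?_
      filter_upwards [extChartAt_source_mem_nhds (I := 𝓘(ℝ, E n)) x₀] with x hx
      simp only [Function.comp_apply, (extChartAt 𝓘(ℝ, E n) x₀).left_inv hx]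
    rw [hκdef]
    exact h1.div h2 (coeff_ne_zero (mem_extChartAt_source x₀) (hν0 x₀))
  have hder : ∀ᶠ x in 𝓝 x₀, HasDerivWithinAt (fun u => coeff x₀ (actionForm om L (P u)) x)
      (fderiv ℝ G (0, extChartAt 𝓘(ℝ, E n) x₀ x) (1, 0)) (Ici 0) 0 := by
    have h1 : ∀ᶠ a in 𝓝 ((0 : ℝ), extChartAt 𝓘(ℝ, E n) x₀ x₀), 0 ≤ a.1 →
        coeff x₀ (actionForm om L (P a.1)) ((extChartAt 𝓘(ℝ, E n) x₀).symm a.2) = G a := by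
      have hO' : (extChartAt 𝓘(ℝ, E n) x₀).symm ⁻¹' O ∈ 𝓝 (extChartAt 𝓘(ℝ, E n) x₀ x₀) :=
        (continuousAt_extChartAt_symm x₀).preimage_mem_nhds
          (by rw [extChartAt_to_inv]; exact hO.mem_nhds hxO)
      filter_upwards [hGeq, continuous_fst.continuousAt.preimage_mem_nhds (Iio_mem_nhds hη),
        continuous_snd.continuousAt.preimage_mem_nhds hO'] with a ha ha1 ha2 ha0
      exact ha (hP.mem _ _ ha0 ha1 ha2)
    have h2 := derivWithin_Ici_eventuallyEq
      (g := fun u y => coeff x₀ (actionForm om L (P u)) ((extChartAt 𝓘(ℝ, E n) x₀).symm y)) hG1 h1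
    filter_upwards [(continuousAt_extChartAt x₀).eventually h2,
      extChartAt_source_mem_nhds (I := 𝓘(ℝ, E n)) x₀] with x hx hxs
    have h3 := hx.1
    simp only [(extChartAt 𝓘(ℝ, E n) x₀).left_inv hxs] at h3
    exact h3
  -- Multiplying by the constant κ x₀ treats both signs at once.
  have hpos : ∀ᶠ x in 𝓝 x₀, 0 < κ x₀ * κ x := by
    have h1 : ContinuousAt (fun x => κ x₀ * κ x) x₀ := continuousAt_const.mul hκc
    exact h1.eventually_const_lt (mul_self_pos.2 hκ₀)
  have hV := (hder.and hpos).and ((hO.eventually_mem hxO).and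
    (extChartAt_source_mem_nhds (I := 𝓘(ℝ, E n)) x₀))
  obtain ⟨χ, -, hχV⟩ := (SmoothBumpFunction.nhds_basis_tsupport (I := 𝓘(ℝ, E n)) x₀).mem_iff.1 hV
  have hKc : IsCompact (tsupport χ) := χ.hasCompactSupport
  have hdef : IsDeformation M γ (tsupport χ) (fun s x => P (cutoffTime χ (η / 2) (s, x)) x) :=
    hP.isDeformation hγ.smooth hγ.mem χ.contMDiff (fun _ => χ.nonneg) (fun _ => χ.le_one)
      (fun x hx => (hχV hx).2.1) (half_pos hη) (half_lt_self hη)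
      fun u x _ _ hx hx' => absurd (subset_tsupport _ hx') hx
  have hzero := (isCritical_iff hn hom hL hM hγ).1 hcrit _ _ hKc hdef
  have hform : ∀ s x, actionForm om L (fun x => P (cutoffTime χ (η / 2) (s, x)) x) x =
      actionForm om L (P (χ x * (η / 2 * Real.sin s))) x := fun s x => by
    rw [hPdef]; rfl
  have hvar : ∀ x ∈ tsupport χ, initialDeriv (fun s => actionForm om L
      (fun x => P (cutoffTime χ (η / 2) (s, x)) x)) x =
        (κ x * (χ x * (η / 2))) • pullVolume om γ x := by
    intro x hx
    obtain ⟨⟨hdx, -⟩, -, hxs⟩ := hχV hx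
    have h1 := hasDerivWithinAt_cutoff hdx (χ.nonneg (x := x)) (half_pos hη)
    have h2 : (fun s => coeff x₀ (actionForm om L
        (fun x => P (cutoffTime χ (η / 2) (s, x)) x)) x) = fun s => coeff x₀
          (actionForm om L (P (χ x * (η / 2 * Real.sin s)))) x := by
      funext s
      rw [coeff, hform]
      rfl
    rw [← h2] at h1
    rw [(hasDerivWithinAt_form hν0 hxs h1).1, hκdef]
    congr 1
    ring
  have hfinal := integralForm_pos hKc (hν.mono (subset_univ _)) hν0
    ((coeffContinuousOn_initialDeriv hν0 fun x _ => Eventually.of_forall fun x' =>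
      hdef.oneSidedSmoothFormAt hn hom hL hM x').smul (κ x₀))
    (κ := fun x => κ x₀ * κ x * (χ x * (η / 2)))
    (fun x hx => mul_nonneg (hχV hx).1.2.le (mul_nonneg χ.nonneg (half_pos hη).le))
    (fun x hx => by rw [hvar x hx, smul_smul]; ring_nf) χ.tsupport_mem_nhds
    (by rw [χ.eq_one]; exact mul_pos (mul_self_pos.2 hκ₀) (by linarith))
  rw [integralForm_smul hKc, hzero, mul_zero] at hfinal
  exact lt_irrefl _ hfinal

/-- The plane tangent to a critical point corresponds to its form. -/
theorem planeAt_mem (hn : 1 ≤ n) (hom : IsSpaceTimeVolume om)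
    (hL : SmoothLagrangian om L) (hM : LegendreCorrespondenceHypothesis om L M r)
    (hγ : IsCurve om M γ) (hcrit : IsCritical om L M γ) (x : X) :
    planeAt om γ x ∈ Z om L (γ x) := by
  obtain ⟨Ψ, S, lam, hSr, hΨ, h1, h2, h3, h4⟩ := hM.subbundle _ (hγ.mem x)
  have h : IsStraightening M (γ x).pt Ψ S lam := ⟨h1, h2, h3, h4⟩
  have hfin : FiniteDimensional ℝ S :=
    FiniteDimensional.of_finrank_pos (by rw [hSr]; exact hM.one_le)
  obtain ⟨z₀, hz₀⟩ := (hM.connected _ (hγ.mem x)).nonempty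
  rw [hM.eq_of_mem _ (hγ.mem x) z₀ hz₀]
  refine ⟨?_, fun p hp => ?_⟩
  · rw [planeAt_eq hγ x]
    exact inv_smul_wedge_mem_planes hn (om_localFrame_ne_zero hγ x)
  · have hle : tangent (fibre M (γ x).pt) (γ x).form ≤
        LinearMap.ker (planeAt om γ x - z₀ : NVec n d).toLinearMap := by
      refine Submodule.span_le.2 fun ζ hζ => ?_
      obtain ⟨e, heS, he⟩ := h.exists_direction S.closed_of_finiteDimensional rfl (hγ.mem x) hΨ hζ
      -- One of e and -e points into the half-space, and the equation to be proved is insensitive to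
      -- the sign of ζ.
      rcases le_total 0 (lam e) with hel | hel
      · exact planeAt_sub_apply_eq_zero hn hom hL hM hγ hcrit h rfl hΨ heS hel he hz₀
      · have h5 := planeAt_sub_apply_eq_zero hn hom hL hM hγ hcrit h rfl hΨ (e := -e)
          (S.neg_mem heS) (by rw [map_neg]; linarith) (ζ := -ζ)
          (by
            have h6 : ((0 : E d), -e) = -(0, e) := by simp
            rw [h6, map_neg, he]; simp) hz₀
        rw [map_neg, neg_eq_zero] at h5
        exact h5
    exact hle hp

end Vertical

theorem fderiv_apply_of_timeChange {Y V : Type*} [NormedAddCommGroup Y] [NormedSpace ℝ Y]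
    [NormedAddCommGroup V] [NormedSpace ℝ V] {B F : ℝ × Y → V} {y : Y} {c δ : ℝ}
    (hB : DifferentiableAt ℝ B (0, y)) (hF : DifferentiableAt ℝ F (0, y))
    (h : ∀ s, F (s, y) = B (c * (δ * Real.sin s), y)) :
    fderiv ℝ F (0, y) (1, 0) = (c * δ) • fderiv ℝ B (0, y) (1, 0) := by
  have h1 : HasDerivAt (fun s : ℝ => (s, y)) ((1 : ℝ), (0 : Y)) 0 :=
    (hasDerivAt_id 0).prodMk (hasDerivAt_const 0 y)
  have h2 : HasDerivAt (fun s : ℝ => (c * (δ * Real.sin s), y)) (c * δ, (0 : Y)) 0 := by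
    refine HasDerivAt.prodMk ?_ (hasDerivAt_const 0 y)
    simpa using ((Real.hasDerivAt_sin 0).const_mul δ).const_mul c
  have h3 := hF.hasFDerivAt.comp_hasDerivAt (0 : ℝ) h1
  have h4 := HasFDerivAt.comp_hasDerivAt_of_eq (0 : ℝ) hB.hasFDerivAt h2 (by simp)
  have h5 : (F ∘ fun s : ℝ => (s, y)) = B ∘ fun s : ℝ => (c * (δ * Real.sin s), y) := funext h
  rw [h5] at h3
  rw [h3.unique h4, ← map_smul]
  simp

/-! ### The first variation depends only on the base velocity -/

section Criticality

variable {n d : ℕ} {N : Type*} [TopologicalSpace N] [ChartedSpace (E d) N]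
  [IsManifold 𝓘(ℝ, E d) ∞ N] {X : Type*} [TopologicalSpace X] [ChartedSpace (E n) X]
  [IsManifold 𝓘(ℝ, E n) ∞ X]
  {om : N → Form n d} {L : N → NVec n d → ℝ} {M : Set (FormBundle n d N)} {r : ℕ}
  {γ γ' : X → FormBundle n d N} {K : Set X} {σ : ℝ → X → FormBundle n d N}

/-- The initial velocity of the base of the family `σ s`, in charts. -/
def velocity (c : X) (b : N) (σ : ℝ → X → FormBundle n d N) (y : E n) : E d :=
  fderiv ℝ (baseRep c b σ) (0, y) (1, 0)

theorem IsDeformation.contDiffAt_baseRep (hσ : IsDeformation M γ K σ) (x : X) :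
    ContDiffAt ℝ ∞ (baseRep x (γ x).pt σ) (0, extChartAt 𝓘(ℝ, E n) x x) := by
  have hyx : (extChartAt 𝓘(ℝ, E n) x).symm (extChartAt 𝓘(ℝ, E n) x x) = x :=
    extChartAt_to_inv x
  refine LepageDedecker.contDiffAt_baseRep (mem_extChartAt_target x) hσ.smooth.1.contMDiffAt ?_
  simp only [hyx, hσ.zero]
  exact mem_extChartAt_source _

theorem IsDeformation.differentiableAt_velocity (hσ : IsDeformation M γ K σ) (x : X) :
    DifferentiableAt ℝ (velocity x (γ x).pt σ) (extChartAt 𝓘(ℝ, E n) x x) := by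
  have h1 : DifferentiableAt ℝ (fderiv ℝ (baseRep x (γ x).pt σ))
      (0, extChartAt 𝓘(ℝ, E n) x x) :=
    ((hσ.contDiffAt_baseRep x).fderiv_right (m := ∞) (by simp)).differentiableAt (by simp)
  have h2 := HasFDerivAt.comp (g := fderiv ℝ (baseRep x (γ x).pt σ))
    (f := fun y : E n => ((0 : ℝ), y)) _ h1.hasFDerivAt
    (hasFDerivAt_prodMk_right 0 (extChartAt 𝓘(ℝ, E n) x x))
  exact h2.differentiableAt.clm_apply (differentiableAt_const _)

/-- Because the tangent plane corresponds to the form, the integrand may be replaced to first order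
by the homogeneous Lagrangian of (q, v). The result is linear in the velocity and its first
derivatives, and the variation of p has disappeared. -/
theorem IsDeformation.coeff_initialDeriv_actionForm (hn : 1 ≤ n) (hom : IsSpaceTimeVolume om)
    (hL : SmoothLagrangian om L) (hM : LegendreCorrespondenceHypothesis om L M r)
    (hγ : IsCurve om M γ) (hσ : IsDeformation M γ K σ) {x : X}
    (hz : planeAt om γ x ∈ Z om L (γ x)) :
    coeff x (initialDeriv fun s => actionForm om L (σ s)) x =
      fderiv ℝ (frameLagrangian om L (γ x).pt) (extChartAt 𝓘(ℝ, E d) (γ x).pt (γ x).pt,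
        localFrame x (γ x).pt (fun x => (γ x).pt) (extChartAt 𝓘(ℝ, E n) x x))
        (velocity x (γ x).pt σ (extChartAt 𝓘(ℝ, E n) x x), fun i =>
          fderiv ℝ (velocity x (γ x).pt σ) (extChartAt 𝓘(ℝ, E n) x x)
            (EuclideanSpace.single i 1)) := by
  have h0 : σ 0 x = γ x := congrFun hσ.zero x
  have hxs := mem_extChartAt_source (I := 𝓘(ℝ, E n)) x
  obtain ⟨ε, hε, hmem⟩ := hσ.mem
  have hframe : frameRep x (γ x).pt σ (0, extChartAt 𝓘(ℝ, E n) x x) =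
      localFrame x (γ x).pt (fun x => (γ x).pt) (extChartAt 𝓘(ℝ, E n) x x) := by
    simp only [frameRep, hσ.zero]
  obtain ⟨G, hG, hGeq, hGd, -⟩ := hM.exists_localAction hn hom hL hxs hσ.smooth.1.contMDiffAt
    (hσ.smooth.contMDiffAt_coord (a := ((0 : ℝ), x)) (mem_extChartAt_source _))
    (by rw [h0]; exact hγ.mem x) (z₀ := planeAt om γ x) (by rw [h0]; exact hz) rfl rfl
  rw [h0, hframe] at hGd
  have hGd := hGd (om_localFrame_ne_zero hγ x) (planeAt_eq hγ x).symm
  have h1 := hasDerivWithinAt_Ici_of_eventually_eq (y := extChartAt 𝓘(ℝ, E n) x x)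
    (g := fun s y => coeff x (actionForm om L (σ s)) ((extChartAt 𝓘(ℝ, E n) x).symm y))
    (hG.differentiableAt (by simp)) (by
      filter_upwards [hGeq, continuous_fst.continuousAt.preimage_mem_nhds (Iio_mem_nhds hε)]
        with a ha ha' ha0
      exact ha (hmem _ ha0 ha' _))
  simp only [extChartAt_to_inv] at h1
  have h5 := hasDerivWithinAt_form (α := fun s => actionForm om L (σ s)) hγ.volume_ne_zero hxs h1
  rw [h5.2, hGd]
  congr 2
  have hB := hσ.contDiffAt_baseRep x
  have hF := (contDiffAt_frameRep hB).differentiableAt (by simp)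
  funext i
  have h2 := hasFDerivAt_pi'.1 hF.hasFDerivAt i
  have h3 := fderiv_fderiv_comm hB (EuclideanSpace.single i (1 : ℝ))
  refine Eq.trans ?_ h3
  exact (congrArg (fun T : ℝ × E n →L[ℝ] E d => T (1, 0)) h2.fderiv).symm

variable [T2Space X] [SigmaCompactSpace X]

/-- Criticality only depends on the projection to `N`, as long as the tangent planes correspond to
the forms. -/
theorem IsCritical.congr_base (hn : 1 ≤ n) (hom : IsSpaceTimeVolume om)
    (hL : SmoothLagrangian om L) (hM : LegendreCorrespondenceHypothesis om L M r)
    (hγ : IsCurve om M γ) (hγ' : IsCurve om M γ') (hbase : (fun x => (γ' x).pt) = fun x => (γ x).pt)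
    (hz : ∀ x, planeAt om γ x ∈ Z om L (γ x)) (hz' : ∀ x, planeAt om γ x ∈ Z om L (γ' x))
    (hcrit : IsCritical om L M γ) : IsCritical om L M γ' := by
  have hpt : ∀ x, (γ' x).pt = (γ x).pt := fun x => congrFun hbase x
  have hdb : ∀ x, dbase γ' x = dbase γ x := fun x => by rw [dbase, hbase]; rfl
  have hvol : pullVolume om γ' = pullVolume om γ := by
    funext x
    rw [pullVolume, hdb, hpt]; rfl
  have hplane : ∀ x, planeAt om γ' x = planeAt om γ x := fun x => by
    rw [planeAt, hvol, hdb]; rfl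
  rw [isCritical_iff hn hom hL hM hγ']
  intro K σ hK hσ
  rw [hvol]
  have : LocallyCompactSpace X := ChartedSpace.locallyCompactSpace (E n) X
  -- The first variation involves derivatives of the velocity, so the partition functions must sum
  -- to 1 on a neighbourhood of each point of K, not merely on K.
  obtain ⟨K', hK', hKK'⟩ := exists_compact_superset hK
  have hτ0 : ∀ x, (σ 0 x).pt = (γ x).pt := fun x => by rw [hσ.zero, hpt]
  -- Local lifts to ℳ of the base motion of σ, starting at γ instead of γ'. With e = 0 the
  -- straightened fibre coordinate stays constant, so γ is unmoved wherever the base is.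
  have hloc : ∀ x₀ : X, ∃ (O : Set X) (η : ℝ) (P : ℝ → X → FormBundle n d N), IsOpen O ∧ x₀ ∈ O ∧
      0 < η ∧ IsLocalMotion M γ O η P ∧ (∀ u x, (P u x).pt = (σ u x).pt) ∧
      ∀ u x, |u| < η → x ∈ O → (σ u x).pt = (γ x).pt → P u x = γ x := by
    intro x₀
    obtain ⟨Ψ, S, lam, -, hΨ, h1, h2, h3, h4⟩ := hM.subbundle _ (hγ.mem x₀)
    obtain ⟨O, hO, hxO, η, hη, hP, hP'⟩ := exists_isLocalMotion (τ := fun u x => (σ u x).pt)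
      (e := 0) (⟨h1, h2, h3, h4⟩ : IsStraightening M (γ x₀).pt Ψ S lam) rfl hΨ hγ.smooth hγ.mem
      hσ.smooth.1 hτ0 S.zero_mem (by simp)
    exact ⟨O, η, _, hO, hxO, hη, hP, fun u x => rfl, fun u x hu hx h =>
      hP' u x hu hx h (smul_zero u)⟩
  choose O η P hO hxO hη hP hPpt hPeq using hloc
  obtain ⟨t, -, ht⟩ := hK'.elim_nhds_subcover O fun x _ => (hO x).mem_nhds (hxO x)
  obtain ⟨f, hf⟩ := SmoothPartitionOfUnity.exists_isSubordinate 𝓘(ℝ, E n) hK'.isClosed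
    (fun i : t => O i) (fun i => hO i) (by
      intro x hx
      obtain ⟨i, hi, hxi⟩ := mem_iUnion₂.1 (ht hx)
      exact mem_iUnion.2 ⟨⟨i, hi⟩, hxi⟩)
  have hsum : ∀ x ∈ K', ∑ i, f i x = 1 := fun x hx => by
    rw [← finsum_eq_sum_of_fintype]
    exact f.sum_eq_one hx
  -- Each local lift is run at the speed f_i η_i / 2. The halving keeps the time strictly below η_i.
  obtain ⟨ρ, hρ⟩ : ∃ ρ : t → ℝ → X → FormBundle n d N,
    ρ = fun (i : t) s x => P i (cutoffTime (f i) (η i / 2) (s, x)) x := ⟨_, rfl⟩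
  have hdef : ∀ i, IsDeformation M γ K (ρ i) := by
    intro i
    rw [hρ]
    refine (hP i).isDeformation hγ.smooth hγ.mem (f i).contMDiff (fun x => f.nonneg i x)
      (fun x => f.le_one i x) (hf i) (half_pos (hη i)) (half_lt_self (hη i)) ?_
    -- Outside K the base of σ does not move, so neither does the lift.
    intro u x hu hx hxK _
    exact hPeq i u x hu hx (by rw [hσ.eq_off u x hxK, hpt])
  have hvel : ∀ x ∈ K, velocity x (γ x).pt σ =ᶠ[𝓝 (extChartAt 𝓘(ℝ, E n) x x)]
      fun y => ∑ i : t, (2 / η i) • velocity x (γ x).pt (ρ i) y := by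
    intro x hxK
    have hd : ∀ F : ℝ × E n → E d, ContDiffAt ℝ ∞ F (0, extChartAt 𝓘(ℝ, E n) x x) →
        ∀ᶠ y in 𝓝 (extChartAt 𝓘(ℝ, E n) x x), DifferentiableAt ℝ F (0, y) := by
      intro F hF
      have h1 : ContinuousAt (fun y : E n => ((0 : ℝ), y)) (extChartAt 𝓘(ℝ, E n) x x) := by fun_prop
      exact (h1.eventually ((hF.of_le (m := 1) (by simp)).eventually (by simp))).mono
        fun y hy => hy.differentiableAt (by simp)
    have hB : ContDiffAt ℝ ∞ (baseRep x (γ x).pt σ) (0, extChartAt 𝓘(ℝ, E n) x x) := by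
      rw [← hpt]
      exact hσ.contDiffAt_baseRep x
    have hnear : (extChartAt 𝓘(ℝ, E n) x).symm ⁻¹' K' ∈ 𝓝 (extChartAt 𝓘(ℝ, E n) x x) := by
      refine (continuousAt_extChartAt_symm x).preimage_mem_nhds ?_
      rw [extChartAt_to_inv]
      exact mem_interior_iff_mem_nhds.1 (hKK' hxK)
    filter_upwards [hd _ hB, eventually_all.2 fun i : t => hd _ ((hdef i).contDiffAt_baseRep x),
      hnear] with y hy hyi hyK
    have h1 : ∀ i : t, velocity x (γ x).pt (ρ i) y =
        (f i ((extChartAt 𝓘(ℝ, E n) x).symm y) * (η i / 2)) • velocity x (γ x).pt σ y := by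
      intro i
      refine fderiv_apply_of_timeChange hy (hyi i) fun s => ?_
      rw [hρ]
      simp only [baseRep, hPpt, cutoffTime]
    simp only [h1, smul_smul]
    rw [← Finset.sum_smul]
    -- The weights 2 / η_i undo the slowing down, which leaves the sum of the partition functions.
    have h2 : ∑ i : t, 2 / η i * (f i ((extChartAt 𝓘(ℝ, E n) x).symm y) * (η i / 2)) = 1 := by
      rw [← hsum _ hyK]
      refine Finset.sum_congr rfl fun i _ => ?_
      have := (hη i).ne'
      field_simp
    rw [h2, one_smul]
  have hvar : ∀ x ∈ K, initialDeriv (fun s => actionForm om L (σ s)) x =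
      ∑ i : t, (2 / η i) • initialDeriv (fun s => actionForm om L (ρ i s)) x := by
    intro x hxK
    refine eq_of_coeff_eq (mem_extChartAt_source x)
      (β := fun x => ∑ i : t, (2 / η i) • initialDeriv (fun s => actionForm om L (ρ i s)) x) ?_
    have h1 : coeff x (fun x => ∑ i : t, (2 / η i) • initialDeriv
        (fun s => actionForm om L (ρ i s)) x) x = ∑ i : t, (2 / η i) *
          coeff x (initialDeriv fun s => actionForm om L (ρ i s)) x := by
      simp only [coeff, ContinuousAlternatingMap.sum_apply]
      rfl
    have h2 : ∀ i : t, coeff x (initialDeriv fun s => actionForm om L (ρ i s)) x = _ := fun i =>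
      (hdef i).coeff_initialDeriv_actionForm hn hom hL hM hγ (hz x)
    rw [h1, hσ.coeff_initialDeriv_actionForm hn hom hL hM hγ' (by rw [hplane]; exact hz' x)]
    simp only [h2, hpt]
    -- Both sides are values of one linear map, the differential of the frame Lagrangian over γ, so
    -- it suffices to compare its arguments: velocities and their derivatives.
    simp only [← smul_eq_mul (a := (2 / η _ : ℝ)), ← map_smul, ← map_sum]
    congr 1
    refine Prod.ext ?_ ?_
    · rw [Prod.fst_sum]
      exact (hvel x hxK).self_of_nhds
    · rw [Prod.snd_sum]
      funext j
      rw [Finset.sum_apply]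
      change fderiv ℝ (velocity x (γ x).pt σ) _ _ = ∑ i : t, (2 / η i) •
        fderiv ℝ (velocity x (γ x).pt (ρ i)) _ _
      have h3 : HasFDerivAt (fun y => ∑ i : t, (2 / η i) • velocity x (γ x).pt (ρ i) y) _ _ :=
        HasFDerivAt.fun_sum (u := Finset.univ) fun i _ =>
        (((hdef i).differentiableAt_velocity x).hasFDerivAt.const_smul (2 / η i))
      rw [(hvel x hxK).fderiv_eq, h3.fderiv, sum_apply]
      rfl
  rw [integralForm_eq_sum hK (hγ.coeffContinuousOn_pullVolume hom) hγ.volume_ne_zero Finset.univ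
    (α := fun (i : t) x => (2 / η i) • initialDeriv (fun s => actionForm om L (ρ i s)) x)
    (fun i _ => (coeffContinuousOn_initialDeriv hγ.volume_ne_zero fun x _ =>
      Eventually.of_forall fun x' =>
        (hdef i).oneSidedSmoothFormAt hn hom hL hM x').smul (2 / η i)) hvar]
  refine Finset.sum_eq_zero fun i _ => ?_
  rw [integralForm_smul hK, (isCritical_iff hn hom hL hM hγ).1 hcrit K (ρ i) hK (hdef i), mul_zero]

end Criticality

/-! ### Shifting the form by annihilators and by multiples of ω -/

section Shift

variable {n d : ℕ} {N : Type*} [TopologicalSpace N] [ChartedSpace (E d) N]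
  [IsManifold 𝓘(ℝ, E d) ∞ N] {X : Type*} [TopologicalSpace X] [ChartedSpace (E n) X]
  [IsManifold 𝓘(ℝ, E n) ∞ X]
  {om : N → Form n d} {L : N → NVec n d → ℝ} {M : Set (FormBundle n d N)} {r : ℕ}
  {γ : X → FormBundle n d N} {π : X → Form n d}

omit [IsManifold 𝓘(ℝ, E n) ∞ X] in
theorem IsCurve.shift (hγ : IsCurve om M γ)
    (hπ : SmoothForm 𝓘(ℝ, E n) (fun x => (⟨(γ x).pt, π x⟩ : FormBundle n d N)))
    (hmem : ∀ x, shift γ π x ∈ M) : IsCurve om M (shift γ π) where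
  smooth := ⟨hγ.smooth.1, fun x => (hγ.smooth.2 x).add (hπ.2 x)⟩
  embedding := hγ.embedding
  volume_ne_zero := hγ.volume_ne_zero
  mem := hmem

omit [TopologicalSpace N] [ChartedSpace (E d) N] [IsManifold 𝓘(ℝ, E d) ∞ N] [TopologicalSpace X]
  [ChartedSpace (E n) X] [IsManifold 𝓘(ℝ, E n) ∞ X] in
-- W(q, ·, p + π) differs from W(q, ·, p) by ⟨·, π⟩, whose derivative along D^ω at z is zero.
theorem mem_Z_shift (hn : 1 ≤ n) {x : X} {z : NVec n d} (hz : z ∈ Z om L (γ x))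
    (hπ : π x ∈ tangentAnnihilator om (γ x).pt z) : z ∈ Z om L (shift γ π x) := by
  refine ⟨hz.1, ?_⟩
  have h0 : HasFDerivWithinAt (fun z' => W L (γ x).pt z' (γ x).form) (0 : NVec n d →L[ℝ] ℝ)
    (planes om (γ x).pt) z := hz.2
  have h1 := HasFDerivWithinAt.add (𝕜 := ℝ) (E := NVec n d) (F := ℝ) h0
    (hasFDerivWithinAt_of_mem_tangentAnnihilator hn hz.1 hπ)
  rw [add_zero] at h1
  refine h1.congr_of_eventuallyEq (Eventually.of_forall fun z' => ?_) ?_ <;>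
  · simp only [W, LepageDedecker.shift, map_add, Pi.add_apply]
    ring

omit [TopologicalSpace X] [ChartedSpace (E n) X] [IsManifold 𝓘(ℝ, E n) ∞ X] in
-- The same z computes ℋ at both points, and ⟨z, ω⟩ = 1.
theorem hamiltonian_shift_volume (hM : LegendreCorrespondenceHypothesis om L M r)
    (hγ : ∀ x, γ x ∈ M) {c : X → ℝ} {x : X} (hmem : shift γ (fun x => c x • om (γ x).pt) x ∈ M)
    {z : NVec n d} (hz : z ∈ Z om L (γ x))
    (hz' : z ∈ Z om L (shift γ (fun x => c x • om (γ x).pt) x)) :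
    hamiltonian om L (shift γ (fun x => c x • om (γ x).pt) x) = hamiltonian om L (γ x) + c x := by
  rw [hamiltonian_eq (hM.connected _ hmem) (hM.submanifold _ hmem) hz',
    hamiltonian_eq (hM.connected _ (hγ x)) (hM.submanifold _ (hγ x)) hz]
  have h1 : z (om (γ x).pt) = 1 := hz.1.2
  simp only [W, LepageDedecker.shift, map_add, map_smul, h1, smul_eq_mul]
  ring

omit [IsManifold 𝓘(ℝ, E n) ∞ X] in
-- Along γ, ℋ is locally the composition with a smooth extension of it off ℳ. This makes (h - ℋ) ω a
-- smooth section, as the general shift requires.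
theorem contMDiff_hamiltonian (hn : 1 ≤ n) (hom : IsSpaceTimeVolume om)
    (hL : SmoothLagrangian om L) (hM : LegendreCorrespondenceHypothesis om L M r)
    (hγ : IsCurve om M γ) : ContMDiff 𝓘(ℝ, E n) 𝓘(ℝ, ℝ) ∞ (fun x => hamiltonian om L (γ x)) := by
  intro x
  obtain ⟨z₀, hz₀⟩ := (hM.connected _ (hγ.mem x)).nonempty
  obtain ⟨h, hh, hheq, -⟩ := hM.exists_localHamiltonian hn hom hL (hγ.mem x) hz₀
  have hc : ContMDiffAt 𝓘(ℝ, E n) 𝓘(ℝ, E d × Form n d) ∞ (fun y => coord (γ x).pt (γ y)) x :=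
    (ContMDiffAt.comp (g := extChartAt 𝓘(ℝ, E d) (γ x).pt) (f := fun x => (γ x).pt) x
      contMDiffAt_extChartAt hγ.smooth.1.contMDiffAt).prodMk_space (hγ.smooth.2 x)
  refine (ContMDiffAt.comp (g := h) (f := fun y => coord (γ x).pt (γ y)) x hh.contMDiffAt
    hc).congr_of_eventuallyEq ?_
  filter_upwards [hc.continuousAt.eventually hheq,
    hγ.smooth.1.continuous.continuousAt.preimage_mem_nhds
      (extChartAt_source_mem_nhds (I := 𝓘(ℝ, E d)) (γ x).pt)] with y hy hys
  rw [ofCoord_coord hys] at hy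
  exact hy (hγ.mem y)

omit [IsManifold 𝓘(ℝ, E n) ∞ X] in
theorem smoothForm_smul_volume (hom : IsSpaceTimeVolume om) (hγ : SmoothForm 𝓘(ℝ, E n) γ)
    {c : X → ℝ} (hc : ContMDiff 𝓘(ℝ, E n) 𝓘(ℝ, ℝ) ∞ c) :
    SmoothForm 𝓘(ℝ, E n) (fun x => (⟨(γ x).pt, c x • om (γ x).pt⟩ : FormBundle n d N)) :=
  ⟨hγ.1, fun x => (hc x).smul (hom.smooth.comp (fun _ => rfl) hγ.1.contMDiffAt
    (mem_extChartAt_source (γ x).pt))⟩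

omit [TopologicalSpace N] [ChartedSpace (E d) N] [IsManifold 𝓘(ℝ, E d) ∞ N] in
theorem smul_volume_mem_tangentAnnihilator (c : ℝ) {q : N} (z : NVec n d) :
    c • om q ∈ tangentAnnihilator om q z := fun ζ hζ => by
  rw [map_smul, volume_mem_tangentAnnihilator z ζ hζ, smul_zero]

end Shift

end LepageDedecker

end

/-! ### The theorem -/

open LepageDedecker in
theorem mainTheorem3 {n k : ℕ} (hn : 1 ≤ n) (hk : 1 ≤ k)
    {N : Type*} [TopologicalSpace N] [ChartedSpace (E (n + k)) N]
    [IsManifold 𝓘(ℝ, E (n + k)) ∞ N] [T2Space N] [SigmaCompactSpace N]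
    (om : N → Form n (n + k)) (hom : IsSpaceTimeVolume om)
    (L : N → NVec n (n + k) → ℝ) (hL : SmoothLagrangian om L)
    (M : Set (FormBundle n (n + k) N)) (r : ℕ)
    (hM : LegendreCorrespondenceHypothesis om L M r)
    {X : Type*} [TopologicalSpace X] [ChartedSpace (E n) X] [IsManifold 𝓘(ℝ, E n) ∞ X]
    [T2Space X] [SigmaCompactSpace X]
    (γ : X → FormBundle n (n + k) N) (hγ : IsCurve om M γ) (hcrit : IsCritical om L M γ) :
    (∀ x, planeAt om γ x ∈ Z om L (γ x)) ∧
    (∀ π : X → Form n (n + k),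
      SmoothForm 𝓘(ℝ, E n) (fun x => (⟨(γ x).pt, π x⟩ : FormBundle n (n + k) N)) →
      (∀ x, π x ∈ tangentAnnihilator om (γ x).pt (planeAt om γ x)) →
      (∀ x, shift γ π x ∈ M) →
      IsCurve om M (shift γ π) ∧ IsCritical om L M (shift γ π)) ∧
    (∀ h t : ℝ,
      (∀ x, shift γ (fun x => (t * (h - hamiltonian om L (γ x))) • om (γ x).pt) x ∈ M) →
      IsCurve om M (shift γ (fun x => (t * (h - hamiltonian om L (γ x))) • om (γ x).pt)) ∧
      IsCritical om L M (shift γ (fun x => (t * (h - hamiltonian om L (γ x))) • om (γ x).pt)) ∧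
      ∀ x, hamiltonian om L
          (shift γ (fun x => (t * (h - hamiltonian om L (γ x))) • om (γ x).pt) x) =
        (1 - t) * hamiltonian om L (γ x) + t * h) := by
  have hz := planeAt_mem hn hom hL hM hγ hcrit
  have hshift : ∀ π : X → Form n (n + k),
      SmoothForm 𝓘(ℝ, E n) (fun x => (⟨(γ x).pt, π x⟩ : FormBundle n (n + k) N)) →
      (∀ x, π x ∈ tangentAnnihilator om (γ x).pt (planeAt om γ x)) →
      (∀ x, shift γ π x ∈ M) →
      IsCurve om M (shift γ π) ∧ IsCritical om L M (shift γ π) := fun π hπ hann hmem =>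
    -- A shift changes only the forms, so the projections to N coincide by definition.
    ⟨hγ.shift hπ hmem, hcrit.congr_base hn hom hL hM hγ (hγ.shift hπ hmem) rfl hz
      fun x => mem_Z_shift hn (hz x) (hann x)⟩
  refine ⟨hz, hshift, fun h t hmem => ?_⟩
  have hann : ∀ x, (t * (h - hamiltonian om L (γ x))) • om (γ x).pt ∈
      tangentAnnihilator om (γ x).pt (planeAt om γ x) := fun x =>
    smul_volume_mem_tangentAnnihilator _ _
  obtain ⟨h1, h2⟩ := hshift _ (smoothForm_smul_volume hom hγ.smooth
    (contMDiff_const.mul (contMDiff_const.sub (contMDiff_hamiltonian hn hom hL hM hγ)))) hann hmem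
  refine ⟨h1, h2, fun x => ?_⟩
  rw [hamiltonian_shift_volume hM hγ.mem (hmem x) (hz x) (mem_Z_shift hn (hz x) (hann x))]
  ring
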